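/- Let $n\ge 3$. A \emph{Goursat structure} on a smooth $n$-manifold $M$ is a smooth rank two distribution $\mathcal D$ whose derived flag $\mathcal D^{(0)}=\mathcal D$, $\mathcal D^{(i+1)}=\mathcal D^{(i)}+[\mathcal D^{(i)},\mathcal D^{(i)}]$ satisfies $\dim\mathcal D^{(i)}(p)=i+2$ for $0\le i\le n-2$ and all $p\in M$. Let $\mathcal C_i$ denote the characteristic distribution of $\mathcal D^{(i+1)}$, i.e. the one generated by the vector fields $f\in\mathcal D^{(i+1)}$ with $[f,\mathcal D^{(i+1)}]\subset\mathcal D^{(i+1)}$ (for $0\le i\le n-4$). Put $S_0^{(i)}=\{p:\mathcal D^{(i)}(p)=\mathcal C_{i+1}(p)\}$ for $0\le i\le n-5$ and $S_0^{(i)}=\emptyset$ for $i\ge n-4$; for $1\le j\le i$ put $$S_j^{(i)}=\{p\in S_{j-1}^{(i)}:\ \mathcal D^{(i-j)}(p)\cap T_pS_{j-1}^{(i)}\ne\mathcal C_{i-j}(p)\},$$ and $S_j^{(i)}=\emptyset$ for $j\ge i+1$. The \emph{singularity type} of $\mathcal D$ at $p$ is the word $\delta_{\mathcal D}(p)=w_{n-4}\cdots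 w_0$ in the letters $a_0,a_1,\dots$, where $w_i=a_{j+1}$ if $p\in S_j^{(i+j)}$ for some $j\ge0$, and $w_i=a_0$ otherwise. The \emph{Jacquard languages} are $J_0=\{\epsilon\}$, $J_1=\{a_0\}$ and, for $m\ge2$, $J_m=J_{m-1}a_0\cup J_{m-1}a_1\cup J_{m-2}a_1a_2\cup\dots\cup J_1a_1a_2\cdots a_{m-1}$. A \emph{Kumpera--Ruiz normal form} is a pair of vector fields $\kappa^n=(\kappa^n_1,\kappa^n_2)$ on $\mathbb R^n$ obtained from $\kappa^3=(\partial_{x_3},\ x_3\partial_{x_2}+\partial_{x_1})$ by $n-3$ successive prolongations, each being either the regular one $R_c$, $c\in\mathbb R$: $\kappa^m_1=\partial_{x_m}$, $\kappa_2^m=(x_m+c)\kappa_1^{m-1}+\kappa_2^{m-1}$, or the singular one $S$: $\kappa_1^m=\partial_{x_m}$, $\kappa_2^m=\kappa_1^{m-1}+x_m\kappa_2^{m-1}$. Define $\delta_{\kappa^3}=\epsilon$, $\delta_{\kappa^4}=a_0$ and, for $m\ge5$: $\delta_{\kappa^m}=\delta_{\kappa^{m-1}}a_1$ if $\kappa^m=S(\kappa^{m-1})$;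 $\delta_{\kappa^m}=\delta_{\kappa^{m-1}}a_{i+1}$ if $\kappa^m=R_0(\kappa^{m-1})$ and $\delta_{\kappa^{m-1}}$ ends with $a_i$, $i\ge1$; $\delta_{\kappa^m}=\delta_{\kappa^{m-1}}a_0$ otherwise. Then the following hold. (1) For every Goursat structure on a smooth $n$-manifold $M$ and all integers $i,j\ge0$, the set $S_j^{(i)}$ is either empty or a smooth submanifold of $M$ of codimension $j+1$; and $S_j^{(i+j)}\cap S_k^{(i+k)}=\emptyset$ for all $i,j,k\ge0$ with $k\ne j$. Consequently the singularity type is well defined at every point. (2) Let $\mathcal D$ be the distribution on $\mathbb R^n$ spanned by a Kumpera--Ruiz normal form $\kappa^n$. Then $\mathcal D$ is a Goursat structure, $\delta_{\kappa^n}\in J_{n-3}$, and $\delta_{\mathcal D}(0)=\delta_{\kappa^n}$. For $0\le j\le i$ we have $0\in S_j^{(i)}$ if and only if $\delta_{\kappa^n}=w_1a_1a_2\cdots a_{j+1}w_2$ for some words $w_1,w_2$ with $|w_2|=i-j$. Moreover, whenever $0\in S_j^{(i)}$, $$S_j^{(i)}=\{x\in\mathbb R^n:\ x_{n-i}=\dots=x_{n-i+j}=0\}.$$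 (3) The singularity type at any point of any Goursat structure on a smooth $n$-manifold belongs to $J_{n-3}$. Conversely, every word of $J_{n-3}$ is the singularity type, at some point, of some Goursat structure on $\mathbb R^n$. -/

import Mathlib

open scoped Manifold ContDiff

universe u

noncomputable section

namespace Goursat

/-! ## Submanifolds -/

/-- `S` is a smooth (embedded) submanifold of codimension `k` of the `n`-manifold `M`: around each
of its points there is a chart of the smooth structure in which `S` is given by the vanishing of
exactly `k` of the coordinates. -/
def IsSubmanifoldOfCodim (n : ℕ) {M : Type*} [TopologicalSpace M]
    [ChartedSpace (EuclideanSpace ℝ (Fin n)) M] (S : Set M) (k : ℕ) : Prop :=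
  ∀ p ∈ S, ∃ e ∈ IsManifold.maximalAtlas (𝓡 n) ∞ M, p ∈ e.source ∧
    ∃ J : Finset (Fin n), J.card = k ∧ ∀ q ∈ e.source, q ∈ S ↔ ∀ a ∈ J, e q a = 0

/-- The tangent space `T_p S`, as a subspace of `T_p M`, of a subset `S` at a point `p`: the vectors
annihilated by the differentials at `p` of all smooth functions defined near `p` that vanish
on `S`. For a smooth submanifold `S` and `p ∈ S` this is the usual tangent space. -/
def tangentSpaceOf (n : ℕ) {M : Type*} [TopologicalSpace M]
    [ChartedSpace (EuclideanSpace ℝ (Fin n)) M] (S : Set M) (p : M) :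
    Submodule ℝ (TangentSpace (𝓡 n) p) where
  carrier := {v | ∀ U : Set M, IsOpen U → p ∈ U → ∀ f : M → ℝ,
    ContMDiffOn (𝓡 n) 𝓘(ℝ, ℝ) ∞ f U → (∀ q ∈ U ∩ S, f q = 0) →
      mfderiv (𝓡 n) 𝓘(ℝ, ℝ) f p v = 0}
  zero_mem' := by
    intro U _ _ f _ _
    exact map_zero _
  add_mem' := by
    intro v w hv hw U hU hp f hf h0
    rw [map_add, hv U hU hp f hf h0, hw U hU hp f hf h0, add_zero]
  smul_mem' := by
    intro c v hv U hU hp f hf h0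
    rw [map_smul, hv U hU hp f hf h0, smul_zero]

/-! ## Distributions, derived flags and characteristic distributions -/

section Manifold

variable {n : ℕ} {M : Type*} [TopologicalSpace M] [ChartedSpace (EuclideanSpace ℝ (Fin n)) M]

/-- A field of tangent subspaces on an `n`-manifold (no regularity yet). -/
abbrev SubspaceField (n : ℕ) (M : Type*) [TopologicalSpace M]
    [ChartedSpace (EuclideanSpace ℝ (Fin n)) M] : Type _ :=
  (p : M) → Submodule ℝ (TangentSpace (𝓡 n) p)

variable [IsManifold (𝓡 n) ∞ M]

/-- The vector field `X` is smooth on the set `U`. -/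
def SmoothFieldOn (X : (p : M) → TangentSpace (𝓡 n) p) (U : Set M) : Prop :=
  ContMDiffOn (𝓡 n) (𝓡 n).tangent ∞ (fun q => (⟨q, X q⟩ : TangentBundle (𝓡 n) M)) U

/-- `X` is a smooth local section over `U` of the field of subspaces `E`. -/
def IsSectionOn (E : SubspaceField n M) (U : Set M) (X : (p : M) → TangentSpace (𝓡 n) p) : Prop :=
  SmoothFieldOn X U ∧ ∀ q ∈ U, X q ∈ E q

/-- A smooth rank `k` distribution: it is locally spanned by `k` pointwise linearly independent
smooth vector fields. -/
def IsDistribution (k : ℕ) (D : SubspaceField n M) : Prop :=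
  ∀ p : M, ∃ U : Set M, IsOpen U ∧ p ∈ U ∧ ∃ X : Fin k → (q : M) → TangentSpace (𝓡 n) q,
    (∀ a, SmoothFieldOn (X a) U) ∧
    ∀ q ∈ U, LinearIndependent ℝ (fun a => X a q) ∧
      D q = Submodule.span ℝ (Set.range fun a => X a q)

/-- `E + [E, E]`: at `p` it is spanned by `E p` and the values at `p` of the Lie brackets of smooth
local sections of `E` defined near `p`. -/
def bracketSum (E : SubspaceField n M) : SubspaceField n M := fun p =>
  E p ⊔ Submodule.span ℝ {v | ∃ U : Set M, IsOpen U ∧ p ∈ U ∧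
    ∃ X Y : (q : M) → TangentSpace (𝓡 n) q, IsSectionOn E U X ∧ IsSectionOn E U Y ∧
      VectorField.mlieBracket (𝓡 n) X Y p = v}

/-- The derived flag `D^{(0)} = D`, `D^{(i+1)} = D^{(i)} + [D^{(i)}, D^{(i)}]`. -/
def derivedFlag (D : SubspaceField n M) : ℕ → SubspaceField n M
  | 0 => D
  | i + 1 => bracketSum (derivedFlag D i)

/-- A Goursat structure on an `n`-manifold: a rank two distribution with
`dim D^{(i)}(p) = i + 2` for `0 ≤ i ≤ n - 2` and all `p`. -/
def IsGoursat (D : SubspaceField n M) : Prop :=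
  IsDistribution 2 D ∧
    ∀ i : ℕ, i + 2 ≤ n → ∀ p : M, Module.finrank ℝ (derivedFlag D i p) = i + 2

/-- `X` is a characteristic vector field of `E` over `U`: a smooth section of `E` with
`[X, E] ⊆ E`. -/
def IsCharacteristicOn (E : SubspaceField n M) (U : Set M)
    (X : (p : M) → TangentSpace (𝓡 n) p) : Prop :=
  IsSectionOn E U X ∧ ∀ V : Set M, IsOpen V → V ⊆ U →
    ∀ Y : (q : M) → TangentSpace (𝓡 n) q, IsSectionOn E V Y →
      ∀ q ∈ V, VectorField.mlieBracket (𝓡 n) X Y q ∈ E q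

/-- The characteristic distribution of `E`: at `p` it is spanned by the values at `p` of the
characteristic vector fields of `E` defined near `p`. -/
def characteristicDistribution (E : SubspaceField n M) : SubspaceField n M := fun p =>
  Submodule.span ℝ {v | ∃ U : Set M, IsOpen U ∧ p ∈ U ∧
    ∃ X : (q : M) → TangentSpace (𝓡 n) q, IsCharacteristicOn E U X ∧ X p = v}

/-- `C_i`, the characteristic distribution of `D^{(i+1)}`. -/
def cartanDistribution (D : SubspaceField n M) (i : ℕ) : SubspaceField n M :=
  characteristicDistribution (derivedFlag D (i + 1))

/-! ## The canonical sets and the singularity type -/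

/-- The canonical set `S_j^{(i)}`. Here `S_0^{(i)} = {p : D^{(i)}(p) = C_{i+1}(p)}` for `i ≤ n - 5`
and `S_0^{(i)} = ∅` for `i ≥ n - 4`; for `1 ≤ j ≤ i`,
`S_j^{(i)} = {p ∈ S_{j-1}^{(i)} : D^{(i-j)}(p) ∩ T_p S_{j-1}^{(i)} ≠ C_{i-j}(p)}`,
and `S_j^{(i)} = ∅` for `j ≥ i + 1`. -/
def canonicalSet (D : SubspaceField n M) (i : ℕ) : ℕ → Set M
  | 0 => {p | i + 5 ≤ n ∧ derivedFlag D i p = cartanDistribution D (i + 1) p}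
  | j + 1 => {p | j + 1 ≤ i ∧ p ∈ canonicalSet D i j ∧
      derivedFlag D (i - (j + 1)) p ⊓ tangentSpaceOf n (canonicalSet D i j) p ≠
        cartanDistribution D (i - (j + 1)) p}

/-- The rule for the letter `w_i = a_l` (encoded by its index `l`) of the singularity type at `p`:
`l = j + 1` whenever `p ∈ S_j^{(i+j)}`, and `l = 0` if there is no such `j`. If `p` were in
`S_j^{(i+j)}` for two different `j`, no `l` would satisfy the rule. -/
def IsTypeLetter (D : SubspaceField n M) (p : M) (i l : ℕ) : Prop :=
  (∀ j : ℕ, p ∈ canonicalSet D (i + j) j → l = j + 1) ∧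
    ((∀ j : ℕ, p ∉ canonicalSet D (i + j) j) → l = 0)

/-- `w` is a singularity type of `D` at `p`: `w = w_{n-4} ⋯ w_0`, each `w_i` obeying the rule
`IsTypeLetter`. Words over `{a_0, a_1, …}` are lists of indices. -/
def IsSingularityType (D : SubspaceField n M) (p : M) (w : List ℕ) : Prop :=
  ∃ l : ℕ → ℕ, (∀ i, i + 4 ≤ n → IsTypeLetter D p i (l i)) ∧
    w = ((List.range (n - 3)).reverse).map l

end Manifold

/-! ## The Jacquard language -/

/-- The word `a_1 a_2 ⋯ a_k`. -/
def ascendingWord (k : ℕ) : List ℕ := List.range' 1 k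

/-- The Jacquard languages: `J_0 = {ε}`, `J_1 = {a_0}` and, for `m ≥ 2`,
`J_m = J_{m-1} a_0 ∪ J_{m-1} a_1 ∪ J_{m-2} a_1 a_2 ∪ ⋯ ∪ J_1 a_1 a_2 ⋯ a_{m-1}`. -/
def jacquard : ℕ → Set (List ℕ)
  | 0 => {[]}
  | 1 => {[0]}
  | m + 2 => {w | ∃ u ∈ jacquard (m + 1), w = u ++ [0]} ∪
      ⋃ k : Fin (m + 1), {w | ∃ u ∈ jacquard (m + 1 - k), w = u ++ ascendingWord (k + 1)}

/-! ## Kumpera–Ruiz normal forms -/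

/-- A sequence of prolongations `σ_{n-3} ∘ ⋯ ∘ σ_1` leading from dimension `3` to dimension `n`:
each step is the singular prolongation `S` or a regular prolongation `R_c`. -/
inductive KRSequence : ℕ → Type
  | base : KRSequence 3
  | singular {n : ℕ} (s : KRSequence n) : KRSequence (n + 1)
  | regular {n : ℕ} (c : ℝ) (s : KRSequence n) : KRSequence (n + 1)

/-- The lift of a vector field on `ℝ^n` to `ℝ^{n+1}`, by translation along the last axis. -/
def liftField {n : ℕ} (f : EuclideanSpace ℝ (Fin n) → EuclideanSpace ℝ (Fin n)) :
    EuclideanSpace ℝ (Fin (n + 1)) → EuclideanSpace ℝ (Fin (n + 1)) := fun x =>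
  WithLp.toLp 2 (Fin.snoc (α := fun _ => ℝ) (fun a => f (WithLp.toLp 2 fun b => x b.castSucc) a) 0)

/-- The Kumpera–Ruiz normal form `(κ_1, κ_2)` given by a sequence of prolongations. The
coordinates `x_1, …, x_n` are `x 0, …, x (n - 1)`. -/
def KRSequence.fields : {n : ℕ} → KRSequence n →
    (EuclideanSpace ℝ (Fin n) → EuclideanSpace ℝ (Fin n)) ×
      (EuclideanSpace ℝ (Fin n) → EuclideanSpace ℝ (Fin n))
  | _, .base =>
      (fun _ => EuclideanSpace.single 2 1,
       fun x => x 2 • EuclideanSpace.single 1 1 + EuclideanSpace.single 0 1)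
  | _, .singular s =>
      (fun _ => EuclideanSpace.single (Fin.last _) 1,
       fun x => liftField s.fields.1 x + x (Fin.last _) • liftField s.fields.2 x)
  | _, .regular c s =>
      (fun _ => EuclideanSpace.single (Fin.last _) 1,
       fun x => (x (Fin.last _) + c) • liftField s.fields.1 x + liftField s.fields.2 x)

/-- The distribution on `ℝ^n` spanned by a Kumpera–Ruiz normal form. -/
def KRSequence.distribution {n : ℕ} (s : KRSequence n) :
    SubspaceField n (EuclideanSpace ℝ (Fin n)) := fun x =>
  Submodule.span ℝ {(s.fields.1 x : TangentSpace (𝓡 n) x), (s.fields.2 x : TangentSpace (𝓡 n) x)}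

open Classical in
/-- The word `δ_κ` read off from the sequence of prolongations: `δ = ε` in dimension `3`, `δ = a_0`
in dimension `4`; after that, `S` appends `a_1`, `R_0` appends `a_{i+1}` if the preceding letter is
`a_i` with `i ≥ 1`, and in all other cases `a_0` is appended. -/
def KRSequence.word : {n : ℕ} → KRSequence n → List ℕ
  | _, .base => []
  | _, .singular .base => [0]
  | _, .regular _ .base => [0]
  | _, .singular s => s.word ++ [1]
  | _, .regular c s => s.word ++
      [match s.word.getLast? with
        | some (i + 1) => if c = 0 then i + 2 else 0
        | _ => 0]

end Goursat

end

/-! The basis is Cartan's lemma, `SmoothlySpanned.characteristicDistribution_bracketSum`. Let `E`,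
`E' = E + [E, E]` and `E'' = E' + [E', E']` have ranks `k`, `k + 1`, `k + 2`, and let `Y` be a
section of `E'` transverse to `E`. Then `X ↦ [X, Y]` mod `E'` is a nonzero tensorial map from `E` to
the line `E''/E'`, and its kernel is the characteristic distribution of `E'`. For a Goursat
structure this makes each `C_i` an involutive hyperplane of `D^{(i)}` with `C_i ⊂ C_{i+1}` and
`[C_i, D^{(i+1)}] ⊂ D^{(i+1)}`. As `D^{(i)}` is not involutive, every section `X` of it transverse
to `C_i` has a partner `Z` in `C_i` with `[Z, X] ∉ D^{(i)}`.

These facts produce local equations `h_0 = ⋯ = h_j = 0` of `S_j^{(i)}`. The function `h_0` measures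
how far `C_{i+1}` is from lying in `D^{(i)}`, and `h_{j+1} = X h_j`, where `X` is a section of
`D^{(i-j-1)}` transverse to `C_{i-j-1}`: as `C_{i-j-1}` is tangent to `S_j^{(i)}`, the next singular
set is where `X` becomes tangent as well. The partner `Z` of `X` satisfies `Z (X h_j) = dh_j [Z, X]
≠ 0` there, so the differentials remain independent (`IsGoursat.exists_localEquations_zero`,
`IsGoursat.exists_localEquations_succ`). The codimension follows. On `S_j^{(i)}` with `j ≥ 1` the
form `dh_{j-1}` kills `D^{(i-j)}` but not `C_{i-j+1}`, so these differ; since the sets are nested in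
`j`, this gives disjointness.

The Jacquard language consists of the words that begin with `a_0` and in which each `a_l`, `l ≥ 2`,
follows `a_{l-1}`; for singularity types this is the inclusion `S_{j+1}^{(i)} ⊂ S_j^{(i)}`.

For a Kumpera–Ruiz normal form everything is explicit: `D^{(i)}` is spanned by the last coordinate
fields and one truncated polynomial field, and `C_i` by coordinate fields alone. By induction on
`j`, the origin lies in `S_j^{(i)}` exactly when a singular step is followed by `j` steps `R_0`, and
the set is then a coordinate plane. Conversely, the letters of a Jacquard word dictate a sequence of
prolongations. -/

noncomputable section

namespace Goursat

open Set Topology VectorField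

/-! ### Smooth functions, vector fields and Lie brackets on open sets -/

section Calculus

variable {n : ℕ} {M : Type*} [TopologicalSpace M] [ChartedSpace (EuclideanSpace ℝ (Fin n)) M]

/-- A (not necessarily smooth) vector field on an `n`-manifold. -/
abbrev VField (n : ℕ) (M : Type*) [TopologicalSpace M]
    [ChartedSpace (EuclideanSpace ℝ (Fin n)) M] : Type _ :=
  (p : M) → TangentSpace (𝓡 n) p

/-- The function `f` is smooth on the set `U`. -/
def SmoothFunOn (n : ℕ) {M : Type*} [TopologicalSpace M]
    [ChartedSpace (EuclideanSpace ℝ (Fin n)) M] (f : M → ℝ) (U : Set M) : Prop :=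
  ContMDiffOn (𝓡 n) 𝓘(ℝ, ℝ) ∞ f U

/-- The derivative of the function `f` along the vector field `X`. -/
def derivAlong (X : VField n M) (f : M → ℝ) : M → ℝ := fun q => mvfderiv (𝓡 n) f q (X q)

lemma SmoothFunOn.mono {f : M → ℝ} {U V : Set M} (h : SmoothFunOn n f U) (hV : V ⊆ U) :
    SmoothFunOn n f V := ContMDiffOn.mono h hV

lemma SmoothFunOn.mdifferentiableAt {f : M → ℝ} {U : Set M} (h : SmoothFunOn n f U)
    (hU : IsOpen U) {q : M} (hq : q ∈ U) : MDifferentiableAt (𝓡 n) 𝓘(ℝ, ℝ) f q :=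
  (ContMDiffOn.contMDiffAt h (hU.mem_nhds hq)).mdifferentiableAt (by simp)

lemma SmoothFunOn.mul {f g : M → ℝ} {U : Set M} (hf : SmoothFunOn n f U)
    (hg : SmoothFunOn n g U) : SmoothFunOn n (f * g) U := ContMDiffOn.mul hf hg

lemma smoothFunOn_const (c : ℝ) (U : Set M) : SmoothFunOn n (fun _ : M => c) U :=
  contMDiffOn_const

lemma mlieBracket_congr' {X Y : VField n M} {U : Set M} {q : M} (hU : IsOpen U) (hq : q ∈ U) {X' Y' : VField n M}
    (hX : ∀ r ∈ U, X r = X' r) (hY : ∀ r ∈ U, Y r = Y' r) :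
    mlieBracket (𝓡 n) X Y q = mlieBracket (𝓡 n) X' Y' q :=
  Filter.EventuallyEq.mlieBracket_vectorField_eq
    (Filter.eventually_of_mem (hU.mem_nhds hq) hX) (Filter.eventually_of_mem (hU.mem_nhds hq) hY)

lemma two_le_infty : (2 : ℕ∞ω) ≤ ∞ := by
  have : ((2 : ℕ∞) : ℕ∞ω) ≤ ((⊤ : ℕ∞) : ℕ∞ω) := by exact_mod_cast le_top
  exact this

variable [IsManifold (𝓡 n) ∞ M] {X Y Z : VField n M} {U V : Set M} {q : M}

lemma SmoothFieldOn.mono (h : SmoothFieldOn X U) (hV : V ⊆ U) : SmoothFieldOn X V :=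
  ContMDiffOn.mono h hV

lemma SmoothFieldOn.contMDiffAt (h : SmoothFieldOn X U) (hU : IsOpen U) (hq : q ∈ U) :
    ContMDiffAt (𝓡 n) (𝓡 n).tangent ∞ (fun q => (⟨q, X q⟩ : TangentBundle (𝓡 n) M)) q :=
  ContMDiffOn.contMDiffAt h (hU.mem_nhds hq)

lemma SmoothFieldOn.mdifferentiableAt (h : SmoothFieldOn X U) (hU : IsOpen U) (hq : q ∈ U) :
    MDifferentiableAt (𝓡 n) (𝓡 n).tangent (fun q => (⟨q, X q⟩ : TangentBundle (𝓡 n) M)) q :=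
  (h.contMDiffAt hU hq).mdifferentiableAt (by simp)

lemma SmoothFieldOn.add (hX : SmoothFieldOn X U) (hY : SmoothFieldOn Y U) :
    SmoothFieldOn (X + Y) U := ContMDiffOn.add_section hX hY

lemma SmoothFieldOn.sub (hX : SmoothFieldOn X U) (hY : SmoothFieldOn Y U) :
    SmoothFieldOn (X - Y) U := ContMDiffOn.sub_section hX hY

lemma SmoothFieldOn.neg (hX : SmoothFieldOn X U) :
    SmoothFieldOn (-X) U := ContMDiffOn.neg_section hX

lemma SmoothFieldOn.smul {f : M → ℝ} (hX : SmoothFieldOn X U) (hf : SmoothFunOn n f U) :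
    SmoothFieldOn (f • X) U := ContMDiffOn.smul_section hf hX

lemma SmoothFieldOn.const_smul (c : ℝ) (hX : SmoothFieldOn X U) :
    SmoothFieldOn (c • X) U := ContMDiffOn.const_smul_section hX

lemma smoothFieldOn_zero : SmoothFieldOn (0 : VField n M) U :=
  (Bundle.contMDiff_zeroSection ℝ (TangentSpace (𝓡 n) : M → Type _)).contMDiffOn

lemma smoothFieldOn_sum {ι : Type*} (s : Finset ι) {X : ι → VField n M}
    (hX : ∀ a ∈ s, SmoothFieldOn (X a) U) : SmoothFieldOn (∑ a ∈ s, X a) U := by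
  classical
  induction s using Finset.induction_on with
  | empty => simpa using smoothFieldOn_zero
  | insert a s ha ih =>
    rw [Finset.sum_insert ha]
    exact (hX a (by simp)).add (ih fun b hb => hX b (by simp [hb]))

lemma SmoothFieldOn.mlieBracket (hU : IsOpen U) (hX : SmoothFieldOn X U)
    (hY : SmoothFieldOn Y U) : SmoothFieldOn (mlieBracket (𝓡 n) X Y) U := by
  intro q hq
  have : IsManifold (𝓡 n) (((⊤ : ℕ∞) : ℕ∞ω) + 1) M := by
    simpa using ‹IsManifold (𝓡 n) ∞ M›
  have : IsManifold (𝓡 n) (minSmoothness ℝ 2) M := by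
    simp only [minSmoothness_of_isRCLikeNormedField]; infer_instance
  have : IsManifold (𝓡 n) (minSmoothness ℝ 3) M := by
    simp only [minSmoothness_of_isRCLikeNormedField]; infer_instance
  exact (ContMDiffAt.mlieBracket_vectorField (m := ⊤) (n := ⊤) (hX.contMDiffAt hU hq)
    (hY.contMDiffAt hU hq) (by simp)).contMDiffWithinAt

lemma SmoothFieldOn.derivAlong (hU : IsOpen U) (hX : SmoothFieldOn X U) {f : M → ℝ}
    (hf : SmoothFunOn n f U) : SmoothFunOn n (derivAlong X f) U := by
  have h1 := (ContMDiffOn.contMDiffOn_tangentMapWithin (m := ∞) hf (by simp)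
    hU.uniqueMDiffOn)
  have h2 : ContMDiffOn (𝓡 n) 𝓘(ℝ, ℝ).tangent ∞
    (fun q => tangentMapWithin (𝓡 n) 𝓘(ℝ, ℝ) f U ⟨q, X q⟩) U :=
    h1.comp hX (fun q hq => hq)
  have h3 := (contMDiff_snd_tangentBundle_modelSpace (n := ∞) ℝ 𝓘(ℝ, ℝ)).comp_contMDiffOn h2
  refine h3.congr fun q hq => ?_
  simp only [Goursat.derivAlong, Function.comp, tangentMapWithin]
  rw [mfderivWithin_of_isOpen hU hq]
  rfl

lemma mlieBracket_smul_left' (hU : IsOpen U) (hq : q ∈ U) {f : M → ℝ} (hf : SmoothFunOn n f U)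
    (hX : SmoothFieldOn X U) :
    mlieBracket (𝓡 n) (f • X) Y q = - derivAlong Y f q • X q + f q • mlieBracket (𝓡 n) X Y q :=
  mlieBracket_smul_left (hf.mdifferentiableAt hU hq) (hX.mdifferentiableAt hU hq)

lemma mlieBracket_smul_right' (hU : IsOpen U) (hq : q ∈ U) {f : M → ℝ} (hf : SmoothFunOn n f U)
    (hX : SmoothFieldOn X U) :
    mlieBracket (𝓡 n) Y (f • X) q = derivAlong Y f q • X q + f q • mlieBracket (𝓡 n) Y X q :=
  mlieBracket_smul_right (hf.mdifferentiableAt hU hq) (hX.mdifferentiableAt hU hq)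

lemma mlieBracket_add_left' (hU : IsOpen U) (hq : q ∈ U) (hX : SmoothFieldOn X U)
    (hY : SmoothFieldOn Y U) :
    mlieBracket (𝓡 n) (X + Y) Z q = mlieBracket (𝓡 n) X Z q + mlieBracket (𝓡 n) Y Z q :=
  mlieBracket_add_left (hX.mdifferentiableAt hU hq) (hY.mdifferentiableAt hU hq)

lemma mlieBracket_add_right' (hU : IsOpen U) (hq : q ∈ U) (hX : SmoothFieldOn X U)
    (hY : SmoothFieldOn Y U) :
    mlieBracket (𝓡 n) Z (X + Y) q = mlieBracket (𝓡 n) Z X q + mlieBracket (𝓡 n) Z Y q :=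
  mlieBracket_add_right (hX.mdifferentiableAt hU hq) (hY.mdifferentiableAt hU hq)

lemma mlieBracket_neg_left' (hU : IsOpen U) (hq : q ∈ U) (hX : SmoothFieldOn X U) :
    mlieBracket (𝓡 n) (-X) Z q = - mlieBracket (𝓡 n) X Z q := by
  have := mlieBracket_const_smul_left (W := Z) (c := (-1 : ℝ)) (hX.mdifferentiableAt hU hq)
  rwa [neg_one_smul, neg_one_smul] at this

lemma mlieBracket_sub_left' (hU : IsOpen U) (hq : q ∈ U) (hX : SmoothFieldOn X U)
    (hY : SmoothFieldOn Y U) :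
    mlieBracket (𝓡 n) (X - Y) Z q = mlieBracket (𝓡 n) X Z q - mlieBracket (𝓡 n) Y Z q := by
  rw [sub_eq_add_neg, mlieBracket_add_left' hU hq hX hY.neg, mlieBracket_neg_left' hU hq hY,
    sub_eq_add_neg]

lemma jacobi' (hU : IsOpen U) (hq : q ∈ U) (hX : SmoothFieldOn X U)
    (hY : SmoothFieldOn Y U) (hZ : SmoothFieldOn Z U) :
    mlieBracket (𝓡 n) X (mlieBracket (𝓡 n) Y Z) q =
      mlieBracket (𝓡 n) (mlieBracket (𝓡 n) X Y) Z q +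
        mlieBracket (𝓡 n) Y (mlieBracket (𝓡 n) X Z) q := by
  have : IsManifold (𝓡 n) (minSmoothness ℝ 3) M := by
    simp only [minSmoothness_of_isRCLikeNormedField]; infer_instance
  refine leibniz_identity_mlieBracket_apply ?_ ?_ ?_
  · exact (hX.contMDiffAt hU hq).of_le (by simpa using two_le_infty)
  · exact (hY.contMDiffAt hU hq).of_le (by simpa using two_le_infty)
  · exact (hZ.contMDiffAt hU hq).of_le (by simpa using two_le_infty)

lemma exists_smoothField_extending (v : TangentSpace (𝓡 n) q) :
    ∃ U : Set M, IsOpen U ∧ q ∈ U ∧ ∃ Z : VField n M, SmoothFieldOn Z U ∧ Z q = v := by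
  obtain ⟨s, hs, h⟩ := FiberBundle.exists_contMDiffOn_extend (k := ∞) (𝓡 n) (EuclideanSpace ℝ (Fin n)) v
  obtain ⟨U, hUs, hU, hq⟩ := mem_nhds_iff.1 hs
  exact ⟨U, hU, hq, _, h.mono hUs, by simp⟩

/-- `[X, Y] f = X (Y f) - Y (X f)`, deduced from the Jacobi identity for `X`, `Y` and `f • Z`. -/
lemma derivAlong_mlieBracket (hU : IsOpen U) (hq : q ∈ U) (hX : SmoothFieldOn X U)
    (hY : SmoothFieldOn Y U) {f : M → ℝ} (hf : SmoothFunOn n f U) :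
    derivAlong (mlieBracket (𝓡 n) X Y) f q =
      derivAlong X (derivAlong Y f) q - derivAlong Y (derivAlong X f) q := by
  -- In dimension zero there is no nonzero `Z q` whose coefficient could be read off; both sides
  -- vanish.
  by_cases h0 : ∀ v : TangentSpace (𝓡 n) q, v = 0
  · simp only [derivAlong, h0 (mlieBracket (𝓡 n) X Y q), h0 (X q), h0 (Y q), map_zero, sub_zero]
  push Not at h0
  obtain ⟨v, hv⟩ := h0
  obtain ⟨V, hV, hqV, Z, hZ, hZq⟩ := exists_smoothField_extending v
  wlog hUV : U = V generalizing U V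
  · exact this (U := U ∩ V) (hU.inter hV) ⟨hq, hqV⟩ (hX.mono inter_subset_left) (hY.mono inter_subset_left)
      (hf.mono inter_subset_left) (U ∩ V) (hU.inter hV) ⟨hq, hqV⟩ (hZ.mono inter_subset_right) rfl
  subst hUV
  have key : ∀ {X Y : VField n M}, SmoothFieldOn X U → SmoothFieldOn Y U →
      mlieBracket (𝓡 n) X (mlieBracket (𝓡 n) Y (f • Z)) q =
        derivAlong X (derivAlong Y f) q • Z q + derivAlong Y f q • mlieBracket (𝓡 n) X Z q +
        (derivAlong X f q • mlieBracket (𝓡 n) Y Z q +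
          f q • mlieBracket (𝓡 n) X (mlieBracket (𝓡 n) Y Z) q) := by
    intro X Y hX hY
    rw [mlieBracket_congr' (X' := X) (Y' := derivAlong Y f • Z + f • mlieBracket (𝓡 n) Y Z) hU hq
      (fun _ _ => rfl) (fun r hr => mlieBracket_smul_right' hU hr hf hZ),
      mlieBracket_add_right' hU hq (hZ.smul (hY.derivAlong hU hf)) ((hY.mlieBracket hU hZ).smul hf),
      mlieBracket_smul_right' hU hq (hY.derivAlong hU hf) hZ,
      mlieBracket_smul_right' hU hq hf (hY.mlieBracket hU hZ)]
  have h := jacobi' hU hq hX hY (hZ.smul hf)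
  rw [key hX hY, key hY hX, mlieBracket_smul_right' hU hq hf hZ, jacobi' hU hq hX hY hZ] at h
  -- In the Jacobi identity for `X`, `Y`, `f • Z` all terms containing a bracket with `Z` cancel;
  -- what remains is the claimed difference times `Z q`.
  have h2 : (derivAlong (mlieBracket (𝓡 n) X Y) f q -
      (derivAlong X (derivAlong Y f) q - derivAlong Y (derivAlong X f) q)) • Z q = 0 := by
    rw [sub_smul, sub_smul, sub_eq_zero, eq_comm, sub_eq_iff_eq_add]
    rw [smul_add, ← sub_eq_zero] at h
    rw [← sub_eq_zero, ← h]
    abel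
  rw [hZq] at h2
  exact sub_eq_zero.1 ((smul_eq_zero.1 h2).resolve_right hv)

end Calculus

end Goursat

end

noncomputable section

namespace Goursat

open Set Topology VectorField

/-! ### Smooth covector fields and dual coframes -/

section Coframe

variable {n : ℕ} {M : Type*} [TopologicalSpace M] [ChartedSpace (EuclideanSpace ℝ (Fin n)) M]

lemma smoothFunOn_sum {ι : Type*} (s : Finset ι) {f : ι → M → ℝ} {U : Set M}
    (hf : ∀ a ∈ s, SmoothFunOn n (f a) U) : SmoothFunOn n (fun q => ∑ a ∈ s, f a q) U :=
  contMDiffOn_finsetSum hf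

lemma smoothFunOn_prod {ι : Type*} (s : Finset ι) {f : ι → M → ℝ} {U : Set M}
    (hf : ∀ a ∈ s, SmoothFunOn n (f a) U) : SmoothFunOn n (fun q => ∏ a ∈ s, f a q) U :=
  contMDiffOn_finsetProd hf

lemma smoothFunOn_det {ι : Type*} [Fintype ι] [DecidableEq ι] {A : M → Matrix ι ι ℝ} {U : Set M}
    (hA : ∀ a b, SmoothFunOn n (fun q => A q a b) U) :
    SmoothFunOn n (fun q => (A q).det) U := by
  simp only [Matrix.det_apply']
  exact smoothFunOn_sum _ fun σ _ => (smoothFunOn_const _ U).mul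
    (smoothFunOn_prod _ fun a _ => hA _ _)

lemma SmoothFunOn.inv {f : M → ℝ} {U : Set M} (hf : SmoothFunOn n f U)
    (h0 : ∀ q ∈ U, f q ≠ 0) : SmoothFunOn n (fun q => (f q)⁻¹) U := by
  intro q hq
  have h : ContMDiffAt 𝓘(ℝ, ℝ) 𝓘(ℝ, ℝ) ∞ (fun x : ℝ => x⁻¹) (f q) :=
    (contDiffAt_inv ℝ (h0 q hq)).contMDiffAt
  exact h.comp_contMDiffWithinAt q (hf q hq)

lemma SmoothFunOn.isOpen_ne_zero {f : M → ℝ} {U : Set M} (hf : SmoothFunOn n f U)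
    (hU : IsOpen U) : IsOpen {q | q ∈ U ∧ f q ≠ 0} := by
  have := ContMDiffOn.continuousOn hf
  exact this.isOpen_inter_preimage hU isOpen_compl_singleton

lemma smoothFunOn_inv_apply {ι : Type*} [Fintype ι] [DecidableEq ι] {A : M → Matrix ι ι ℝ}
    {U : Set M} (hA : ∀ a b, SmoothFunOn n (fun q => A q a b) U) (h0 : ∀ q ∈ U, (A q).det ≠ 0)
    (a b : ι) : SmoothFunOn n (fun q => (A q)⁻¹ a b) U := by
  simp only [Matrix.inv_def, Ring.inverse_eq_inv', Matrix.smul_apply, smul_eq_mul,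
    Matrix.adjugate_apply]
  refine ((smoothFunOn_det hA).inv h0).mul (smoothFunOn_det fun c d => ?_)
  by_cases hc : c = b
  · subst hc
    simpa using smoothFunOn_const _ U
  · simpa [Matrix.updateRow_ne hc] using hA c d

variable [IsManifold (𝓡 n) ∞ M]

/-- The field of covectors `l` is smooth on `U`. -/
def SmoothCovectorOn (l : (q : M) → TangentSpace (𝓡 n) q →ₗ[ℝ] ℝ) (U : Set M) : Prop :=
  ∀ V : Set M, IsOpen V → V ⊆ U → ∀ Y : VField n M, SmoothFieldOn Y V →
    SmoothFunOn n (fun q => l q (Y q)) V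

lemma SmoothCovectorOn.mono {l : (q : M) → TangentSpace (𝓡 n) q →ₗ[ℝ] ℝ} {U V : Set M}
    (h : SmoothCovectorOn l U) (hV : V ⊆ U) : SmoothCovectorOn l V :=
  fun W hW hWV => h W hW (hWV.trans hV)

lemma smoothCovectorOn_sum {ι : Type*} [Fintype ι] {f : ι → M → ℝ}
    {l : ι → (q : M) → TangentSpace (𝓡 n) q →ₗ[ℝ] ℝ} {U : Set M}
    (hf : ∀ a, SmoothFunOn n (f a) U) (hl : ∀ a, SmoothCovectorOn (l a) U) :
    SmoothCovectorOn (fun q => ∑ a, f a q • l a q) U := by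
  intro V hV hVU Y hY
  simp only [LinearMap.sum_apply, LinearMap.smul_apply, smul_eq_mul]
  exact smoothFunOn_sum _ fun a _ => ((hf a).mono hVU).mul (hl a V hV hVU Y hY)

lemma exists_covector_extending {p : M} (φ : TangentSpace (𝓡 n) p →ₗ[ℝ] ℝ) :
    ∃ U : Set M, IsOpen U ∧ p ∈ U ∧ ∃ l : (q : M) → TangentSpace (𝓡 n) q →ₗ[ℝ] ℝ,
      SmoothCovectorOn l U ∧ l p = φ := by
  let e := trivializationAt (EuclideanSpace ℝ (Fin n)) (TangentSpace (𝓡 n) : M → Type _) p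
  let b := (EuclideanSpace.basisFun (Fin n) ℝ).toBasis
  have hp : p ∈ e.baseSet := FiberBundle.mem_baseSet_trivializationAt' p
  refine ⟨e.baseSet, e.open_baseSet, hp,
    fun q => ∑ i, φ (e.localFrame b i p) • e.localFrameCoeff (𝓡 n) b i q,
    smoothCovectorOn_sum (fun _ => smoothFunOn_const _ _) fun i V hV hVe Y hY =>
      contMDiffOn_localFrameCoeff (e := e) b hV hVe hY i, ?_⟩
  ext v
  have := e.eq_sum_localFrameCoeff_smul (I := 𝓡 n) (b := b)
    (s := FiberBundle.extend (EuclideanSpace ℝ (Fin n)) v) hp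
  simp only [FiberBundle.extend_apply_self] at this
  conv_rhs => rw [this, map_sum]
  simp [mul_comm]

/-- Extend functionals dual to the vectors at `p` to smooth covectors `l a`. The matrix `l a (X b)`
is the identity at `p`, hence invertible nearby, and its inverse, smooth by Cramer's rule, corrects
the `l a` to an exact dual family. Duality off `p` gives independence near `p` and smooth
coefficients. -/
lemma exists_dual_coframe {ι : Type*} [Finite ι] {X : ι → VField n M} {U : Set M} (hU : IsOpen U)
    {p : M} (hp : p ∈ U) (hX : ∀ a, SmoothFieldOn (X a) U)
    (hi : LinearIndependent ℝ fun a => X a p) :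
    ∃ V ⊆ U, IsOpen V ∧ p ∈ V ∧ ∃ c : ι → (q : M) → TangentSpace (𝓡 n) q →ₗ[ℝ] ℝ,
      (∀ a, SmoothCovectorOn (c a) V) ∧ ∀ q ∈ V, ∀ a, c a q (X a q) = 1 ∧
        ∀ b, b ≠ a → c a q (X b q) = 0 := by
  classical
  have := Fintype.ofFinite ι
  have hφ : ∀ a, ∃ φ : TangentSpace (𝓡 n) p →ₗ[ℝ] ℝ, ∀ b, φ (X b p) = if a = b then 1 else 0 := by
    intro a
    obtain ⟨φ, hφ⟩ := ((Module.Basis.span hi).coord a).exists_extend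
    refine ⟨φ, fun b => ?_⟩
    have h := LinearMap.congr_fun hφ (Module.Basis.span hi b)
    rw [LinearMap.comp_apply, Submodule.subtype_apply, Module.Basis.span_apply] at h
    simp [h, Finsupp.single_apply, eq_comm]
  choose φ hφ using hφ
  choose W hW hpW l hl hlp using fun a => exists_covector_extending (φ a)
  let A : M → Matrix ι ι ℝ := fun q a b => l a q (X b q)
  let U' := U ∩ ⋂ a, W a
  have hU' : IsOpen U' := hU.inter (isOpen_iInter_of_finite hW)
  have hA : ∀ a b, SmoothFunOn n (fun q => A q a b) U' := fun a b =>
    hl a U' hU' (inter_subset_right.trans (iInter_subset _ a)) _ ((hX b).mono inter_subset_left)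
  let V := {q | q ∈ U' ∧ (A q).det ≠ 0}
  have hV : IsOpen V := (smoothFunOn_det hA).isOpen_ne_zero hU'
  have hVU' : V ⊆ U' := fun q hq => hq.1
  have hAp : A p = 1 := by
    ext a b
    simp [A, hlp, hφ, Matrix.one_apply]
  refine ⟨V, fun q hq => hq.1.1, hV, ⟨⟨hp, mem_iInter.2 hpW⟩, by simp [hAp]⟩,
    fun a q => ∑ b, (A q)⁻¹ a b • l b q, fun a => smoothCovectorOn_sum
      (fun b => smoothFunOn_inv_apply (fun c d => (hA c d).mono hVU') (fun q hq => hq.2) a b)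
      (fun b => (hl b).mono (hVU'.trans (inter_subset_right.trans (iInter_subset _ b)))),
    fun q hq a => ?_⟩
  have hinv : ∀ b, (∑ d, (A q)⁻¹ a d • l d q) (X b q) = (1 : Matrix ι ι ℝ) a b := by
    intro b
    rw [← Matrix.nonsing_inv_mul (A q) (isUnit_iff_ne_zero.2 hq.2), Matrix.mul_apply]
    simp [A]
  refine ⟨by rw [hinv]; simp, fun b hb => by rw [hinv, Matrix.one_apply_ne hb.symm]⟩

end Coframe

end Goursat

end

noncomputable section

namespace Goursat

open Set Topology VectorField

/-! ### Sections of fields of subspaces, local frames and the bracket sum -/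

section Sections

variable {n : ℕ} {M : Type*} [TopologicalSpace M] [ChartedSpace (EuclideanSpace ℝ (Fin n)) M]

instance (q : M) : FiniteDimensional ℝ (TangentSpace (𝓡 n) q) :=
  inferInstanceAs (FiniteDimensional ℝ (EuclideanSpace ℝ (Fin n)))

lemma mlieBracket_mem_swap {X Y : VField n M} {q : M} {S : Submodule ℝ (TangentSpace (𝓡 n) q)}
    (h : mlieBracket (𝓡 n) Y X q ∈ S) : mlieBracket (𝓡 n) X Y q ∈ S := by
  rw [mlieBracket_swap_apply]
  exact S.neg_mem h

variable [IsManifold (𝓡 n) ∞ M] {E F : SubspaceField n M} {X Y W : VField n M} {U V : Set M} {p q : M}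

lemma IsSectionOn.mono (h : IsSectionOn E U X) (hV : V ⊆ U) : IsSectionOn E V X :=
  ⟨h.1.mono hV, fun q hq => h.2 q (hV hq)⟩

lemma IsSectionOn.of_le (h : IsSectionOn E U X) (hEF : ∀ q ∈ U, E q ≤ F q) : IsSectionOn F U X :=
  ⟨h.1, fun q hq => hEF q hq (h.2 q hq)⟩

lemma IsSectionOn.add (hX : IsSectionOn E U X) (hY : IsSectionOn E U Y) :
    IsSectionOn E U (X + Y) :=
  ⟨hX.1.add hY.1, fun q hq => (E q).add_mem (hX.2 q hq) (hY.2 q hq)⟩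

lemma IsSectionOn.sub (hX : IsSectionOn E U X) (hY : IsSectionOn E U Y) :
    IsSectionOn E U (X - Y) :=
  ⟨hX.1.sub hY.1, fun q hq => (E q).sub_mem (hX.2 q hq) (hY.2 q hq)⟩

lemma IsSectionOn.smul (hX : IsSectionOn E U X) {f : M → ℝ} (hf : SmoothFunOn n f U) :
    IsSectionOn E U (f • X) :=
  ⟨hX.1.smul hf, fun q hq => (E q).smul_mem _ (hX.2 q hq)⟩

lemma IsSectionOn.const_smul (hX : IsSectionOn E U X) (c : ℝ) :
    IsSectionOn E U (c • X) :=
  ⟨hX.1.const_smul c, fun q hq => (E q).smul_mem _ (hX.2 q hq)⟩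

lemma isSectionOn_sum {ι : Type*} (s : Finset ι) {X : ι → VField n M}
    (hX : ∀ a ∈ s, IsSectionOn E U (X a)) : IsSectionOn E U (∑ a ∈ s, X a) :=
  ⟨smoothFieldOn_sum s fun a ha => (hX a ha).1, fun q hq => by
    rw [Finset.sum_apply]
    exact (E q).sum_mem fun a ha => (hX a ha).2 q hq⟩

/-- Every vector of `E` is a value of a smooth local section of `E`. -/
def SmoothlySpanned (E : SubspaceField n M) : Prop :=
  ∀ p, ∀ v ∈ E p, ∃ U : Set M, IsOpen U ∧ p ∈ U ∧ ∃ X, IsSectionOn E U X ∧ X p = v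

/-- It suffices to extend a spanning set of vectors. -/
lemma SmoothlySpanned.of_span (S : (p : M) → Set (TangentSpace (𝓡 n) p))
    (hS : ∀ p, E p = Submodule.span ℝ (S p))
    (h : ∀ p, ∀ v ∈ S p, ∃ U : Set M, IsOpen U ∧ p ∈ U ∧ ∃ X, IsSectionOn E U X ∧ X p = v) :
    SmoothlySpanned E := by
  intro p v hv
  rw [hS p] at hv
  induction hv using Submodule.span_induction with
  | mem v hv => exact h p v hv
  | zero => exact ⟨univ, isOpen_univ, mem_univ _, 0,
      ⟨smoothFieldOn_zero, fun q _ => (E q).zero_mem⟩, rfl⟩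
  | add v w _ _ hv hw =>
    obtain ⟨U, hU, hp, X, hX, rfl⟩ := hv
    obtain ⟨V, hV, hp', Y, hY, rfl⟩ := hw
    exact ⟨U ∩ V, hU.inter hV, ⟨hp, hp'⟩, X + Y,
      (hX.mono inter_subset_left).add (hY.mono inter_subset_right), rfl⟩
  | smul c v _ hv =>
    obtain ⟨U, hU, hp, X, hX, rfl⟩ := hv
    exact ⟨U, hU, hp, c • X, hX.const_smul c, rfl⟩

lemma linearIndependent_of_dual {K N ι : Type*} [Field K] [AddCommGroup N] [Module K N]
    {e : ι → N} {c : ι → N →ₗ[K] K} (h : ∀ a, c a (e a) = 1 ∧ ∀ b, b ≠ a → c a (e b) = 0) :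
    LinearIndependent K e := by
  rw [linearIndependent_iff']
  intro s g hg a ha
  have := congrArg (c a) hg
  rw [map_sum, Finset.sum_eq_single a] at this
  · simpa [(h a).1] using this
  · intro b _ hb
    simp [(h a).2 b hb]
  · exact fun h => absurd ha h

lemma eq_sum_of_dual {K N ι : Type*} [Field K] [AddCommGroup N] [Module K N] [Fintype ι]
    {e : ι → N} {c : ι → N →ₗ[K] K} (h : ∀ a, c a (e a) = 1 ∧ ∀ b, b ≠ a → c a (e b) = 0)
    {v : N} (hv : v ∈ Submodule.span K (Set.range e)) : v = ∑ a, c a v • e a := by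
  obtain ⟨r, rfl⟩ := (Submodule.mem_span_range_iff_exists_fun K).1 hv
  refine Finset.sum_congr rfl fun a _ => ?_
  congr 1
  rw [map_sum, Finset.sum_eq_single a]
  · simp [(h a).1]
  · intro b _ hb
    simp [(h a).2 b hb]
  · simp

lemma mem_span_of_dual {K N : Type*} [Field K] [AddCommGroup N] [Module K N] {k : ℕ}
    {e : Fin k → N} {c : Fin k → N →ₗ[K] K}
    (h : ∀ a, c a (e a) = 1 ∧ ∀ b, b ≠ a → c a (e b) = 0) {S : Submodule K N}
    [FiniteDimensional K N] (hS : Module.finrank K S = k) (he : ∀ a, e a ∈ S) :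
    S = Submodule.span K (Set.range e) := by
  symm
  refine Submodule.eq_of_le_of_finrank_eq (Submodule.span_le.2 ?_) ?_
  · rintro _ ⟨a, rfl⟩
    exact he a
  · rw [finrank_span_eq_card (linearIndependent_of_dual h), hS, Fintype.card_fin]

lemma SmoothlySpanned.exists_sections (hE : SmoothlySpanned E) {k : ℕ} (p : M)
    (hk : Module.finrank ℝ (E p) = k) :
    ∃ V : Set M, IsOpen V ∧ p ∈ V ∧ ∃ e : Fin k → VField n M, (∀ a, IsSectionOn E V (e a)) ∧
      LinearIndependent ℝ (fun a => e a p) := by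
  let b := Module.finBasisOfFinrankEq ℝ (E p) hk
  choose U hU hp X hX hXp using fun a => hE p (b a) (b a).2
  refine ⟨⋂ a, U a, isOpen_iInter_of_finite hU, mem_iInter.2 hp, X,
    fun a => (hX a).mono (iInter_subset _ a), ?_⟩
  simp only [hXp]
  exact b.linearIndependent.map' (E p).subtype (Submodule.ker_subtype _)

/-- A local frame of `E` near `p` and smooth covectors computing the coefficients in this frame. -/
lemma SmoothlySpanned.exists_frame (hE : SmoothlySpanned E) {k : ℕ}
    (hk : ∀ q, Module.finrank ℝ (E q) = k) (p : M) :
    ∃ V : Set M, IsOpen V ∧ p ∈ V ∧ ∃ e : Fin k → VField n M, (∀ a, IsSectionOn E V (e a)) ∧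
      ∃ c : Fin k → (q : M) → TangentSpace (𝓡 n) q →ₗ[ℝ] ℝ, (∀ a, SmoothCovectorOn (c a) V) ∧
        ∀ q ∈ V, ∀ v ∈ E q, v = ∑ a, c a q v • e a q := by
  obtain ⟨U, hU, hp, e, he, hi⟩ := hE.exists_sections p (hk p)
  -- Near `p` the dual coframe keeps the sections independent; as the rank of `E` is constant, they
  -- still span it.
  obtain ⟨V, hVU, hV, hpV, c, hc, hce⟩ := exists_dual_coframe hU hp (fun a => (he a).1) hi
  refine ⟨V, hV, hpV, e, fun a => (he a).mono hVU, c, hc, fun q hq v hv => ?_⟩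
  rw [mem_span_of_dual (hce q hq) (hk q) fun a => (he a).2 q (hVU hq)] at hv
  exact eq_sum_of_dual (hce q hq) hv

/-- A smooth covector field that vanishes on `E` and is `1` on a field transverse to `E`. -/
lemma SmoothlySpanned.exists_covector (hE : SmoothlySpanned E) {k : ℕ}
    (hk : ∀ q, Module.finrank ℝ (E q) = k) (hU : IsOpen U) (hp : p ∈ U)
    (hW : SmoothFieldOn W U) (hWp : W p ∉ E p) :
    ∃ V ⊆ U, IsOpen V ∧ p ∈ V ∧ ∃ l : (q : M) → TangentSpace (𝓡 n) q →ₗ[ℝ] ℝ,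
      SmoothCovectorOn l V ∧ ∀ q ∈ V, l q (W q) = 1 ∧ ∀ v ∈ E q, l q v = 0 := by
  obtain ⟨V, hV, hpV, e, he, hi⟩ := hE.exists_sections p (hk p)
  have hspan : Submodule.span ℝ (Set.range fun a => e a p) ≤ E p := by
    rw [Submodule.span_le]
    rintro _ ⟨a, rfl⟩
    exact (he a).2 p hpV
  -- Adjoin `W` to a frame of `E`; the covector dual to `W` in this larger family is the one sought.
  let X : Option (Fin k) → VField n M := fun o => o.elim W e
  have hX : LinearIndependent ℝ fun o => X o p := by
    rw [linearIndependent_option]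
    exact ⟨hi, fun h => hWp (hspan h)⟩
  obtain ⟨V', hV'U, hV', hpV', c, hc, hce⟩ := exists_dual_coframe (hU.inter hV) ⟨hp, hpV⟩
    (X := X) (by
      rintro (_ | a)
      · exact hW.mono inter_subset_left
      · exact (he a).1.mono inter_subset_right) hX
  refine ⟨V', hV'U.trans inter_subset_left, hV', hpV', c none, hc none, fun q hq =>
    ⟨(hce q hq none).1, fun v hv => ?_⟩⟩
  have hd : ∀ a, c (some a) q (e a q) = 1 ∧ ∀ b, b ≠ a → c (some a) q (e b q) = 0 := fun a =>
    ⟨(hce q hq (some a)).1, fun b hb => (hce q hq (some a)).2 (some b) (by simpa using hb)⟩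
  rw [mem_span_of_dual hd (hk q) fun a => (he a).2 q (hV'U hq).2] at hv
  rw [eq_sum_of_dual hd hv, map_sum]
  refine Finset.sum_eq_zero fun a _ => ?_
  have h0 : c none q (e a q) = 0 := (hce q hq none).2 (some a) (by simp)
  rw [map_smul, h0, smul_zero]

/-- If `l` vanishes on a hyperplane `S` of `T` but not at `w ∈ T`, it computes the component along
`w` modulo `S`. -/
lemma sub_smul_mem_of_finrank_succ {N : Type*} [AddCommGroup N] [Module ℝ N]
    [FiniteDimensional ℝ N] {S T : Submodule ℝ N} (hST : S ≤ T)
    (hk : Module.finrank ℝ T = Module.finrank ℝ S + 1) {w : N} (hw : w ∈ T) {l : N →ₗ[ℝ] ℝ}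
    (hl : l w = 1) (hS : ∀ v ∈ S, l v = 0) {v : N} (hv : v ∈ T) : v - l v • w ∈ S := by
  have hle : S ≤ T ⊓ LinearMap.ker l := le_inf hST fun v hv => hS v hv
  have hlt : T ⊓ LinearMap.ker l < T :=
    lt_of_le_of_ne inf_le_left fun h => by
      have : w ∈ T ⊓ LinearMap.ker l := by rwa [h]
      rw [Submodule.mem_inf, LinearMap.mem_ker, hl] at this
      exact one_ne_zero this.2
  have := Submodule.finrank_lt_finrank_of_lt hlt
  have h2 := Submodule.finrank_mono hle
  rw [Submodule.eq_of_le_of_finrank_eq hle (by omega)]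
  refine ⟨T.sub_mem hv (T.smul_mem _ hw), ?_⟩
  simp [hl]

lemma mlieBracket_sum_left {ι : Type*} (s : Finset ι) {X : ι → VField n M} (hU : IsOpen U)
    (hq : q ∈ U) (hX : ∀ a ∈ s, SmoothFieldOn (X a) U) :
    mlieBracket (𝓡 n) (∑ a ∈ s, X a) Y q = ∑ a ∈ s, mlieBracket (𝓡 n) (X a) Y q := by
  classical
  induction s using Finset.induction_on with
  | empty => simp
  | insert a s ha ih =>
    rw [Finset.sum_insert ha, Finset.sum_insert ha, mlieBracket_add_left' hU hq (hX a (by simp))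
      (smoothFieldOn_sum s fun b hb => hX b (by simp [hb])), ih fun b hb => hX b (by simp [hb])]

/-- A bracket with a combination of the fields `e a`. -/
lemma mlieBracket_mem_of_eq_sum {ι : Type*} [Fintype ι] (hU : IsOpen U) (hq : q ∈ U)
    {e : ι → VField n M} {f : ι → M → ℝ} (he : ∀ a, SmoothFieldOn (e a) U)
    (hf : ∀ a, SmoothFunOn n (f a) U) (hX : ∀ r ∈ U, X r = ∑ a, f a r • e a r)
    {S : Submodule ℝ (TangentSpace (𝓡 n) q)} (hS : ∀ a, e a q ∈ S)
    (h : ∀ a, f a q • mlieBracket (𝓡 n) (e a) Y q ∈ S) : mlieBracket (𝓡 n) X Y q ∈ S := by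
  rw [mlieBracket_congr' (X' := ∑ a, f a • e a) (Y' := Y) hU hq
    (fun r hr => by simp [hX r hr, Finset.sum_apply]) (fun _ _ => rfl),
    mlieBracket_sum_left _ hU hq fun a _ => (he a).smul (hf a)]
  refine S.sum_mem fun a _ => ?_
  rw [mlieBracket_smul_left' hU hq (hf a) (he a)]
  exact S.add_mem (S.smul_mem _ (hS a)) (h a)

/-- Modulo `E`, the bracket of sections of `E` is tensorial. -/
lemma SmoothlySpanned.mlieBracket_mem_of_eq_zero (hE : SmoothlySpanned E) {k : ℕ}
    (hk : ∀ q, Module.finrank ℝ (E q) = k) (hU : IsOpen U) (hq : q ∈ U)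
    (hX : IsSectionOn E U X) (h0 : X q = 0) : mlieBracket (𝓡 n) X Y q ∈ E q := by
  obtain ⟨V, hV, hqV, e, he, c, hc, hce⟩ := hE.exists_frame hk q
  -- The coefficients of `X` in a frame vanish at `q`, so by the Leibniz rule only multiples of the
  -- frame itself survive.
  refine mlieBracket_mem_of_eq_sum (hU.inter hV) ⟨hq, hqV⟩
    (fun a => (he a).1.mono inter_subset_right)
    (fun a => hc a _ (hU.inter hV) inter_subset_right X (hX.1.mono inter_subset_left))
    (fun r hr => hce r hr.2 _ (hX.2 r hr.1)) (fun a => (he a).2 q hqV) fun a => ?_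
  simp [h0]

lemma le_bracketSum (E : SubspaceField n M) (q : M) : E q ≤ bracketSum E q := le_sup_left

lemma mlieBracket_mem_bracketSum (hU : IsOpen U) (hq : q ∈ U) (hX : IsSectionOn E U X)
    (hY : IsSectionOn E U Y) : mlieBracket (𝓡 n) X Y q ∈ bracketSum E q :=
  Submodule.mem_sup_right (Submodule.subset_span ⟨U, hU, hq, X, Y, hX, hY, rfl⟩)

lemma IsSectionOn.mlieBracket (hU : IsOpen U) (hX : IsSectionOn E U X) (hY : IsSectionOn E U Y) :
    IsSectionOn (bracketSum E) U (mlieBracket (𝓡 n) X Y) :=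
  ⟨hX.1.mlieBracket hU hY.1, fun _ hq => mlieBracket_mem_bracketSum hU hq hX hY⟩

lemma SmoothlySpanned.bracketSum (hE : SmoothlySpanned E) : SmoothlySpanned (bracketSum E) := by
  refine SmoothlySpanned.of_span (fun p => (E p : Set _) ∪ {v | ∃ U : Set M, IsOpen U ∧ p ∈ U ∧
    ∃ X Y : (q : M) → TangentSpace (𝓡 n) q, IsSectionOn E U X ∧ IsSectionOn E U Y ∧
      VectorField.mlieBracket (𝓡 n) X Y p = v}) (fun p => ?_) fun p v hv => ?_
  · rw [Submodule.span_union, Submodule.span_eq]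
    rfl
  · rcases hv with hv | ⟨U, hU, hp, X, Y, hX, hY, rfl⟩
    · obtain ⟨U, hU, hp, X, hX, hXp⟩ := hE p v hv
      exact ⟨U, hU, hp, X, hX.of_le fun q _ => le_bracketSum E q, hXp⟩
    · exact ⟨U, hU, hp, _, hX.mlieBracket hU hY, rfl⟩

/-- The brackets of a local frame of `E` span `E + [E, E]` modulo `E`. -/
lemma bracketSum_le_of_frame {ι : Type*} [Finite ι] (hU : IsOpen U) (hq : q ∈ U)
    {e : ι → VField n M} (he : ∀ a, SmoothFieldOn (e a) U)
    (hi : LinearIndependent ℝ fun a => e a q)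
    (hE : ∀ r ∈ U, E r = Submodule.span ℝ (Set.range fun a => e a r))
    {S : Submodule ℝ (TangentSpace (𝓡 n) q)} (hS : ∀ a, e a q ∈ S)
    (h : ∀ a b, mlieBracket (𝓡 n) (e a) (e b) q ∈ S) : bracketSum E q ≤ S := by
  have := Fintype.ofFinite ι
  have hES : E q ≤ S := by
    rw [hE q hq, Submodule.span_le]
    rintro _ ⟨a, rfl⟩
    exact hS a
  refine sup_le hES (Submodule.span_le.2 ?_)
  rintro _ ⟨V, hV, hqV, X, Y, hX, hY, rfl⟩
  obtain ⟨W, hWU, hW, hqW, c, hc, hce⟩ := exists_dual_coframe hU hq he hi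
  have hVW := hV.inter hW
  have hsm : ∀ {Z : VField n M}, IsSectionOn E V Z → ∀ a, SmoothFunOn n (fun r => c a r (Z r)) (V ∩ W) :=
    fun hZ a => hc a _ hVW inter_subset_right _ (hZ.1.mono inter_subset_left)
  have hexp : ∀ {Z : VField n M}, IsSectionOn E V Z → ∀ r ∈ V ∩ W, Z r = ∑ a, c a r (Z r) • e a r := by
    intro Z hZ r hr
    refine eq_sum_of_dual (hce r hr.2) ?_
    rw [← hE r (hWU hr.2)]
    exact hZ.2 r hr.1
  have he' : ∀ a, SmoothFieldOn (e a) (V ∩ W) := fun a =>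
    (he a).mono (inter_subset_right.trans hWU)
  refine mlieBracket_mem_of_eq_sum hVW ⟨hqV, hqW⟩ he' (hsm hX) (hexp hX) hS fun a =>
    S.smul_mem _ (mlieBracket_mem_swap ?_)
  exact mlieBracket_mem_of_eq_sum hVW ⟨hqV, hqW⟩ he' (hsm hY) (hexp hY) hS fun b =>
    S.smul_mem _ (h b a)

lemma IsDistribution.smoothlySpanned {k : ℕ} (h : IsDistribution k E) : SmoothlySpanned E := by
  refine SmoothlySpanned.of_span (fun p => E p) (fun p => (Submodule.span_eq _).symm) ?_
  intro p v hv
  obtain ⟨U, hU, hp, X, hX, hXU⟩ := h p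
  have hv' : v ∈ E p := hv
  rw [(hXU p hp).2] at hv'
  obtain ⟨r, rfl⟩ := (Submodule.mem_span_range_iff_exists_fun ℝ).1 hv'
  refine ⟨U, hU, hp, ∑ a, r a • X a, isSectionOn_sum _ fun a _ =>
    IsSectionOn.const_smul ⟨hX a, fun q hq => ?_⟩ _, by simp [Finset.sum_apply]⟩
  rw [(hXU q hq).2]
  exact Submodule.subset_span ⟨a, rfl⟩

lemma SmoothlySpanned.derivedFlag {D : SubspaceField n M} (h : SmoothlySpanned D) (i : ℕ) :
    SmoothlySpanned (derivedFlag D i) := by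
  induction i with
  | zero => exact h
  | succ i ih => exact ih.bracketSum

end Sections

end Goursat

end

noncomputable section

namespace Goursat

open Set Topology VectorField

/-! ### Characteristic distributions and Cartan's lemma -/

section Characteristic

variable {n : ℕ} {M : Type*} [TopologicalSpace M] [ChartedSpace (EuclideanSpace ℝ (Fin n)) M]
  [IsManifold (𝓡 n) ∞ M] {E E₀ F : SubspaceField n M} {X Y W : VField n M} {U V : Set M} {p q : M}
  {k : ℕ}

/-- If `E₀ ⊆ E` has corank one, sections of `E` split along a section of `E` transverse to `E₀`. -/
lemma SmoothlySpanned.exists_decomposition (hE₀ : SmoothlySpanned E₀)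
    (hk₀ : ∀ q, Module.finrank ℝ (E₀ q) = k) (hk : ∀ q, Module.finrank ℝ (E q) = k + 1)
    (hle : ∀ q, E₀ q ≤ E q) (hU : IsOpen U) (hp : p ∈ U) (hY : IsSectionOn E U Y)
    (hYp : Y p ∉ E₀ p) :
    ∃ V ⊆ U, IsOpen V ∧ p ∈ V ∧ ∃ l : (q : M) → TangentSpace (𝓡 n) q →ₗ[ℝ] ℝ,
      SmoothCovectorOn l V ∧ (∀ q ∈ V, l q (Y q) = 1 ∧ (∀ v ∈ E₀ q, l q v = 0) ∧
        ∀ v ∈ E q, v - l q v • Y q ∈ E₀ q) ∧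
      ∀ O : Set M, IsOpen O → O ⊆ V → ∀ X, IsSectionOn E O X →
        IsSectionOn E₀ O (X - (fun q => l q (X q)) • Y) := by
  obtain ⟨V, hVU, hV, hpV, l, hl, hlV⟩ := hE₀.exists_covector hk₀ hU hp hY.1 hYp
  have hdec : ∀ q ∈ V, ∀ v ∈ E q, v - l q v • Y q ∈ E₀ q := fun q hq v hv =>
    sub_smul_mem_of_finrank_succ (hle q) (by rw [hk, hk₀]) (hY.2 q (hVU hq)) (hlV q hq).1
      (hlV q hq).2 hv
  exact ⟨V, hVU, hV, hpV, l, hl, fun q hq => ⟨(hlV q hq).1, (hlV q hq).2, hdec q hq⟩,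
    fun O hO hOV X hX => ⟨hX.1.sub ((hY.1.mono (hOV.trans hVU)).smul (hl O hO hOV X hX.1)),
      fun q hq => hdec q (hOV hq) _ (hX.2 q hq)⟩⟩

/-- If `E₀ ⊆ E` has corank one, `[E₀, E₀] ⊆ E` and `[E, E] ⊄ E` at `p`, then
`[E₀, Y] ⊄ E` at `p` for every section `Y` of `E` transverse to `E₀`. -/
lemma exists_mlieBracket_notMem (hE₀ : SmoothlySpanned E₀)
    (hk₀ : ∀ q, Module.finrank ℝ (E₀ q) = k) (hk : ∀ q, Module.finrank ℝ (E q) = k + 1)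
    (hle : ∀ q, E₀ q ≤ E q)
    (hinv : ∀ O : Set M, IsOpen O → ∀ q ∈ O, ∀ X Y, IsSectionOn E₀ O X → IsSectionOn E₀ O Y →
      mlieBracket (𝓡 n) X Y q ∈ E q)
    (hne : bracketSum E p ≠ E p) (hU : IsOpen U) (hp : p ∈ U) (hY : IsSectionOn E U Y)
    (hYp : Y p ∉ E₀ p) :
    ∃ V ⊆ U, IsOpen V ∧ p ∈ V ∧ ∃ Z, IsSectionOn E₀ V Z ∧ mlieBracket (𝓡 n) Z Y p ∉ E p := by
  by_contra! hcon
  obtain ⟨V, hVU, hV, hpV, l, hl, -, hdec⟩ :=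
    hE₀.exists_decomposition hk₀ hk hle hU hp hY hYp
  refine hne (le_antisymm (sup_le le_rfl (Submodule.span_le.2 ?_)) le_sup_left)
  rintro _ ⟨O, hO, hpO, A, B, hA, hB, rfl⟩
  have hOV : IsOpen (O ∩ V) := hO.inter hV
  have hpOV : p ∈ O ∩ V := ⟨hpO, hpV⟩
  have hYO := hY.mono (inter_subset_right.trans hVU : O ∩ V ⊆ U)
  have hYpE := hY.2 p hp
  -- Writing `A` as a section of `E₀` plus a multiple of `Y` reduces brackets to three types: within
  -- `E₀`, of `E₀` with `Y`, and of `Y` with itself. If none of them left `E`, then `E` would be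
  -- involutive at `p`.
  have split : ∀ {A B : VField n M}, IsSectionOn E O A →
      (∀ A₀, IsSectionOn E₀ (O ∩ V) A₀ → mlieBracket (𝓡 n) A₀ B p ∈ E p) →
      mlieBracket (𝓡 n) Y B p ∈ E p → mlieBracket (𝓡 n) A B p ∈ E p := by
    intro A B hA h1 h2
    have hA' := hA.mono (inter_subset_left : O ∩ V ⊆ O)
    have hs := hdec _ hOV inter_subset_right A hA'
    have hf := hl _ hOV inter_subset_right A hA'.1
    rw [← sub_add_cancel A ((fun q => l q (A q)) • Y),
      mlieBracket_add_left' hOV hpOV hs.1 (hYO.1.smul hf),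
      mlieBracket_smul_left' hOV hpOV hf hYO.1]
    exact (E p).add_mem (h1 _ hs) ((E p).add_mem ((E p).smul_mem _ hYpE) ((E p).smul_mem _ h2))
  have hZY : ∀ A₀, IsSectionOn E₀ (O ∩ V) A₀ → mlieBracket (𝓡 n) A₀ Y p ∈ E p := fun A₀ h =>
    hcon _ (inter_subset_right.trans hVU) hOV hpOV A₀ h
  refine split hA (fun A₀ hA₀ => ?_) ?_
  · exact mlieBracket_mem_swap (split hB (fun B₀ hB₀ => hinv _ hOV p hpOV _ _ hB₀ hA₀)
      (mlieBracket_mem_swap (hZY A₀ hA₀)))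
  · exact mlieBracket_mem_swap (split hB hZY (by simp))

lemma IsCharacteristicOn.mono (h : IsCharacteristicOn E U X) (hV : V ⊆ U) :
    IsCharacteristicOn E V X :=
  ⟨h.1.mono hV, fun O hO hOV => h.2 O hO (hOV.trans hV)⟩

lemma IsCharacteristicOn.add (hX : IsCharacteristicOn E U X) (hY : IsCharacteristicOn E U Y) :
    IsCharacteristicOn E U (X + Y) := by
  refine ⟨hX.1.add hY.1, fun O hO hOU Z hZ q hq => ?_⟩
  rw [mlieBracket_add_left' hO hq (hX.1.1.mono hOU) (hY.1.1.mono hOU)]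
  exact (E q).add_mem (hX.2 O hO hOU Z hZ q hq) (hY.2 O hO hOU Z hZ q hq)

lemma IsCharacteristicOn.const_smul (hX : IsCharacteristicOn E U X) (c : ℝ) :
    IsCharacteristicOn E U (c • X) := by
  refine ⟨hX.1.const_smul c, fun O hO hOU Z hZ q hq => ?_⟩
  rw [mlieBracket_const_smul_left ((hX.1.1.mono hOU).mdifferentiableAt hO hq)]
  exact (E q).smul_mem _ (hX.2 O hO hOU Z hZ q hq)

lemma IsCharacteristicOn.mem (hU : IsOpen U) (hX : IsCharacteristicOn E U X) (hq : q ∈ U) :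
    X q ∈ characteristicDistribution E q :=
  Submodule.subset_span ⟨U, hU, hq, X, hX, rfl⟩

/-- Every vector of the characteristic distribution extends to a characteristic field. -/
lemma exists_characteristic_extending {v : TangentSpace (𝓡 n) p}
    (hv : v ∈ characteristicDistribution E p) :
    ∃ U : Set M, IsOpen U ∧ p ∈ U ∧ ∃ X, IsCharacteristicOn E U X ∧ X p = v := by
  induction hv using Submodule.span_induction with
  | mem v hv => exact hv
  | zero =>
    refine ⟨univ, isOpen_univ, mem_univ _, 0, ⟨⟨smoothFieldOn_zero, fun q _ => (E q).zero_mem⟩,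
      fun O _ _ Y _ q _ => ?_⟩, rfl⟩
    rw [mlieBracket_zero_left]
    exact (E q).zero_mem
  | add v w _ _ hv hw =>
    obtain ⟨U, hU, hp, X, hX, rfl⟩ := hv
    obtain ⟨V, hV, hp', Y, hY, rfl⟩ := hw
    exact ⟨U ∩ V, hU.inter hV, ⟨hp, hp'⟩, X + Y,
      (hX.mono inter_subset_left).add (hY.mono inter_subset_right), rfl⟩
  | smul c v _ hv =>
    obtain ⟨U, hU, hp, X, hX, rfl⟩ := hv
    exact ⟨U, hU, hp, c • X, hX.const_smul c, rfl⟩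

lemma smoothlySpanned_characteristicDistribution (E : SubspaceField n M) :
    SmoothlySpanned (characteristicDistribution E) := by
  intro p v hv
  obtain ⟨U, hU, hp, X, hX, hXp⟩ := exists_characteristic_extending hv
  exact ⟨U, hU, hp, X, ⟨hX.1.1, fun q hq => hX.mem hU hq⟩, hXp⟩

lemma characteristicDistribution_le (E : SubspaceField n M) (p : M) :
    characteristicDistribution E p ≤ E p := by
  refine Submodule.span_le.2 ?_
  rintro _ ⟨U, hU, hp, X, hX, rfl⟩
  exact hX.1.2 p hp

/-- Sections of the characteristic distribution are characteristic fields. -/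
lemma SmoothlySpanned.isCharacteristicOn (hE : SmoothlySpanned E)
    (hk : ∀ q, Module.finrank ℝ (E q) = k)
    (hX : IsSectionOn (characteristicDistribution E) U X) : IsCharacteristicOn E U X := by
  have hXE : IsSectionOn E U X := hX.of_le fun q _ => characteristicDistribution_le E q
  refine ⟨hXE, fun O hO hOU Y hY q hq => ?_⟩
  -- A characteristic field `Z` agrees with `X` only at `q`, which suffices: the difference vanishes
  -- there and brackets are tensorial modulo `E`.
  obtain ⟨V, hV, hqV, Z, hZ, hZq⟩ := exists_characteristic_extending (hX.2 q (hOU hq))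
  have hOV := hO.inter hV
  have hZ' := hZ.mono (inter_subset_right : O ∩ V ⊆ V)
  have hd := (hXE.mono (inter_subset_left.trans hOU : O ∩ V ⊆ U)).sub hZ'.1
  rw [← sub_add_cancel X Z, mlieBracket_add_left' hOV ⟨hq, hqV⟩ hd.1 hZ'.1.1]
  refine (E q).add_mem (hE.mlieBracket_mem_of_eq_zero hk hOV ⟨hq, hqV⟩ hd ?_)
    (hZ.2 _ hOV inter_subset_right Y (hY.mono inter_subset_left) q ⟨hq, hqV⟩)
  simp [hZq]

/-- By the Jacobi identity, bracketing with `[X, Y]` is the commutator of two operations that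
preserve sections of `E`. -/
lemma IsCharacteristicOn.mlieBracket (hU : IsOpen U) (hX : IsCharacteristicOn E U X)
    (hY : IsCharacteristicOn E U Y) : IsCharacteristicOn E U (mlieBracket (𝓡 n) X Y) := by
  refine ⟨⟨hX.1.1.mlieBracket hU hY.1.1, fun q hq => hX.2 U hU le_rfl Y hY.1 q hq⟩,
    fun O hO hOU Z hZ q hq => ?_⟩
  have hj := jacobi' hO hq (hX.1.1.mono hOU) (hY.1.1.mono hOU) hZ.1
  have h1 : IsSectionOn E O (VectorField.mlieBracket (𝓡 n) X Z) :=
    ⟨(hX.1.1.mono hOU).mlieBracket hO hZ.1, hX.2 O hO hOU Z hZ⟩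
  have h2 : IsSectionOn E O (VectorField.mlieBracket (𝓡 n) Y Z) :=
    ⟨(hY.1.1.mono hOU).mlieBracket hO hZ.1, hY.2 O hO hOU Z hZ⟩
  rw [← sub_eq_iff_eq_add] at hj
  rw [← hj]
  exact (E q).sub_mem (hX.2 O hO hOU _ h2 q hq) (hY.2 O hO hOU _ h1 q hq)

/-- The characteristic distribution is involutive. -/
lemma SmoothlySpanned.mlieBracket_mem_characteristicDistribution (hE : SmoothlySpanned E)
    (hk : ∀ q, Module.finrank ℝ (E q) = k) (hU : IsOpen U) (hq : q ∈ U)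
    (hX : IsSectionOn (characteristicDistribution E) U X)
    (hY : IsSectionOn (characteristicDistribution E) U Y) :
    mlieBracket (𝓡 n) X Y q ∈ characteristicDistribution E q :=
  ((hE.isCharacteristicOn hk hX).mlieBracket hU (hE.isCharacteristicOn hk hY)).mem hU hq

lemma exists_mlieBracket_notMem_of_ne (h : bracketSum E p ≠ E p) :
    ∃ U : Set M, IsOpen U ∧ p ∈ U ∧ ∃ A B, IsSectionOn E U A ∧ IsSectionOn E U B ∧
      mlieBracket (𝓡 n) A B p ∉ E p := by
  by_contra! hcon
  refine h (le_antisymm (sup_le le_rfl (Submodule.span_le.2 ?_)) le_sup_left)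
  rintro _ ⟨U, hU, hp, A, B, hA, hB, rfl⟩
  exact hcon U hU hp A B hA hB

lemma ne_of_finrank_succ {N : Type*} [AddCommGroup N] [Module ℝ N] {S T : Submodule ℝ N}
    (h : Module.finrank ℝ T = Module.finrank ℝ S + 1) : T ≠ S := by
  rintro rfl
  omega

/-- A characteristic field of `E` is characteristic for `E + [E, E]`. -/
lemma SmoothlySpanned.isCharacteristicOn_bracketSum (hE : SmoothlySpanned E)
    (hk : ∀ q, Module.finrank ℝ (E q) = k)
    (hk' : ∀ q, Module.finrank ℝ (Goursat.bracketSum E q) = k + 1)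
    (hX : IsCharacteristicOn E U X) : IsCharacteristicOn (Goursat.bracketSum E) U X := by
  refine ⟨hX.1.of_le fun q _ => le_bracketSum E q, fun O hO hOU Y hY q hq => ?_⟩
  -- By the rank condition `E + [E, E]` is locally `E` plus a single bracket `[A, B]`, so it
  -- suffices to bracket `X` with `E` and, by Jacobi, with `[A, B]`.
  obtain ⟨V, hV, hqV, A, B, hA, hB, hAB⟩ := exists_mlieBracket_notMem_of_ne (E := E) (p := q)
    (ne_of_finrank_succ (by rw [hk, hk']))
  obtain ⟨V', hV'V, hV', hqV', l, hl, -, hdec⟩ := hE.exists_decomposition hk hk'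
    (le_bracketSum E) (hO.inter hV) ⟨hq, hqV⟩
    ((hA.mlieBracket hV hB).mono inter_subset_right) hAB
  have hYV := hY.mono (hV'V.trans inter_subset_left)
  have hs := hdec V' hV' le_rfl Y hYV
  have hW := (hA.mlieBracket hV hB).mono (hV'V.trans inter_subset_right)
  have hA' := hA.mono (hV'V.trans inter_subset_right)
  have hB' := hB.mono (hV'V.trans inter_subset_right)
  have hV'U : V' ⊆ U := hV'V.trans (inter_subset_left.trans hOU)
  have hX' := hX.mono hV'U
  have hf := hl V' hV' le_rfl Y hYV.1
  have h1 : IsSectionOn E V' (VectorField.mlieBracket (𝓡 n) X A) :=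
    ⟨hX'.1.1.mlieBracket hV' hA'.1, hX'.2 V' hV' le_rfl A hA'⟩
  have h2 : IsSectionOn E V' (VectorField.mlieBracket (𝓡 n) X B) :=
    ⟨hX'.1.1.mlieBracket hV' hB'.1, hX'.2 V' hV' le_rfl B hB'⟩
  rw [← sub_add_cancel Y ((fun q => l q (Y q)) • VectorField.mlieBracket (𝓡 n) A B),
    mlieBracket_add_right' hV' hqV' hs.1 (hW.1.smul hf), mlieBracket_smul_right' hV' hqV' hf hW.1,
    jacobi' hV' hqV' hX'.1.1 hA'.1 hB'.1]
  refine add_mem (le_bracketSum E q (hX'.2 V' hV' le_rfl _ hs q hqV')) (add_mem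
    (Submodule.smul_mem _ _ (hW.2 q hqV')) (Submodule.smul_mem _ _ (add_mem ?_ ?_)))
  · exact mlieBracket_mem_bracketSum hV' hqV' h1 hB'
  · exact mlieBracket_mem_bracketSum hV' hqV' hA' h2

lemma SmoothlySpanned.characteristicDistribution_le_bracketSum (hE : SmoothlySpanned E)
    (hk : ∀ q, Module.finrank ℝ (E q) = k)
    (hk' : ∀ q, Module.finrank ℝ (Goursat.bracketSum E q) = k + 1) (p : M) :
    characteristicDistribution E p ≤ characteristicDistribution (Goursat.bracketSum E) p := by
  intro v hv
  obtain ⟨U, hU, hp, X, hX, rfl⟩ := exists_characteristic_extending hv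
  exact (hE.isCharacteristicOn_bracketSum hk hk' hX).mem hU hp

lemma finrank_add_one_of_sub_smul_mem {N : Type*} [AddCommGroup N] [Module ℝ N]
    [FiniteDimensional ℝ N] {S T : Submodule ℝ N} (hST : S ≤ T) {x : N} (hx : x ∈ T)
    (hxS : x ∉ S) (h : ∀ v ∈ T, ∃ t : ℝ, v - t • x ∈ S) :
    Module.finrank ℝ S + 1 = Module.finrank ℝ T := by
  have hT : T = S ⊔ Submodule.span ℝ {x} := by
    refine le_antisymm (fun v hv => ?_) (sup_le hST (by simpa using hx))
    obtain ⟨t, ht⟩ := h v hv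
    rw [← sub_add_cancel v (t • x)]
    exact Submodule.add_mem_sup ht (Submodule.smul_mem _ _ (Submodule.mem_span_singleton_self x))
  have hinf : S ⊓ Submodule.span ℝ {x} = ⊥ := by
    rw [Submodule.eq_bot_iff]
    rintro v ⟨hv, hvx⟩
    obtain ⟨t, rfl⟩ := Submodule.mem_span_singleton.1 hvx
    by_contra h0
    have ht : t ≠ 0 := fun ht => h0 (by simp [ht])
    exact hxS ((Submodule.smul_mem_iff _ ht).1 hv)
  have h1 := Submodule.finrank_sup_add_finrank_inf_eq S (Submodule.span ℝ {x})
  rw [hinf, ← hT, finrank_bot, finrank_span_singleton (by rintro rfl; exact hxS S.zero_mem : x ≠ 0)] at h1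
  omega

/-- Cartan's lemma: if the ranks of `E`, `E + [E, E]` and the next derived distribution are `k`,
`k + 1` and `k + 2`, the characteristic distribution of `E + [E, E]` is contained in `E` with
corank one. -/
lemma SmoothlySpanned.characteristicDistribution_bracketSum (hE : SmoothlySpanned E)
    (hk : ∀ q, Module.finrank ℝ (E q) = k)
    (hk' : ∀ q, Module.finrank ℝ (Goursat.bracketSum E q) = k + 1)
    (hk'' : ∀ q, Module.finrank ℝ (Goursat.bracketSum (Goursat.bracketSum E) q) = k + 1 + 1)
    (p : M) : characteristicDistribution (Goursat.bracketSum E) p ≤ E p ∧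
      Module.finrank ℝ (characteristicDistribution (Goursat.bracketSum E) p) + 1 = k := by
  set F := Goursat.bracketSum E with hF
  have hFs : SmoothlySpanned F := hE.bracketSum
  obtain ⟨y, hyF, hyE⟩ : ∃ y ∈ F p, y ∉ E p := by
    by_contra! hcon
    exact ne_of_finrank_succ (by rw [hk, hk']) (le_antisymm hcon (le_bracketSum E p))
  obtain ⟨U, hU, hpU, Y, hY, rfl⟩ := hFs p y hyF
  -- Here `F = E ⊕ Y`, and `X₀` in `E` has `[X₀, Y] ∉ F` at `p`; so `Y` spans `F/E` and `[X₀, Y]`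
  -- spans the next quotient near `p`.
  obtain ⟨U₁, hU₁U, hU₁, hpU₁, X₀, hX₀, hbr⟩ := exists_mlieBracket_notMem hE hk hk'
    (le_bracketSum E) (fun O hO q hq A B hA hB => mlieBracket_mem_bracketSum hO hq hA hB)
    (ne_of_finrank_succ (by rw [hk', hk''])) hU hpU hY hyE
  have hX₀F : IsSectionOn F U₁ X₀ := hX₀.of_le fun q _ => le_bracketSum E q
  have hY₁ := hY.mono hU₁U
  have hW := hX₀F.mlieBracket hU₁ hY₁
  obtain ⟨V₁, hV₁, hV₁o, hpV₁, l', hl', hl'p, hdec'⟩ := hE.exists_decomposition hk hk'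
    (le_bracketSum E) hU₁ hpU₁ hY₁ hyE
  obtain ⟨V₂, hV₂, hV₂o, hpV₂, l, hl, hlp, hdec⟩ := hFs.exists_decomposition hk' hk''
    (le_bracketSum F) hU₁ hpU₁ hW hbr
  -- A characteristic field brackets `X₀` into `F`, and so does its `E`-part; since `[Y, X₀] ∉ F`,
  -- its `Y`-component vanishes at `p`.
  have hle : characteristicDistribution F p ≤ E p := by
    intro v hv
    obtain ⟨O, hO, hpO, Z, hZ, rfl⟩ := exists_characteristic_extending hv
    have hOV := hO.inter hV₁o
    have hpOV : p ∈ O ∩ V₁ := ⟨hpO, hpV₁⟩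
    have hZ' := hZ.mono (inter_subset_left : O ∩ V₁ ⊆ O)
    have hs := hdec' _ hOV inter_subset_right Z hZ'.1
    have hf := hl' _ hOV inter_subset_right Z hZ'.1.1
    have hX₀' := hX₀.mono (inter_subset_right.trans hV₁ : O ∩ V₁ ⊆ U₁)
    have hY' := hY₁.mono (inter_subset_right.trans hV₁ : O ∩ V₁ ⊆ U₁)
    have h1 := hZ'.2 _ hOV le_rfl X₀ (hX₀F.mono (inter_subset_right.trans hV₁)) p hpOV
    rw [← sub_add_cancel Z ((fun q => l' q (Z q)) • Y),
      mlieBracket_add_left' hOV hpOV hs.1 (hY'.1.smul hf),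
      mlieBracket_smul_left' hOV hpOV hf hY'.1] at h1
    have h2 : l' p (Z p) • mlieBracket (𝓡 n) Y X₀ p ∈ F p :=
      ((F p).add_mem_iff_right ((F p).smul_mem _ (hY.2 p hpU))).1
        (((F p).add_mem_iff_right (mlieBracket_mem_bracketSum hOV hpOV hs hX₀')).1 h1)
    have h3 : l' p (Z p) = 0 := by
      by_contra h0
      exact hbr (mlieBracket_mem_swap ((Submodule.smul_mem_iff _ h0).1 h2))
    have h4 := (hl'p p hpV₁).2.2 (Z p) (hZ.1.2 p hpO)
    rwa [h3, zero_smul, sub_zero] at h4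
  refine ⟨hle, ?_⟩
  rw [← hk p]
  -- Corank one: `X₀` spans a complement of the characteristic distribution in `E`.
  refine finrank_add_one_of_sub_smul_mem hle (hX₀.2 p hpU₁) (fun hmem => hbr ?_) fun v hv => ?_
  · obtain ⟨O, hO, hpO, Z, hZ, hZp⟩ := exists_characteristic_extending hmem
    have hOU := hO.inter hU₁
    have hpOU : p ∈ O ∩ U₁ := ⟨hpO, hpU₁⟩
    have hZ' := hZ.mono (inter_subset_left : O ∩ U₁ ⊆ O)
    have hd := (hX₀F.mono (inter_subset_right : O ∩ U₁ ⊆ U₁)).sub hZ'.1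
    rw [← sub_add_cancel X₀ Z, mlieBracket_add_left' hOU hpOU hd.1 hZ'.1.1]
    refine (F p).add_mem (hFs.mlieBracket_mem_of_eq_zero hk' hOU hpOU hd ?_)
      (hZ'.2 _ hOU le_rfl Y (hY₁.mono inter_subset_right) p hpOU)
    simp [hZp]
  · obtain ⟨O, hO, hpO, X, hX, rfl⟩ := hE p v hv
    let O' := O ∩ (V₁ ∩ V₂)
    have hO' : IsOpen O' := hO.inter (hV₁o.inter hV₂o)
    have hpO' : p ∈ O' := ⟨hpO, hpV₁, hpV₂⟩
    have hO'V₁ : O' ⊆ V₁ := inter_subset_right.trans inter_subset_left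
    have hO'V₂ : O' ⊆ V₂ := inter_subset_right.trans inter_subset_right
    have hO'U : O' ⊆ U₁ := hO'V₁.trans hV₁
    have hX' : IsSectionOn E O' X := hX.mono inter_subset_left
    have hXF : IsSectionOn F O' X := hX'.of_le fun q _ => le_bracketSum E q
    have hB : IsSectionOn (Goursat.bracketSum F) O' (mlieBracket (𝓡 n) X Y) :=
      hXF.mlieBracket hO' (hY₁.mono hO'U)
    -- `g` is the coefficient of `[X, Y]` along `[X₀, Y]` modulo `F`; thus `X - g X₀` brackets `Y`
    -- into `F`, and sections of `E` into `F` anyway, so it is characteristic.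
    let g : M → ℝ := fun q => l q (mlieBracket (𝓡 n) X Y q)
    have hg : SmoothFunOn n g O' := hl O' hO' hO'V₂ _ hB.1
    have hX₀' := hX₀.mono hO'U
    have hS : IsSectionOn E O' (X - g • X₀) := hX'.sub (hX₀'.smul hg)
    have hSY : ∀ q ∈ O', mlieBracket (𝓡 n) (X - g • X₀) Y q ∈ F q := by
      intro q hq
      rw [mlieBracket_sub_left' hO' hq hX'.1 (hX₀'.smul hg).1,
        mlieBracket_smul_left' hO' hq hg hX₀'.1, sub_add_eq_sub_sub, sub_right_comm]
      exact (F q).sub_mem ((hlp q (hO'V₂ hq)).2.2 _ (hB.2 q hq))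
        ((F q).smul_mem _ (hX₀F.2 q (hO'U hq)))
    refine ⟨g p, IsCharacteristicOn.mem (X := X - g • X₀) hO' ⟨hS.of_le fun q _ => le_bracketSum E q,
      fun O'' hO'' hsub T hT q hq => ?_⟩ hpO'⟩
    have hs := hdec' O'' hO'' (hsub.trans hO'V₁) T hT
    have hf := hl' O'' hO'' (hsub.trans hO'V₁) T hT.1
    have hYO := hY₁.mono (hsub.trans hO'U)
    rw [← sub_add_cancel T ((fun q => l' q (T q)) • Y),
      mlieBracket_add_right' hO'' hq hs.1 (hYO.1.smul hf),
      mlieBracket_smul_right' hO'' hq hf hYO.1]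
    exact (F q).add_mem (mlieBracket_mem_bracketSum hO'' hq (hS.mono hsub) hs)
      ((F q).add_mem ((F q).smul_mem _ (hYO.2 q hq)) ((F q).smul_mem _ (hSY q (hsub hq))))

end Characteristic

end Goursat

end

noncomputable section

namespace Goursat

open Set Topology VectorField

/-! ### Local coordinates from independent differentials, and tangent spaces of level sets -/

section Coordinates

variable {n : ℕ} {M : Type*} [TopologicalSpace M] [ChartedSpace (EuclideanSpace ℝ (Fin n)) M]

/-- The differential of a function in the preferred chart at the point. -/
lemma mvfderiv_eq_fderiv_chartAt {f : M → ℝ} {p : M}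
    (hf : MDifferentiableAt (𝓡 n) 𝓘(ℝ, ℝ) f p) (v : EuclideanSpace ℝ (Fin n)) :
    mvfderiv (𝓡 n) f p v = fderiv ℝ (f ∘ (chartAt (EuclideanSpace ℝ (Fin n)) p).symm)
      (chartAt (EuclideanSpace ℝ (Fin n)) p p) v := by
  have h1 : mfderiv (𝓡 n) 𝓘(ℝ, ℝ) f p = fderivWithin ℝ (writtenInExtChartAt (𝓡 n) 𝓘(ℝ, ℝ) p f)
      (Set.range (𝓡 n)) (extChartAt (𝓡 n) p p) := if_pos hf
  have h2 : mvfderiv (𝓡 n) f p v = mfderiv (𝓡 n) 𝓘(ℝ, ℝ) f p v := rfl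
  rw [h2, h1]
  have h3 : Set.range (𝓡 n) = univ := by simp
  rw [h3, fderivWithin_univ]
  rfl

variable [IsManifold (𝓡 n) ∞ M]

lemma SmoothFunOn.contDiffOn_chartAt {f : M → ℝ} {U : Set M} (hf : SmoothFunOn n f U) (p : M) :
    ContDiffOn ℝ ∞ (f ∘ (chartAt (EuclideanSpace ℝ (Fin n)) p).symm)
      ((chartAt (EuclideanSpace ℝ (Fin n)) p).target ∩
        (chartAt (EuclideanSpace ℝ (Fin n)) p).symm ⁻¹' U) := by
  rw [← contMDiffOn_iff_contDiffOn]
  exact ContMDiffOn.comp (I' := 𝓡 n) hf ((contMDiffOn_chart_symm (n := ∞)).mono inter_subset_left)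
    (fun x hx => hx.2)

lemma SmoothFunOn.contDiffAt_chartAt {f : M → ℝ} {U : Set M} (hf : SmoothFunOn n f U)
    (hU : IsOpen U) {p : M} (hp : p ∈ U) :
    ContDiffAt ℝ ∞ (f ∘ (chartAt (EuclideanSpace ℝ (Fin n)) p).symm)
      (chartAt (EuclideanSpace ℝ (Fin n)) p p) := by
  refine (hf.contDiffOn_chartAt p).contDiffAt (IsOpen.mem_nhds
    ((chartAt (EuclideanSpace ℝ (Fin n)) p).symm.isOpen_inter_preimage hU) ⟨?_, ?_⟩)
  · exact (chartAt _ p).map_source (mem_chart_source _ p)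
  · simpa using hp

/-- A linear form in the coordinates of the preferred chart. -/
lemma smoothFunOn_comp_chartAt (p : M) (l : EuclideanSpace ℝ (Fin n) →L[ℝ] ℝ) :
    SmoothFunOn n (l ∘ chartAt (EuclideanSpace ℝ (Fin n)) p)
      (chartAt (EuclideanSpace ℝ (Fin n)) p).source :=
  (l.contDiff.contMDiff (n := ∞)).comp_contMDiffOn contMDiffOn_chart

lemma mvfderiv_comp_chartAt (p : M) (l : EuclideanSpace ℝ (Fin n) →L[ℝ] ℝ)
    (v : EuclideanSpace ℝ (Fin n)) :
    mvfderiv (𝓡 n) (l ∘ chartAt (EuclideanSpace ℝ (Fin n)) p) p v = l v := by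
  rw [mvfderiv_eq_fderiv_chartAt ((smoothFunOn_comp_chartAt p l).mdifferentiableAt
    (chartAt _ p).open_source (mem_chart_source _ p))]
  have : (l ∘ chartAt (EuclideanSpace ℝ (Fin n)) p) ∘ (chartAt (EuclideanSpace ℝ (Fin n)) p).symm
      =ᶠ[𝓝 (chartAt (EuclideanSpace ℝ (Fin n)) p p)] l := by
    filter_upwards [(chartAt (EuclideanSpace ℝ (Fin n)) p).open_target.mem_nhds
      ((chartAt _ p).map_source (mem_chart_source _ p))] with x hx
    simp [(chartAt (EuclideanSpace ℝ (Fin n)) p).right_inv hx]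
  rw [this.fderiv_eq, l.fderiv]

lemma eq_zero_of_forall_apply_eq_zero {N ι : Type*} [AddCommGroup N] [Module ℝ N]
    [FiniteDimensional ℝ N] [Fintype ι] {l : ι → Module.Dual ℝ N} (hl : LinearIndependent ℝ l)
    (hc : Fintype.card ι = Module.finrank ℝ N) {v : N} (hv : ∀ a, l a v = 0) : v = 0 := by
  have hs : Submodule.span ℝ (Set.range l) = ⊤ :=
    hl.span_eq_top_of_card_eq_finrank' (by rw [hc, Subspace.dual_finrank_eq])
  rw [← Module.forall_dual_apply_eq_zero_iff ℝ]
  intro φ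
  have hφ : φ ∈ Submodule.span ℝ (Set.range l) := hs ▸ Submodule.mem_top
  induction hφ using Submodule.span_induction with
  | mem x hx => obtain ⟨a, rfl⟩ := hx; exact hv a
  | zero => rfl
  | add x y _ _ hx hy => rw [LinearMap.add_apply, hx, hy, add_zero]
  | smul c x _ hx => rw [LinearMap.smul_apply, hx, smul_zero]

/-- The differential of `f` at `p`, as an element of the algebraic dual. -/
def differential (n : ℕ) {M : Type*} [TopologicalSpace M]
    [ChartedSpace (EuclideanSpace ℝ (Fin n)) M] (f : M → ℝ) (p : M) :
    Module.Dual ℝ (TangentSpace (𝓡 n) p) := (mvfderiv (𝓡 n) f p).toLinearMap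

/-- Functions with independent differentials, as many as the dimension, are local coordinates. -/
lemma exists_chart_of_linearIndependent {U : Set M} (hU : IsOpen U) {p : M} (hp : p ∈ U)
    {k : Fin n → M → ℝ} (hk : ∀ a, SmoothFunOn n (k a) U)
    (hi : LinearIndependent ℝ fun a => differential n (k a) p) :
    ∃ e ∈ IsManifold.maximalAtlas (𝓡 n) ∞ M, p ∈ e.source ∧ e.source ⊆ U ∧
      ∀ q ∈ e.source, ∀ a, e q a = k a q := by
  let φ := chartAt (EuclideanSpace ℝ (Fin n)) p
  let g : EuclideanSpace ℝ (Fin n) → EuclideanSpace ℝ (Fin n) :=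
    fun x => WithLp.toLp 2 fun a => k a (φ.symm x)
  let W : Set (EuclideanSpace ℝ (Fin n)) := φ.target ∩ φ.symm ⁻¹' U
  have hW : IsOpen W := φ.symm.isOpen_inter_preimage hU
  have hpφ : p ∈ φ.source := mem_chart_source _ p
  have hpW : φ p ∈ W := ⟨φ.map_source hpφ, by simpa [φ] using hp⟩
  have hg : ContDiffOn ℝ ∞ g W := by
    rw [contDiffOn_euclidean]
    exact fun a => (hk a).contDiffOn_chartAt p
  have hgd : ∀ x ∈ W, ContDiffAt ℝ ∞ g x := fun x hx => hg.contDiffAt (hW.mem_nhds hx)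
  have hder : ∀ v a, fderiv ℝ g (φ p) v a = differential n (k a) p v := by
    intro v a
    have h1 := ((hgd _ hpW).hasStrictFDerivAt (by simp)).hasFDerivAt
    have h2 := ((EuclideanSpace.proj a : EuclideanSpace ℝ (Fin n) →L[ℝ] ℝ).hasFDerivAt
      (x := g (φ p))).comp (φ p) h1
    have h3 : differential n (k a) p v = fderiv ℝ (k a ∘ φ.symm) (φ p) v :=
      mvfderiv_eq_fderiv_chartAt ((hk a).mdifferentiableAt hU hp) v
    rw [h3]
    have h4 : HasFDerivAt (k a ∘ φ.symm)
      ((EuclideanSpace.proj a : EuclideanSpace ℝ (Fin n) →L[ℝ] ℝ).comp (fderiv ℝ g (φ p))) (φ p) := h2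
    rw [h4.fderiv]
    rfl
  have hinj : Function.Injective (fderiv ℝ g (φ p)).toLinearMap := by
    rw [injective_iff_map_eq_zero]
    intro v hv
    refine eq_zero_of_forall_apply_eq_zero (N := TangentSpace (𝓡 n) p) hi
      (by rw [Fintype.card_fin]; exact finrank_euclideanSpace_fin.symm) fun a => ?_
    have h := hder v a
    have hv' : fderiv ℝ g (φ p) v = 0 := hv
    rw [hv'] at h
    exact h.symm
  let G : EuclideanSpace ℝ (Fin n) ≃L[ℝ] EuclideanSpace ℝ (Fin n) :=
    (LinearEquiv.ofInjectiveEndo _ hinj).toContinuousLinearEquiv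
  have hG : (G : EuclideanSpace ℝ (Fin n) →L[ℝ] EuclideanSpace ℝ (Fin n)) = fderiv ℝ g (φ p) := by
    ext1 v
    rfl
  have hGd : HasFDerivAt g (G : EuclideanSpace ℝ (Fin n) →L[ℝ] EuclideanSpace ℝ (Fin n)) (φ p) := by
    rw [hG]
    exact ((hgd _ hpW).hasStrictFDerivAt (by simp)).hasFDerivAt
  let Ψ := (hgd _ hpW).toOpenPartialHomeomorph g hGd (by simp)
  -- A chart of the maximal atlas needs a smooth inverse on its whole target, not only near one
  -- point; so restrict to where the derivative of `g` is invertible.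
  let W' : Set (EuclideanSpace ℝ (Fin n)) := W ∩ fderiv ℝ g ⁻¹' Set.range
    (ContinuousLinearEquiv.toContinuousLinearMap :
      (EuclideanSpace ℝ (Fin n) ≃L[ℝ] EuclideanSpace ℝ (Fin n)) → _)
  have hW' : IsOpen W' := (hg.continuousOn_fderiv_of_isOpen hW (by simp)).isOpen_inter_preimage hW
    ContinuousLinearEquiv.isOpen
  let Ψ' := Ψ.restrOpen W' hW'
  have hΨ' : Ψ'.source ⊆ W' := by
    simp only [Ψ', OpenPartialHomeomorph.restrOpen_source]
    exact inter_subset_right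
  have hpΨ : φ p ∈ Ψ'.source := by
    simp only [Ψ', OpenPartialHomeomorph.restrOpen_source]
    exact ⟨(hgd _ hpW).mem_toOpenPartialHomeomorph_source hGd (by simp), hpW, G, hG⟩
  let e := φ.trans Ψ'
  have hes : ∀ q ∈ e.source, q ∈ φ.source ∧ φ q ∈ Ψ'.source := fun q hq => by
    simpa [e, OpenPartialHomeomorph.trans_source] using hq
  have heU : e.source ⊆ U := fun q hq => by
    have := (hΨ' (hes q hq).2).1.2
    rwa [mem_preimage, φ.left_inv (hes q hq).1] at this
  have hek : ∀ q ∈ e.source, ∀ a, e q a = k a q := fun q hq a => by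
    have : e q a = k a (φ.symm (φ q)) := rfl
    rw [this, φ.left_inv (hes q hq).1]
  refine ⟨e, OpenPartialHomeomorph.mem_maximalAtlas_of_contMDiffOn e ?_ ?_, ?_, heU, hek⟩
  · have hg' : ContMDiffOn 𝓘(ℝ, EuclideanSpace ℝ (Fin n)) 𝓘(ℝ, EuclideanSpace ℝ (Fin n)) ∞ g W :=
      contMDiffOn_iff_contDiffOn.2 hg
    exact hg'.comp (contMDiffOn_chart.mono fun q hq => (hes q hq).1)
      fun q hq => (hΨ' (hes q hq).2).1
  · have het : ∀ y ∈ e.target, y ∈ Ψ'.target ∧ Ψ'.symm y ∈ φ.target := fun y hy => by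
      simpa [e, OpenPartialHomeomorph.trans_target] using hy
    have hsymm : ContMDiffOn 𝓘(ℝ, EuclideanSpace ℝ (Fin n)) 𝓘(ℝ, EuclideanSpace ℝ (Fin n)) ∞
        Ψ'.symm e.target := by
      refine contMDiffOn_iff_contDiffOn.2 fun y hy => ContDiffAt.contDiffWithinAt ?_
      have hx := hΨ' (Ψ'.map_target (het y hy).1)
      obtain ⟨A, hA⟩ := hx.2
      refine Ψ'.contDiffAt_symm (f₀' := A) (het y hy).1 ?_ (hgd _ hx.1)
      rw [hA]
      exact ((hgd _ hx.1).hasStrictFDerivAt (by simp)).hasFDerivAt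
    exact contMDiffOn_chart_symm.comp hsymm fun y hy => (het y hy).2
  · simp only [e, OpenPartialHomeomorph.trans_source]
    exact ⟨hpφ, hpΨ⟩

/-- Functions with independent differentials are part of a local coordinate system. -/
lemma exists_chart_extending {m : ℕ} {U : Set M} (hU : IsOpen U) {p : M} (hp : p ∈ U)
    {h : Fin m → M → ℝ} (hh : ∀ b, SmoothFunOn n (h b) U)
    (hi : LinearIndependent ℝ fun b => differential n (h b) p) :
    ∃ e ∈ IsManifold.maximalAtlas (𝓡 n) ∞ M, p ∈ e.source ∧ e.source ⊆ U ∧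
      ∃ i : Fin m ↪ Fin n, ∀ q ∈ e.source, ∀ b, e q (i b) = h b q := by
  let B := Module.Basis.sumExtend hi
  have hB : ∀ b, B (Sum.inl b) = differential n (h b) p := fun b => by
    simp [B, Module.Basis.sumExtend]
    rfl
  have : Finite (Fin m ⊕ Module.Basis.sumExtendIndex hi) := Module.Finite.finite_basis B
  have := Fintype.ofFinite (Fin m ⊕ Module.Basis.sumExtendIndex hi)
  have hcard : Fintype.card (Fin m ⊕ Module.Basis.sumExtendIndex hi) = n := by
    rw [← Module.finrank_eq_card_basis B, Subspace.dual_finrank_eq]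
    exact finrank_euclideanSpace_fin (𝕜 := ℝ)
  let σ := Fintype.equivFinOfCardEq hcard
  -- The covectors that complete the differentials to a basis are themselves differentials at `p`,
  -- namely of linear functions of the preferred chart.
  let l : Fin m ⊕ Module.Basis.sumExtendIndex hi → EuclideanSpace ℝ (Fin n) →L[ℝ] ℝ :=
    fun o => LinearMap.toContinuousLinearMap (B o : EuclideanSpace ℝ (Fin n) →ₗ[ℝ] ℝ)
  let k : Fin m ⊕ Module.Basis.sumExtendIndex hi → M → ℝ := fun o =>
    Sum.elim h (fun r => l (Sum.inr r) ∘ chartAt (EuclideanSpace ℝ (Fin n)) p) o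
  have hk : ∀ o, SmoothFunOn n (k o) (U ∩ (chartAt (EuclideanSpace ℝ (Fin n)) p).source) := by
    rintro (b | r)
    · exact (hh b).mono inter_subset_left
    · exact (smoothFunOn_comp_chartAt p _).mono inter_subset_right
  have hkB : ∀ o, differential n (k o) p = B o := by
    rintro (b | r)
    · exact (hB b).symm
    · ext v
      exact mvfderiv_comp_chartAt p (l (Sum.inr r)) v
  obtain ⟨e, he, hpe, heU, hek⟩ := exists_chart_of_linearIndependent
    (hU.inter (chartAt _ p).open_source) ⟨hp, mem_chart_source _ p⟩
    (k := fun a => k (σ.symm a)) (fun a => hk _) (by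
      simp only [hkB]
      exact B.linearIndependent.comp _ σ.symm.injective)
  refine ⟨e, he, hpe, heU.trans inter_subset_left,
    ⟨fun b => σ (Sum.inl b), fun b c hbc => by simpa using hbc⟩, fun q hq b => ?_⟩
  have := hek q hq (σ (Sum.inl b))
  rwa [σ.symm_apply_apply] at this

/-- The tangent space of a regular level set is the common kernel of the differentials. -/
lemma mem_tangentSpaceOf_iff {m : ℕ} {U : Set M} (hU : IsOpen U) {p : M} (hp : p ∈ U)
    {h : Fin m → M → ℝ} (hh : ∀ b, SmoothFunOn n (h b) U)
    (hi : LinearIndependent ℝ fun b => differential n (h b) p) {S : Set M}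
    (hS : ∀ q ∈ U, q ∈ S ↔ ∀ b, h b q = 0) (hpS : p ∈ S) (v : TangentSpace (𝓡 n) p) :
    v ∈ tangentSpaceOf n S p ↔ ∀ b, differential n (h b) p v = 0 := by
  refine ⟨fun hv b => hv U hU hp (h b) (hh b) fun q hq => (hS q hq.1).1 hq.2 b,
    fun hv V hV hpV f hf hf0 => ?_⟩
  let φ := chartAt (EuclideanSpace ℝ (Fin n)) p
  have hpφ : p ∈ φ.source := mem_chart_source _ p
  have hf' : SmoothFunOn n f V := hf
  -- Lagrange multipliers: `f` is constant on `S`, so `p` is trivially a constrained extremum and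
  -- the differentials of `f` and the `h b` are dependent. Independence of the latter makes the
  -- multiplier of `f` nonzero.
  have hext : IsLocalExtrOn (f ∘ φ.symm)
      {x | ∀ b, (h b ∘ φ.symm) x = (h b ∘ φ.symm) (φ p)} (φ p) := by
    refine Or.inl ?_
    have hnhds : φ.target ∩ φ.symm ⁻¹' (U ∩ V) ∈ 𝓝 (φ p) :=
      IsOpen.mem_nhds (φ.symm.isOpen_inter_preimage (hU.inter hV))
        ⟨φ.map_source hpφ, by simpa [φ] using ⟨hp, hpV⟩⟩
    filter_upwards [mem_nhdsWithin_of_mem_nhds hnhds, self_mem_nhdsWithin] with x hx hx'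
    have h0 : ∀ b, h b p = 0 := (hS p hp).1 hpS
    have hxS : φ.symm x ∈ S := by
      refine (hS _ hx.2.1).2 fun b => ?_
      have := hx' b
      simp only [Function.comp, φ.left_inv hpφ, h0] at this
      exact this
    simp only [Function.comp, φ.left_inv hpφ]
    rw [hf0 p ⟨hpV, hpS⟩, hf0 _ ⟨hx.2.2, hxS⟩]
  obtain ⟨Λ, Λ₀, hne, hsum⟩ := hext.exists_multipliers_of_hasStrictFDerivAt
    (fun b => ((hh b).contDiffAt_chartAt hU hp).hasStrictFDerivAt (by simp))
    ((hf'.contDiffAt_chartAt hV hpV).hasStrictFDerivAt (by simp))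
  have hw : ∀ w : EuclideanSpace ℝ (Fin n), ∑ b, Λ b * fderiv ℝ (h b ∘ φ.symm) (φ p) w +
      Λ₀ * fderiv ℝ (f ∘ φ.symm) (φ p) w = 0 := by
    intro w
    simpa using DFunLike.congr_fun hsum w
  have hsum' : ∀ w : TangentSpace (𝓡 n) p,
      ∑ b, Λ b * differential n (h b) p w + Λ₀ * differential n f p w = 0 := by
    intro w
    have e1 : ∀ b, differential n (h b) p w = fderiv ℝ (h b ∘ φ.symm) (φ p) w := fun b =>
      mvfderiv_eq_fderiv_chartAt ((hh b).mdifferentiableAt hU hp) w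
    have e2 : differential n f p w = fderiv ℝ (f ∘ φ.symm) (φ p) w :=
      mvfderiv_eq_fderiv_chartAt (hf'.mdifferentiableAt hV hpV) w
    rw [e2]
    simp only [e1]
    exact hw w
  have hΛ₀ : Λ₀ ≠ 0 := by
    intro h0
    subst h0
    refine hne ?_
    have hΛ : Λ = 0 := by
      funext b
      refine Fintype.linearIndependent_iff.1 hi Λ ?_ b
      ext w
      simpa using hsum' w
    rw [hΛ]
    rfl
  have hv' := hsum' v
  simp only [hv, mul_zero, Finset.sum_const_zero, zero_add] at hv'
  exact (mul_eq_zero.1 hv').resolve_left hΛ₀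

end Coordinates

end Goursat

end

noncomputable section

namespace Goursat

open Set Topology VectorField

/-! ### Local equations of the canonical sets of a Goursat structure -/

section CanonicalSets

lemma forall_eq_zero_of_finrank_succ {N : Type*} [AddCommGroup N] [Module ℝ N]
    [FiniteDimensional ℝ N] {S T : Submodule ℝ N} (hST : S ≤ T)
    (hk : Module.finrank ℝ T = Module.finrank ℝ S + 1) {w : N} (hw : w ∈ T) (hwS : w ∉ S)
    {φ : N →ₗ[ℝ] ℝ} (hS : ∀ v ∈ S, φ v = 0) (hφ : φ w = 0) {v : N} (hv : v ∈ T) : φ v = 0 := by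
  have h1 : S < T ⊓ LinearMap.ker φ := lt_of_le_of_ne (le_inf hST fun v hv => hS v hv) fun h => by
    rw [h] at hwS
    exact hwS ⟨hw, hφ⟩
  have h2 := Submodule.finrank_lt_finrank_of_lt h1
  have h3 : T ⊓ LinearMap.ker φ = T :=
    Submodule.eq_of_le_of_finrank_le inf_le_left (by omega)
  rw [← h3] at hv
  exact hv.2

variable {n : ℕ} {M : Type*} [TopologicalSpace M] [ChartedSpace (EuclideanSpace ℝ (Fin n)) M]

lemma differential_apply (f : M → ℝ) (X : VField n M) (q : M) :
    differential n f q (X q) = derivAlong X f q := rfl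

lemma derivAlong_eq_zero_of_mem_tangentSpaceOf {S U : Set M} {q : M} (hU : IsOpen U) (hq : q ∈ U)
    {X : VField n M} {f : M → ℝ} (hX : X q ∈ tangentSpaceOf n S q) (hf : SmoothFunOn n f U)
    (h0 : ∀ r ∈ U ∩ S, f r = 0) : derivAlong X f q = 0 :=
  hX U hU hq f hf h0

variable [IsManifold (𝓡 n) ∞ M] {D : SubspaceField n M}

lemma IsGoursat.smoothlySpanned (hD : IsGoursat D) (i : ℕ) : SmoothlySpanned (derivedFlag D i) :=
  hD.1.smoothlySpanned.derivedFlag i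

/-- Cartan's lemma for `D^{(i)}`, `D^{(i+1)}`, `D^{(i+2)}`; the bound on `i` is what prescribes the
rank of the last one. -/
lemma IsGoursat.cartanDistribution_le (hD : IsGoursat D) {i : ℕ} (hi : i + 4 ≤ n) (q : M) :
    cartanDistribution D i q ≤ derivedFlag D i q :=
  ((hD.smoothlySpanned i).characteristicDistribution_bracketSum (hD.2 i (by omega))
    (hD.2 (i + 1) (by omega)) (hD.2 (i + 2) (by omega)) q).1

lemma IsGoursat.finrank_cartanDistribution (hD : IsGoursat D) {i : ℕ} (hi : i + 4 ≤ n) (q : M) :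
    Module.finrank ℝ (cartanDistribution D i q) = i + 1 := by
  have h := ((hD.smoothlySpanned i).characteristicDistribution_bracketSum (hD.2 i (by omega))
    (hD.2 (i + 1) (by omega)) (hD.2 (i + 2) (by omega)) q).2
  have h' : Module.finrank ℝ (cartanDistribution D i q) + 1 = i + 2 := h
  omega

lemma smoothlySpanned_cartanDistribution (D : SubspaceField n M) (i : ℕ) :
    SmoothlySpanned (cartanDistribution D i) :=
  smoothlySpanned_characteristicDistribution _

lemma IsGoursat.cartanDistribution_mono_succ (hD : IsGoursat D) {i : ℕ} (hi : i + 4 ≤ n) (q : M) :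
    cartanDistribution D i q ≤ cartanDistribution D (i + 1) q :=
  (hD.smoothlySpanned (i + 1)).characteristicDistribution_le_bracketSum
    (hD.2 (i + 1) (by omega)) (hD.2 (i + 2) (by omega)) q

lemma IsGoursat.cartanDistribution_mono (hD : IsGoursat D) {l i : ℕ} (hl : l ≤ i)
    (hi : i + 3 ≤ n) (q : M) : cartanDistribution D l q ≤ cartanDistribution D i q := by
  induction i, hl using Nat.le_induction with
  | base => exact le_rfl
  | succ i _ ih => exact (ih (by omega)).trans (hD.cartanDistribution_mono_succ (by omega) q)

lemma IsGoursat.mlieBracket_mem_cartanDistribution (hD : IsGoursat D) {i : ℕ} (hi : i + 3 ≤ n)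
    {U : Set M} (hU : IsOpen U) {q : M} (hq : q ∈ U) {X Y : VField n M}
    (hX : IsSectionOn (cartanDistribution D i) U X)
    (hY : IsSectionOn (cartanDistribution D i) U Y) :
    mlieBracket (𝓡 n) X Y q ∈ cartanDistribution D i q :=
  (hD.smoothlySpanned (i + 1)).mlieBracket_mem_characteristicDistribution
    (hD.2 (i + 1) (by omega)) hU hq hX hY

lemma IsGoursat.mlieBracket_mem_derivedFlag (hD : IsGoursat D) {i : ℕ} (hi : i + 3 ≤ n)
    {U : Set M} (hU : IsOpen U) {q : M} (hq : q ∈ U) {X Y : VField n M}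
    (hX : IsSectionOn (cartanDistribution D i) U X)
    (hY : IsSectionOn (derivedFlag D (i + 1)) U Y) :
    mlieBracket (𝓡 n) X Y q ∈ derivedFlag D (i + 1) q :=
  ((hD.smoothlySpanned (i + 1)).isCharacteristicOn (hD.2 (i + 1) (by omega)) hX).2 U hU le_rfl
    Y hY q hq

lemma derivedFlag_le_succ (D : SubspaceField n M) (i : ℕ) (q : M) :
    derivedFlag D i q ≤ derivedFlag D (i + 1) q := le_bracketSum _ q

lemma IsGoursat.exists_notMem_cartanDistribution (hD : IsGoursat D) {i : ℕ} (hi : i + 4 ≤ n)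
    (q : M) : ∃ v ∈ derivedFlag D i q, v ∉ cartanDistribution D i q := by
  by_contra! h
  have := Submodule.finrank_mono (show derivedFlag D i q ≤ cartanDistribution D i q from h)
  rw [hD.finrank_cartanDistribution hi, hD.2 i (by omega)] at this
  omega

/-- `C_i` is an involutive hyperplane of the non-involutive `D^{(i)}`, so the failure of
involutivity must come from brackets of `C_i` with a transverse section. This is the source of every
transversality below. -/
lemma IsGoursat.exists_mlieBracket_notMem (hD : IsGoursat D) {i : ℕ} (hi : i + 4 ≤ n)
    {U : Set M} (hU : IsOpen U) {q : M} (hq : q ∈ U) {X : VField n M}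
    (hX : IsSectionOn (derivedFlag D i) U X) (hXq : X q ∉ cartanDistribution D i q) :
    ∃ V ⊆ U, IsOpen V ∧ q ∈ V ∧ ∃ Z, IsSectionOn (cartanDistribution D i) V Z ∧
      mlieBracket (𝓡 n) Z X q ∉ derivedFlag D i q :=
  Goursat.exists_mlieBracket_notMem (smoothlySpanned_cartanDistribution D i)
    (hD.finrank_cartanDistribution hi) (hD.2 i (by omega)) (hD.cartanDistribution_le hi)
    (fun _ hO r hr _ _ hA hB => hD.cartanDistribution_le hi r
      (hD.mlieBracket_mem_cartanDistribution (by omega) hO hr hA hB))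
    (ne_of_finrank_succ (by rw [hD.2 i (by omega)]; exact hD.2 (i + 1) (by omega) q)) hU hq hX hXq

lemma canonicalSet_succ_subset (D : SubspaceField n M) (i j : ℕ) :
    canonicalSet D i (j + 1) ⊆ canonicalSet D i j := fun _ hp => hp.2.1

lemma canonicalSet_antitone (D : SubspaceField n M) (i : ℕ) : Antitone (canonicalSet D i) :=
  antitone_nat_of_succ_le (canonicalSet_succ_subset D i)

lemma le_of_mem_canonicalSet {i j : ℕ} {p : M} (hp : p ∈ canonicalSet D i j) :
    i + 5 ≤ n ∧ j ≤ i := by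
  induction j with
  | zero => exact ⟨hp.1, Nat.zero_le _⟩
  | succ j ih => exact ⟨(ih hp.2.1).1, hp.1⟩

/-- Local equations `h 0 = ⋯ = h j = 0` for `S_j^{(i)}` on `U`, together with the position of the
distributions of the flag relative to `S_j^{(i)}`. -/
structure LocalEquations (D : SubspaceField n M) (i j : ℕ) (U : Set M) (h : ℕ → M → ℝ) :
    Prop where
  smooth : ∀ b ≤ j, SmoothFunOn n (h b) U
  mem_iff : ∀ q ∈ U, q ∈ canonicalSet D i j ↔ ∀ b ≤ j, h b q = 0
  -- The invariants of the induction on `j`: along `S_j^{(i)}`, the smaller `C_l` are tangent to it,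
  -- `D^{(i-j)}` is tangent to the preceding set, and `C_{i-j}` contains a vector tangent to the
  -- preceding set but not to `S_j^{(i)}`. The last one yields independence.
  cartan : ∀ q ∈ U, q ∈ canonicalSet D i j → ∀ l, l + j < i → ∀ v ∈ cartanDistribution D l q,
    ∀ b ≤ j, differential n (h b) q v = 0
  flag : ∀ q ∈ U, q ∈ canonicalSet D i j → ∀ v ∈ derivedFlag D (i - j) q,
    ∀ b < j, differential n (h b) q v = 0
  transverse : ∀ q ∈ U, q ∈ canonicalSet D i j → ∃ v ∈ cartanDistribution D (i - j) q,
    (∀ b < j, differential n (h b) q v = 0) ∧ differential n (h j) q v ≠ 0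
  indep : ∀ q ∈ U, q ∈ canonicalSet D i j →
    LinearIndependent ℝ fun b : Fin (j + 1) => differential n (h b) q
  ne_cartan : ∀ q ∈ U, q ∈ canonicalSet D i j → 1 ≤ j →
    derivedFlag D (i - j) q ≠ cartanDistribution D (i - j + 1) q

/-- Locally `D^{(i+1)} = D^{(i)} ⊕ Y` and `C_{i+1} = C_i ⊕ W`. The equation is `f = 0`, with `f` the
`Y`-component of `W`; put `T = W - f Y`, a section of `D^{(i)}`. On the canonical set, involutivity
of `C_{i+1} = D^{(i)}` gives `[Z, T] + (Z f) Y ∈ D^{(i)}` for `Z` in `C_i`, so `Z f` tells whether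
`[Z, T]` leaves `D^{(i)}`. -/
lemma IsGoursat.exists_localEquations_zero (hD : IsGoursat D) {i : ℕ} {p : M}
    (hp : p ∈ canonicalSet D i 0) :
    ∃ U : Set M, IsOpen U ∧ p ∈ U ∧ ∃ h, LocalEquations D i 0 U h := by
  have hi : i + 5 ≤ n := hp.1
  obtain ⟨y, hy, hyD⟩ : ∃ y ∈ derivedFlag D (i + 1) p, y ∉ derivedFlag D i p := by
    by_contra! hcon
    have := Submodule.finrank_mono (show derivedFlag D (i + 1) p ≤ derivedFlag D i p from hcon)
    rw [hD.2 (i + 1) (by omega), hD.2 i (by omega)] at this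
    omega
  obtain ⟨U₁, hU₁, hpU₁, Y, hY, rfl⟩ := hD.smoothlySpanned (i + 1) p y hy
  obtain ⟨V₁, hV₁U, hV₁, hpV₁, l, hl, hlp, hdec⟩ :=
    (hD.smoothlySpanned i).exists_decomposition (hD.2 i (by omega)) (hD.2 (i + 1) (by omega))
      (derivedFlag_le_succ D i) hU₁ hpU₁ hY hyD
  obtain ⟨w, hw, hwC⟩ : ∃ w ∈ cartanDistribution D (i + 1) p, w ∉ cartanDistribution D i p := by
    by_contra! hcon
    have := Submodule.finrank_mono
      (show cartanDistribution D (i + 1) p ≤ cartanDistribution D i p from hcon)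
    rw [hD.finrank_cartanDistribution (by omega), hD.finrank_cartanDistribution (by omega)] at this
    omega
  obtain ⟨U₂, hU₂, hpU₂, W, hW, rfl⟩ := smoothlySpanned_cartanDistribution D (i + 1) p w hw
  obtain ⟨V₂, hV₂U, hV₂, hpV₂, m, -, hmp, -⟩ :=
    (smoothlySpanned_cartanDistribution D i).exists_decomposition
      (hD.finrank_cartanDistribution (by omega)) (hD.finrank_cartanDistribution (by omega))
      (hD.cartanDistribution_mono_succ (by omega)) hU₂ hpU₂ hW hwC
  let U := V₁ ∩ V₂
  have hU : IsOpen U := hV₁.inter hV₂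
  have hUV₁ : U ⊆ V₁ := inter_subset_left
  have hWU := hW.mono (inter_subset_right.trans hV₂U : U ⊆ U₂)
  have hWD : IsSectionOn (derivedFlag D (i + 1)) U W :=
    hWU.of_le fun q _ => hD.cartanDistribution_le (by omega) q
  have hYU := hY.mono (hUV₁.trans hV₁U)
  let f : M → ℝ := fun q => l q (W q)
  have hf : SmoothFunOn n f U := hl U hU hUV₁ W hWU.1
  have hT : IsSectionOn (derivedFlag D i) U (W - f • Y) := hdec U hU hUV₁ W hWD
  -- If `f q = 0`, then `W q`, and with it all of `C_{i+1}`, lies in `D^{(i)}`, which has the same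
  -- rank `i + 2`.
  have hmem : ∀ q ∈ U, q ∈ canonicalSet D i 0 ↔ f q = 0 := by
    intro q hq
    refine ⟨fun hqS => (hlp q hq.1).2.1 _ (hqS.2 ▸ hWU.2 q hq), fun h0 => ⟨hi, ?_⟩⟩
    symm
    refine Submodule.eq_of_le_of_finrank_eq (fun v hv => ?_)
      (by rw [hD.finrank_cartanDistribution (by omega), hD.2 i (by omega)])
    have h1 := hD.cartanDistribution_le (by omega) q ((hmp q hq.2).2.2 v hv)
    have h2 := hT.2 q hq
    simp only [Pi.sub_apply, Pi.smul_apply', h0, zero_smul, sub_zero] at h2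
    have h3 := add_mem h1 (Submodule.smul_mem _ (m q v) h2)
    rwa [sub_add_cancel] at h3
  have hbr : ∀ {O : Set M} {q : M} {Z : VField n M}, IsOpen O → q ∈ O → O ⊆ U →
      q ∈ canonicalSet D i 0 → IsSectionOn (cartanDistribution D i) O Z →
      mlieBracket (𝓡 n) Z (W - f • Y) q + derivAlong Z f q • Y q ∈ derivedFlag D i q := by
    intro O q Z hO hqO hOU hqS hZ
    have h1 := hD.mlieBracket_mem_cartanDistribution (i := i + 1) (by omega) hO hqO
      (hZ.of_le fun r _ => hD.cartanDistribution_mono_succ (by omega) r) (hWU.mono hOU)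
    rw [← sub_add_cancel W (f • Y), mlieBracket_add_right' hO hqO (hT.1.mono hOU)
      ((hYU.1.mono hOU).smul (hf.mono hOU)), mlieBracket_smul_right' hO hqO (hf.mono hOU)
      (hYU.1.mono hOU), (hmem q (hOU hqO)).1 hqS, zero_smul, add_zero, ← hqS.2] at h1
    exact h1
  have htr : ∀ q ∈ U, q ∈ canonicalSet D i 0 → ∃ v ∈ cartanDistribution D (i - 0) q,
      (∀ b < 0, differential n ((fun _ : ℕ => f) b) q v = 0) ∧ differential n f q v ≠ 0 := by
    intro q hq hqS
    have hTq : (W - f • Y) q ∉ cartanDistribution D i q := by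
      simp only [Pi.sub_apply, Pi.smul_apply', (hmem q hq).1 hqS, zero_smul, sub_zero]
      intro h
      have := (hmp q hq.2).2.1 _ h
      rw [(hmp q hq.2).1] at this
      exact one_ne_zero this
    obtain ⟨O, hOU, hO, hqO, Z, hZ, hZT⟩ :=
      hD.exists_mlieBracket_notMem (by omega) hU hq hT hTq
    refine ⟨Z q, hZ.2 q hqO, fun b hb => absurd hb (Nat.not_lt_zero b), fun h0 => hZT ?_⟩
    have := hbr hO hqO hOU hqS hZ
    rw [differential_apply] at h0
    rwa [h0, zero_smul, add_zero] at this
  refine ⟨U, hU, ⟨hpV₁, hpV₂⟩, fun _ => f, fun _ _ => hf, fun q hq => ?_, fun q hq hqS k hk v hv b _ => ?_,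
    fun _ _ _ _ _ b hb => absurd hb (Nat.not_lt_zero b), htr, fun q hq hqS => ?_,
    fun _ _ _ h => absurd h (by omega)⟩
  · rw [hmem q hq]
    exact ⟨fun h _ _ => h, fun h => h 0 le_rfl⟩
  -- Fields in `C_{i-1}` are characteristic for `D^{(i)}`, so `[Z, T]` stays in `D^{(i)}` and `Z f =
  -- 0`.
  · obtain ⟨i, rfl⟩ : ∃ i', i = i' + 1 := ⟨i - 1, by omega⟩
    have hv' := hD.cartanDistribution_mono (show k ≤ i by omega) (by omega) q hv
    obtain ⟨O, hO, hqO, Z, hZ, rfl⟩ := smoothlySpanned_cartanDistribution D i q v hv'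
    have hOU := hO.inter hU
    have hZ' := hZ.mono (inter_subset_left : O ∩ U ⊆ O)
    have h1 := hbr hOU ⟨hqO, hq⟩ inter_subset_right hqS
      (hZ'.of_le fun r _ => hD.cartanDistribution_mono_succ (by omega) r)
    have h2 := hD.mlieBracket_mem_derivedFlag (by omega) hOU ⟨hqO, hq⟩ hZ'
      (hT.mono inter_subset_right)
    have h3 := (hlp q hq.1).2.1 _ ((Submodule.add_mem_iff_right _ h2).1 h1)
    rw [map_smul, (hlp q hq.1).1, smul_eq_mul, mul_one] at h3
    exact h3
  · obtain ⟨v, -, -, hv⟩ := htr q hq hqS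
    have : Unique (Fin (0 + 1)) := inferInstanceAs (Unique (Fin 1))
    refine linearIndependent_unique_iff.2 fun h0 => hv ?_
    have h0' : differential n f q = 0 := h0
    rw [h0', LinearMap.zero_apply]

/-- With `k = i - (j + 1)` and `X` a section of `D^{(k)}` transverse to `C_k`, the new equation is
`X h_j = 0`. Since `C_k` is tangent to `S_j^{(i)}`, the intersection of `D^{(k)}` with the tangent
space exceeds `C_k` exactly when `X` is tangent; the equations before `h_j` are killed by `X`
anyway. -/
lemma IsGoursat.exists_localEquations_succ (hD : IsGoursat D) {i j : ℕ} {p : M}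
    (hp : p ∈ canonicalSet D i (j + 1)) {U₀ : Set M} (hU₀ : IsOpen U₀) (hpU₀ : p ∈ U₀)
    {h : ℕ → M → ℝ} (hh : LocalEquations D i j U₀ h) :
    ∃ U : Set M, IsOpen U ∧ p ∈ U ∧ ∃ h, LocalEquations D i (j + 1) U h := by
  obtain ⟨hi, hji⟩ := le_of_mem_canonicalSet hp
  obtain ⟨k, hk⟩ : ∃ k, k = i - (j + 1) := ⟨_, rfl⟩
  have hk1 : i - j = k + 1 := by omega
  obtain ⟨x, hx, hxC⟩ := hD.exists_notMem_cartanDistribution (i := k) (by omega) p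
  obtain ⟨U₁, hU₁, hpU₁, X, hX, rfl⟩ := hD.smoothlySpanned k p x hx
  obtain ⟨V, hVU, hV, hpV, l, -, hlp, -⟩ :=
    (smoothlySpanned_cartanDistribution D k).exists_decomposition
      (hD.finrank_cartanDistribution (by omega)) (hD.2 k (by omega))
      (hD.cartanDistribution_le (by omega)) hU₁ hpU₁ hX hxC
  let U := U₀ ∩ V
  have hU : IsOpen U := hU₀.inter hV
  have hUU₀ : U ⊆ U₀ := inter_subset_left
  have hXU := hX.mono (inter_subset_right.trans hVU : U ⊆ U₁)
  have hCT : ∀ q ∈ U, q ∈ canonicalSet D i j → ∀ v ∈ cartanDistribution D k q, ∀ b ≤ j,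
      differential n (h b) q v = 0 := fun q hq hqS v hv b hb =>
    hh.cartan q hq.1 hqS k (by omega) v hv b hb
  have hT : ∀ q ∈ U, q ∈ canonicalSet D i j → ∀ v : TangentSpace (𝓡 n) q,
      v ∈ tangentSpaceOf n (canonicalSet D i j) q ↔ ∀ b ≤ j, differential n (h b) q v = 0 := by
    intro q hq hqS v
    rw [mem_tangentSpaceOf_iff hU₀ hq.1 (h := fun b : Fin (j + 1) => h b)
      (fun b => hh.smooth b (by omega)) (hh.indep q hq.1 hqS) (fun r hr => ?_) hqS]
    · exact ⟨fun H b hb => H ⟨b, by omega⟩, fun H b => H b (by omega)⟩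
    · rw [hh.mem_iff r hr]
      exact ⟨fun H b => H b (by omega), fun H b hb => H ⟨b, by omega⟩⟩
  have hXb : ∀ q ∈ U, q ∈ canonicalSet D i j → ∀ b < j, differential n (h b) q (X q) = 0 :=
    fun q hq hqS b hb => hh.flag q hq.1 hqS _
      (by rw [hk1]; exact derivedFlag_le_succ D k q (hXU.2 q hq)) b hb
  have hXC : ∀ q ∈ U, X q ∉ cartanDistribution D k q := fun q hq hmem => by
    have := (hlp q hq.2).2.1 _ hmem
    rw [(hlp q hq.2).1] at this
    exact one_ne_zero this
  have hsplit : ∀ q ∈ U, q ∈ canonicalSet D i j → ∀ v ∈ derivedFlag D k q, ∀ b ≤ j,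
      differential n (h b) q v = l q v * differential n (h b) q (X q) := by
    intro q hq hqS v hv b hb
    have := hCT q hq hqS _ ((hlp q hq.2).2.2 v hv) b hb
    rwa [map_sub, map_smul, smul_eq_mul, sub_eq_zero] at this
  have hcond : ∀ q ∈ U, q ∈ canonicalSet D i j →
      (derivedFlag D k q ⊓ tangentSpaceOf n (canonicalSet D i j) q ≠ cartanDistribution D k q ↔
        derivAlong X (h j) q = 0) := by
    intro q hq hqS
    refine ⟨fun hne => ?_, fun h0 heq => hXC q hq ?_⟩
    · by_contra h0
      refine hne (le_antisymm (fun v hv => ?_) fun v hv =>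
        ⟨hD.cartanDistribution_le (by omega) q hv, (hT q hq hqS v).2 (hCT q hq hqS v hv)⟩)
      have h1 := (hT q hq hqS v).1 hv.2 j le_rfl
      rw [hsplit q hq hqS v hv.1 j le_rfl] at h1
      have h2 := (hlp q hq.2).2.2 v hv.1
      rwa [(mul_eq_zero.1 h1).resolve_right h0, zero_smul, sub_zero] at h2
    · rw [← heq]
      refine ⟨hXU.2 q hq, (hT q hq hqS _).2 fun b hb => ?_⟩
      rcases hb.lt_or_eq with hb | rfl
      · exact hXb q hq hqS b hb
      · exact h0
  have hmem : ∀ q ∈ U, q ∈ canonicalSet D i (j + 1) ↔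
      q ∈ canonicalSet D i j ∧ derivAlong X (h j) q = 0 := by
    intro q hq
    constructor
    · rintro ⟨_, hqS, hne⟩
      rw [← hk] at hne
      exact ⟨hqS, (hcond q hq hqS).1 hne⟩
    · rintro ⟨hqS, h0⟩
      refine ⟨hji, hqS, ?_⟩
      rw [← hk]
      exact (hcond q hq hqS).2 h0
  have hflag : ∀ q ∈ U, q ∈ canonicalSet D i (j + 1) → ∀ v ∈ derivedFlag D k q, ∀ b ≤ j,
      differential n (h b) q v = 0 := by
    intro q hq hqS v hv b hb
    obtain ⟨hqj, h0⟩ := (hmem q hq).1 hqS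
    rw [hsplit q hq hqj v hv b hb]
    rcases hb.lt_or_eq with hb | rfl
    · rw [hXb q hq hqj b hb, mul_zero]
    · rw [differential_apply, h0, mul_zero]
  have hhj : SmoothFunOn n (h j) U := (hh.smooth j le_rfl).mono hUU₀
  -- `Z h_j` vanishes on `S_j^{(i)}`, and at points of the new set `X` is tangent to `S_j^{(i)}`;
  -- hence `X (Z h_j) = 0` and only the bracket term survives.
  have hcomm : ∀ {O : Set M} {q : M} {Z : VField n M}, IsOpen O → q ∈ O → O ⊆ U →
      q ∈ canonicalSet D i (j + 1) → IsSectionOn (cartanDistribution D k) O Z →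
      derivAlong Z (derivAlong X (h j)) q =
        differential n (h j) q (mlieBracket (𝓡 n) Z X q) := by
    intro O q Z hO hqO hOU hqS hZ
    have hqj := canonicalSet_succ_subset D i j hqS
    have h1 : derivAlong X (derivAlong Z (h j)) q = 0 :=
      derivAlong_eq_zero_of_mem_tangentSpaceOf hO hqO
        ((hT q (hOU hqO) hqj _).2 (hflag q (hOU hqO) hqS _ (hXU.2 q (hOU hqO))))
        (hZ.1.derivAlong hO (hhj.mono hOU))
        fun r hr => hCT r (hOU hr.1) hr.2 _ (hZ.2 r hr.1) j le_rfl
    have h2 := derivAlong_mlieBracket hO hqO hZ.1 (hXU.1.mono hOU) (hhj.mono hOU)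
    rw [h1, sub_zero] at h2
    exact h2.symm
  let h' : ℕ → M → ℝ := Function.update h (j + 1) (derivAlong X (h j))
  have hlt : ∀ b ≤ j, h' b = h b := fun b hb => Function.update_of_ne (by omega) _ _
  have heq : h' (j + 1) = derivAlong X (h j) := Function.update_self _ _ _
  have hbnd : ∀ b ≤ j + 1, b ≤ j ∨ b = j + 1 := fun b hb => by omega
  -- Take `Z` with `[Z, X] ∉ D^{(k)}`. If `dh_j` killed this bracket as well as `D^{(k)}`, it would
  -- kill all of `D^{(k+1)}`, including the vector of `C_{k+1}` transverse to `S_j^{(i)}`.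
  have htr : ∀ q ∈ U, q ∈ canonicalSet D i (j + 1) → ∃ v ∈ cartanDistribution D k q,
      (∀ b < j + 1, differential n (h' b) q v = 0) ∧ differential n (h' (j + 1)) q v ≠ 0 := by
    intro q hq hqS
    have hqj := canonicalSet_succ_subset D i j hqS
    obtain ⟨O, hOU, hO, hqO, Z, hZ, hZX⟩ :=
      hD.exists_mlieBracket_notMem (by omega) hU hq hXU (hXC q hq)
    refine ⟨Z q, hZ.2 q hqO, fun b hb => ?_, fun h0 => ?_⟩
    · rw [hlt b (by omega)]
      exact hCT q hq hqj _ (hZ.2 q hqO) b (by omega)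
    · rw [heq, differential_apply, hcomm hO hqO hOU hqS hZ] at h0
      obtain ⟨v, hv, -, hvj⟩ := hh.transverse q hq.1 hqj
      rw [hk1] at hv
      refine hvj (forall_eq_zero_of_finrank_succ (derivedFlag_le_succ D k q) ?_ ?_ hZX
        (fun w hw => hflag q hq hqS w hw j le_rfl) h0 (hD.cartanDistribution_le (by omega) q hv))
      · rw [hD.2 k (by omega), hD.2 (k + 1) (by omega)]
      · exact mlieBracket_mem_bracketSum hO hqO
          (hZ.of_le fun r _ => hD.cartanDistribution_le (by omega) r) (hXU.mono hOU)
  refine ⟨U, hU, ⟨hpU₀, hpV⟩, h', fun b hb => ?_, fun q hq => ?_, fun q hq hqS m hm v hv b hb => ?_,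
    fun q hq hqS v hv b hb => ?_, by rw [← hk]; exact htr, fun q hq hqS => ?_,
    fun q hq hqS _ hcon => ?_⟩
  · rcases hbnd b hb with hb | rfl
    · rw [hlt b hb]
      exact (hh.smooth b hb).mono hUU₀
    · rw [heq]
      exact hXU.1.derivAlong hU hhj
  · rw [hmem q hq, hh.mem_iff q hq.1]
    constructor
    · rintro ⟨h1, h2⟩ b hb
      rcases hbnd b hb with hb | rfl
      · rw [hlt b hb]
        exact h1 b hb
      · rw [heq]
        exact h2
    · intro H
      refine ⟨fun b hb => ?_, ?_⟩
      · rw [← hlt b hb]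
        exact H b (by omega)
      · rw [← heq]
        exact H (j + 1) le_rfl
  · have hqj := canonicalSet_succ_subset D i j hqS
    rcases hbnd b hb with hb | rfl
    · rw [hlt b hb]
      exact hh.cartan q hq.1 hqj m (by omega) v hv b hb
    · rw [heq]
      -- Fields in `C_{k-1}` are characteristic for `D^{(k)}`: the bracket with `X` remains in
      -- `D^{(k)}`, on which `dh_j` vanishes.
      obtain ⟨k, rfl⟩ : ∃ k', k = k' + 1 := ⟨k - 1, by omega⟩
      have hv' := hD.cartanDistribution_mono (show m ≤ k by omega) (by omega) q hv
      obtain ⟨O, hO, hqO, Z, hZ, rfl⟩ := smoothlySpanned_cartanDistribution D k q v hv'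
      have hOU := hO.inter hU
      have hZ' := hZ.mono (inter_subset_left : O ∩ U ⊆ O)
      rw [differential_apply, hcomm hOU ⟨hqO, hq⟩ inter_subset_right hqS
        (hZ'.of_le fun r _ => hD.cartanDistribution_mono_succ (by omega) r)]
      exact hflag q hq hqS _ (hD.mlieBracket_mem_derivedFlag (by omega) hOU ⟨hqO, hq⟩ hZ'
        (hXU.mono inter_subset_right)) j le_rfl
  · rw [← hk] at hv
    rw [hlt b (by omega)]
    exact hflag q hq hqS v hv b (by omega)
  · rw [linearIndependent_finSucc']
    obtain ⟨v, -, hv0, hv1⟩ := htr q hq hqS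
    constructor
    · have : (Fin.init fun b : Fin (j + 1 + 1) => differential n (h' b) q) =
          fun b : Fin (j + 1) => differential n (h b) q := by
        funext b
        simp only [Fin.init, Fin.val_castSucc]
        rw [hlt b (by omega)]
      rw [this]
      exact hh.indep q hq.1 (canonicalSet_succ_subset D i j hqS)
    · intro hspan
      have hle : Submodule.span ℝ (Set.range (Fin.init fun b : Fin (j + 1 + 1) =>
          differential n (h' b) q)) ≤ LinearMap.ker (Module.Dual.eval ℝ _ v) := by
        rw [Submodule.span_le]
        rintro _ ⟨b, rfl⟩
        exact hv0 _ b.2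
      exact hv1 (hle hspan)
  -- `dh_j` vanishes on `D^{(k)}` but not on `C_{k+1}`.
  · have hqj := canonicalSet_succ_subset D i j hqS
    obtain ⟨v, hv, -, hvj⟩ := hh.transverse q hq.1 hqj
    rw [hk1] at hv
    rw [← hk] at hcon
    rw [← hcon] at hv
    exact hvj (hflag q hq hqS v hv j le_rfl)

lemma IsGoursat.exists_localEquations (hD : IsGoursat D) {i j : ℕ} {p : M}
    (hp : p ∈ canonicalSet D i j) :
    ∃ U : Set M, IsOpen U ∧ p ∈ U ∧ ∃ h, LocalEquations D i j U h := by
  induction j with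
  | zero => exact hD.exists_localEquations_zero hp
  | succ j ih =>
    obtain ⟨U, hU, hpU, h, hh⟩ := ih (canonicalSet_succ_subset D i j hp)
    exact hD.exists_localEquations_succ hp hU hpU hh

theorem IsGoursat.isSubmanifoldOfCodim (hD : IsGoursat D) (i j : ℕ) :
    IsSubmanifoldOfCodim n (canonicalSet D i j) (j + 1) := by
  intro p hp
  obtain ⟨U, hU, hpU, h, hh⟩ := hD.exists_localEquations hp
  obtain ⟨e, he, hpe, heU, ι, hι⟩ := exists_chart_extending hU hpU
    (h := fun b : Fin (j + 1) => h b) (fun b => hh.smooth b (by omega)) (hh.indep p hpU hp)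
  refine ⟨e, he, hpe, Finset.univ.map ι, by simp, fun q hq => ?_⟩
  rw [hh.mem_iff q (heU hq)]
  constructor
  · intro H a ha
    obtain ⟨b, -, rfl⟩ := Finset.mem_map.1 ha
    rw [hι q hq]
    exact H b (by omega)
  · intro H b hb
    have := H (ι ⟨b, by omega⟩) (Finset.mem_map_of_mem _ (Finset.mem_univ _))
    rwa [hι q hq] at this

/-- By nestedness the point lies in `S_{j-k}^{(i+j)}` and in `S_0^{(i+k)}`. The second forces
`D^{(i+k)} = C_{i+k+1}`, which the first excludes, because `(i + j) - (j - k) = i + k`. -/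
lemma IsGoursat.disjoint_of_lt (hD : IsGoursat D) {i j k : ℕ} (hkj : k < j) {p : M}
    (hpj : p ∈ canonicalSet D (i + j) j) (hpk : p ∈ canonicalSet D (i + k) k) : False := by
  have h0 := canonicalSet_antitone D (i + k) (Nat.zero_le k) hpk
  have hm := canonicalSet_antitone D (i + j) (show j - k ≤ j by omega) hpj
  obtain ⟨U, hU, hpU, h, hh⟩ := hD.exists_localEquations hm
  have hne := hh.ne_cartan p hpU hm (by omega)
  rw [show i + j - (j - k) = i + k by omega] at hne
  exact hne h0.2

theorem IsGoursat.canonicalSet_inter_eq_empty (hD : IsGoursat D) (i j k : ℕ) (hkj : k ≠ j) :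
    canonicalSet D (i + j) j ∩ canonicalSet D (i + k) k = ∅ := by
  rw [Set.eq_empty_iff_forall_notMem]
  rintro p ⟨hj, hk⟩
  rcases lt_or_gt_of_ne hkj with h | h
  · exact hD.disjoint_of_lt h hj hk
  · exact hD.disjoint_of_lt h hk hj

end CanonicalSets

end Goursat

end

noncomputable section

namespace Goursat

/-! ### Jacquard words and the words of sequences of prolongations -/

section Words

lemma ascendingWord_eq_map (k : ℕ) : ascendingWord k = (List.range k).map (· + 1) := by
  rw [ascendingWord, List.range'_eq_map_range]
  exact List.map_congr_left fun a _ => Nat.add_comm 1 a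

lemma ascendingWord_succ (k : ℕ) : ascendingWord (k + 1) = ascendingWord k ++ [k + 1] := by
  simp [ascendingWord_eq_map, List.range_succ]

lemma map_range_add (f : ℕ → ℕ) (a b : ℕ) :
    (List.range (a + b)).map f = (List.range a).map f ++ (List.range b).map fun t => f (a + t) := by
  simp [List.range_add]

/-- A word that starts with `a_0` and in which every letter `a_i`, `i ≥ 2`, is preceded by
`a_{i-1}` belongs to the Jacquard language. -/
lemma map_range_mem_jacquard (f : ℕ → ℕ) (m : ℕ) (h0 : 0 < m → f 0 = 0)
    (h : ∀ i, i + 1 < m → f (i + 1) ≤ 1 ∨ f (i + 1) = f i + 1) :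
    (List.range m).map f ∈ jacquard m := by
  induction m using Nat.strong_induction_on with
  | _ m ih =>
    match m, ih, h0, h with
    | 0, _, _, _ => simp [jacquard]
    | 1, _, h0, _ => simp [jacquard, h0]
    | m + 2, ih, h0, h =>
      have hsub : ∀ r, r < m + 2 → (List.range r).map f ∈ jacquard r := fun r hr =>
        ih r hr (fun _ => h0 (by omega)) fun i hi => h i (by omega)
      rw [jacquard]
      rcases hc : f (m + 1) with _ | c
      · refine Or.inl ⟨_, hsub (m + 1) (by omega), ?_⟩
        rw [List.range_succ, List.map_append, List.map_singleton, hc]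
      -- A final letter `c + 1` forces, reading backwards, `c, c - 1, …, 1`; this block cannot reach
      -- position `0`, where the letter is `0`. The nonempty prefix before it is covered by
      -- induction.
      · have key : ∀ t, t ≤ c → t ≤ m ∧ f (m + 1 - t) = c + 1 - t := by
          intro t
          induction t with
          | zero => exact fun _ => ⟨Nat.zero_le _, hc⟩
          | succ t iht =>
            intro ht
            obtain ⟨htm, hft⟩ := iht (by omega)
            have h1 := h (m - t) (by omega)
            rw [show m - t + 1 = m + 1 - t by omega, hft] at h1
            have h2 : f (m - t) = c - t := by omega
            have h3 : t + 1 ≤ m := by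
              by_contra hcon
              rw [show m - t = 0 by omega, h0 (by omega)] at h2
              omega
            exact ⟨h3, by rw [show m + 1 - (t + 1) = m - t by omega, h2]; omega⟩
        have hcm := (key c le_rfl).1
        refine Or.inr (Set.mem_iUnion.2 ⟨⟨c, by omega⟩, _, hsub (m + 1 - c) (by omega), ?_⟩)
        conv_lhs => rw [show m + 2 = (m + 1 - c) + (c + 1) by omega]
        rw [map_range_add, ascendingWord_eq_map]
        congr 1
        refine List.map_congr_left fun t ht => ?_
        have ht' := List.mem_range.1 ht
        have := (key (c - t) (by omega)).2
        rw [show m + 1 - (c - t) = m + 1 - c + t by omega] at this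
        rw [this]
        omega

lemma length_of_mem_jacquard {m : ℕ} {w : List ℕ} (hw : w ∈ jacquard m) : w.length = m := by
  induction m using Nat.strong_induction_on generalizing w with
  | _ m ih =>
    match m, ih, hw with
    | 0, _, hw => simp only [jacquard, Set.mem_singleton_iff] at hw; simp [hw]
    | 1, _, hw => simp only [jacquard, Set.mem_singleton_iff] at hw; simp [hw]
    | m + 2, ih, hw =>
      rw [jacquard] at hw
      rcases hw with ⟨u, hu, rfl⟩ | hw
      · simp [ih (m + 1) (by omega) hu]
      · obtain ⟨k, u, hu, rfl⟩ := Set.mem_iUnion.1 hw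
        have := k.2
        simp only [List.length_append, ih (m + 1 - k) (by omega) hu, ascendingWord,
          List.length_range']
        omega

/-- The steps of a sequence of prolongations: step `k` leads from dimension `k + 2` to dimension
`k + 3`; it is `none` for the singular prolongation and `some c` for `R_c`. -/
def KRSequence.step : {n : ℕ} → KRSequence n → ℕ → Option ℝ
  -- With `some 0` at step `0`, the base form is the prolongation `R_0` of the pair `∂_{x_2},
  -- ∂_{x_1}` in dimension two, so `krField` needs no special case.
  | _, .base => fun _ => some 0
  | n + 1, .singular s => Function.update s.step (n - 2) none
  | n + 1, .regular c s => Function.update s.step (n - 2) (some c)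

open Classical in
/-- The letter of the word of a sequence of prolongations contributed by step `k`. -/
def stepLetter (σ : ℕ → Option ℝ) : ℕ → ℕ
  | 0 => 0
  -- Step `1` leads to dimension four, where the letter is `a_0` whichever prolongation is used.
  | 1 => 0
  | k + 2 =>
    match σ (k + 2), stepLetter σ (k + 1) with
    | none, _ => 1
    | some c, a + 1 => if c = 0 then a + 2 else 0
    | some _, 0 => 0

lemma stepLetter_of_none {σ : ℕ → Option ℝ} {k : ℕ} (h : σ (k + 2) = none) :
    stepLetter σ (k + 2) = 1 := by
  rw [stepLetter, h]

open Classical in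
lemma stepLetter_of_some {σ : ℕ → Option ℝ} {k : ℕ} {c : ℝ} (h : σ (k + 2) = some c) :
    stepLetter σ (k + 2) = match stepLetter σ (k + 1) with
      | a + 1 => if c = 0 then a + 2 else 0
      | 0 => 0 := by
  rw [stepLetter, h]
  rcases stepLetter σ (k + 1) with _ | a <;> rfl

lemma stepLetter_congr {σ τ : ℕ → Option ℝ} {k : ℕ} (h : ∀ i ≤ k, σ i = τ i) :
    stepLetter σ k = stepLetter τ k := by
  induction k with
  | zero => rfl
  | succ k ih =>
    rcases k with _ | k
    · rfl
    · rw [stepLetter, stepLetter, h (k + 2) le_rfl, ih fun i hi => h i (by omega)]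

lemma KRSequence.three_le : {n : ℕ} → KRSequence n → 3 ≤ n
  | _, .base => le_rfl
  | _, .singular s => s.three_le.trans (Nat.le_succ _)
  | _, .regular _ s => s.three_le.trans (Nat.le_succ _)

lemma KRSequence.word_singular {n : ℕ} (s : KRSequence n) (hn : n ≠ 3) :
    (KRSequence.singular s).word = s.word ++ [1] := by
  cases s with
  | base => exact absurd rfl hn
  | singular s =>
    refine KRSequence.word.eq_4 _ (.singular s) ?_
    omega
  | regular c s =>
    refine KRSequence.word.eq_4 _ (.regular c s) ?_
    omega

open Classical in
lemma KRSequence.word_regular {n : ℕ} (c : ℝ) (s : KRSequence n) (hn : n ≠ 3) :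
    (KRSequence.regular c s).word = s.word ++
      [match s.word.getLast? with
        | some (i + 1) => if c = 0 then i + 2 else 0
        | _ => 0] := by
  cases s with
  | base => exact absurd rfl hn
  | singular s =>
    refine (KRSequence.word.eq_5 _ c (.singular s) ?_).trans rfl
    omega
  | regular c' s =>
    refine (KRSequence.word.eq_5 _ c (.regular c' s) ?_).trans rfl
    omega

lemma KRSequence.word_eq {n : ℕ} (s : KRSequence n) :
    s.word = (List.range (n - 3)).map fun i => stepLetter s.step (i + 1) := by
  have hcongr : ∀ (σ : ℕ → Option ℝ) (n : ℕ) (o : Option ℝ), 3 ≤ n →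
      (List.range (n - 3)).map (fun i => stepLetter σ (i + 1)) =
        (List.range (n - 3)).map fun i => stepLetter (Function.update σ (n - 2) o) (i + 1) := by
    intro σ n o hn
    refine List.map_congr_left fun i hi => stepLetter_congr fun k hk => ?_
    have := List.mem_range.1 hi
    rw [Function.update_of_ne (by omega)]
  have hlast : ∀ (f : ℕ → ℕ) (n : ℕ), 3 ≤ n → (List.range (n + 1 - 3)).map f =
      (List.range (n - 3)).map f ++ [f (n - 3)] := by
    intro f n hn
    rw [show n + 1 - 3 = n - 3 + 1 by omega, List.range_succ, List.map_append, List.map_singleton]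
  induction s with
  | base => rfl
  | @singular n s ih =>
    have hn := s.three_le
    rw [hlast _ n hn, KRSequence.step, ← hcongr _ _ _ hn, ← ih]
    by_cases h3 : n = 3
    · subst h3
      cases s with
      | base => simp [KRSequence.word, stepLetter]
      | singular s => exact absurd s.three_le (by omega)
      | regular c s => exact absurd s.three_le (by omega)
    · obtain ⟨m, rfl⟩ : ∃ m, n = m + 4 := ⟨n - 4, by omega⟩
      rw [s.word_singular h3]
      congr 2
      exact (stepLetter_of_none (Function.update_self _ _ _)).symm
  | @regular n c s ih =>
    have hn := s.three_le
    rw [hlast _ n hn, KRSequence.step, ← hcongr _ _ _ hn, ← ih]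
    by_cases h3 : n = 3
    · subst h3
      cases s with
      | base => simp [KRSequence.word, stepLetter]
      | singular s => exact absurd s.three_le (by omega)
      | regular c s => exact absurd s.three_le (by omega)
    · obtain ⟨m, rfl⟩ : ∃ m, n = m + 4 := ⟨n - 4, by omega⟩
      rw [s.word_regular c h3]
      congr 2
      have h1 : s.word.getLast? = some (stepLetter s.step (m + 1)) := by
        rw [ih, show m + 4 - 3 = m + 1 by omega, List.range_succ, List.map_append,
          List.map_singleton, List.getLast?_concat]
      have h2 : stepLetter (Function.update s.step (m + 4 - 2) (some c)) (m + 1) =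
          stepLetter s.step (m + 1) := stepLetter_congr fun k hk => by
        rw [Function.update_of_ne (by omega)]
      have h3 : Function.update s.step (m + 4 - 2) (some c) (m + 2) = some c :=
        Function.update_self _ _ _
      rw [h1, show m + 4 - 3 + 1 = m + 2 by omega, stepLetter_of_some h3, h2]
      rcases stepLetter s.step (m + 1) with _ | a <;> rfl

lemma KRSequence.length_word {n : ℕ} (s : KRSequence n) : s.word.length = n - 3 := by
  simp [s.word_eq]

lemma KRSequence.word_mem_jacquard {n : ℕ} (s : KRSequence n) : s.word ∈ jacquard (n - 3) := by
  rw [s.word_eq]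
  refine map_range_mem_jacquard _ _ (fun _ => rfl) fun i _ => ?_
  rcases h : s.step (i + 2) with _ | c
  · exact Or.inl (stepLetter_of_none h).le
  · rw [stepLetter_of_some h]
    rcases stepLetter s.step (i + 1) with _ | a
    · exact Or.inl (Nat.zero_le _)
    · by_cases hc : c = 0 <;> simp [hc]

/-- Steps `k, …, k + j` are a singular prolongation followed by `j` regular prolongations `R_0`. -/
def IsRun (σ : ℕ → Option ℝ) (k j : ℕ) : Prop :=
  -- The bound `2 ≤ k` discards a singular prolongation at step `1`, which creates no singularity.
  2 ≤ k ∧ σ k = none ∧ ∀ t, 1 ≤ t → t ≤ j → σ (k + t) = some 0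

lemma stepLetter_eq_succ_iff {σ : ℕ → Option ℝ} {j k : ℕ} :
    stepLetter σ k = j + 1 ↔ j ≤ k ∧ IsRun σ (k - j) j := by
  induction j generalizing k with
  | zero =>
    match k with
    | 0 => simp [stepLetter, IsRun]
    | 1 => simp [stepLetter, IsRun]
    | k + 2 =>
      rcases h : σ (k + 2) with _ | c
      · simp only [stepLetter_of_none h, IsRun]
        simp only [Nat.sub_zero, h, true_and, Nat.zero_le]
        exact ⟨fun _ => ⟨by omega, fun t _ _ => by omega⟩, fun _ => trivial⟩
      · rw [stepLetter_of_some h]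
        simp only [IsRun, Nat.sub_zero, h, reduceCtorEq, false_and, and_false, iff_false]
        rcases stepLetter σ (k + 1) with _ | a
        · simp
        · by_cases hc : c = 0 <;> simp [hc]
  | succ j ih =>
    match k with
    | 0 => simp [stepLetter]
    | 1 =>
      simp only [stepLetter, IsRun]
      constructor
      · intro h; omega
      · rintro ⟨_, h, _⟩; omega
    | k + 2 =>
      have hstep : stepLetter σ (k + 2) = j + 1 + 1 ↔
          σ (k + 2) = some 0 ∧ stepLetter σ (k + 1) = j + 1 := by
        rcases h : σ (k + 2) with _ | c
        · simp [stepLetter_of_none h]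
        · rw [stepLetter_of_some h]
          rcases stepLetter σ (k + 1) with _ | a
          · simp
          · by_cases hc : c = 0 <;> simp [hc]
      rw [hstep, ih]
      rw [show k + 2 - (j + 1) = k + 1 - j by omega]
      constructor
      · rintro ⟨h0, hj, h2, hn, hr⟩
        refine ⟨by omega, h2, hn, fun t h1 ht => ?_⟩
        rcases ht.lt_or_eq with h | rfl
        · exact hr t h1 (by omega)
        · rwa [show k + 1 - j + (j + 1) = k + 2 by omega]
      · rintro ⟨hj, h2, hn, hr⟩
        refine ⟨?_, by omega, h2, hn, fun t h1 ht => hr t h1 (by omega)⟩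
        have := hr (j + 1) (by omega) le_rfl
        rwa [show k + 1 - j + (j + 1) = k + 2 by omega] at this

lemma IsRun.stepLetter {σ : ℕ → Option ℝ} {k j t : ℕ} (h : IsRun σ k j) (ht : t ≤ j) :
    stepLetter σ (k + t) = t + 1 := by
  rw [stepLetter_eq_succ_iff]
  refine ⟨by omega, ?_⟩
  rw [show k + t - t = k by omega]
  exact ⟨h.1, h.2.1, fun r h1 hr => h.2.2 r h1 (by omega)⟩

/-- Step `k ≥ 1` contributes the letter at position `k - 1` of a word of length `n - 3`, so a block
followed by `i - j` letters begins at step `n - 3 - i`. Its last letter `a_{j+1}` alone determines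
the block, and `i + 5 ≤ n` says that the block begins at step `2` or later. -/
lemma KRSequence.exists_word_eq_iff {n : ℕ} (s : KRSequence n) {i j : ℕ} (hj : j ≤ i) :
    (∃ w₁ w₂ : List ℕ, w₂.length = i - j ∧ s.word = w₁ ++ ascendingWord (j + 1) ++ w₂) ↔
      i + 5 ≤ n ∧ IsRun s.step (n - 3 - i) j := by
  have hn := s.three_le
  constructor
  · rintro ⟨w₁, w₂, hw₂, hw⟩
    have hlen := congrArg List.length hw
    simp only [s.length_word, List.length_append, ascendingWord, List.length_range', hw₂] at hlen
    have hget : s.word[w₁.length + j]? = some (j + 1) := by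
      rw [hw, List.append_assoc, List.getElem?_append_right (by omega),
        List.getElem?_append_left (by simp [ascendingWord])]
      simp [ascendingWord, Nat.add_comm]
    rw [s.word_eq, List.getElem?_map, List.getElem?_range (by omega)] at hget
    have hl : Goursat.stepLetter s.step (w₁.length + j + 1) = j + 1 := by simpa using hget
    rw [stepLetter_eq_succ_iff] at hl
    have h2 := hl.2.1
    refine ⟨by omega, ?_⟩
    rw [show n - 3 - i = w₁.length + j + 1 - j by omega]
    exact hl.2
  · rintro ⟨hi, hrun⟩
    refine ⟨(List.range (n - 4 - i)).map fun i => Goursat.stepLetter s.step (i + 1),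
      (List.range (i - j)).map fun t =>
        Goursat.stepLetter s.step ((n - 4 - i) + (j + 1) + t + 1), by simp, ?_⟩
    rw [s.word_eq]
    conv_lhs => rw [show n - 3 = (n - 4 - i) + (j + 1) + (i - j) by omega]
    rw [map_range_add, map_range_add]
    congr 2
    rw [ascendingWord_eq_map]
    refine List.map_congr_left fun t ht => ?_
    have ht' := List.mem_range.1 ht
    rw [show n - 4 - i + t + 1 = n - 3 - i + t by omega, hrun.stepLetter (by omega)]

/-- Every word of the Jacquard language is the word of a sequence of prolongations. -/
lemma exists_word_eq {m : ℕ} {w : List ℕ} (hw : w ∈ jacquard m) :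
    ∃ (n : ℕ) (s : KRSequence n), s.word = w := by
  have hne : ∀ {n : ℕ} (s : KRSequence n), s.word ≠ [] → n ≠ 3 := by
    rintro n s hs rfl
    exact hs (List.length_eq_zero_iff.1 (by simp [s.length_word]))
  induction m using Nat.strong_induction_on generalizing w with
  | _ m ih =>
    match m, ih, hw with
    | 0, _, hw =>
      simp only [jacquard, Set.mem_singleton_iff] at hw
      exact ⟨3, .base, by rw [KRSequence.word, hw]⟩
    | 1, _, hw =>
      simp only [jacquard, Set.mem_singleton_iff] at hw
      exact ⟨4, .singular .base, by rw [KRSequence.word, hw]⟩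
    | m + 2, ih, hw =>
      rw [jacquard] at hw
      rcases hw with ⟨u, hu, rfl⟩ | hw
      · obtain ⟨n, s, rfl⟩ := ih (m + 1) (by omega) hu
        have hs : s.word ≠ [] := fun h => by simpa [h] using length_of_mem_jacquard hu
        -- Any nonzero constant produces `a_0`, whatever letter precedes it.
        refine ⟨n + 1, .regular 1 s, ?_⟩
        rw [s.word_regular 1 (hne s hs)]
        congr 2
        rcases s.word.getLast? with _ | (_ | a) <;> simp
      · obtain ⟨k, u, hu, rfl⟩ := Set.mem_iUnion.1 hw
        obtain ⟨n, s, rfl⟩ := ih (m + 1 - k) (by omega) hu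
        have hs : s.word ≠ [] := fun h => by
          have := length_of_mem_jacquard hu
          rw [h, List.length_nil] at this
          omega
        -- The block `a_1 ⋯ a_{k+1}` comes from one singular prolongation followed by `k`
        -- prolongations `R_0`.
        generalize (k : ℕ) = k
        induction k with
        | zero => exact ⟨n + 1, .singular s, s.word_singular (hne s hs)⟩
        | succ k ihk =>
          obtain ⟨n', s', hs'⟩ := ihk
          have hlast : s'.word.getLast? = some (k + 1) := by
            rw [hs', ascendingWord_succ, ← List.append_assoc, List.getLast?_concat]
          refine ⟨n' + 1, .regular 0 s', ?_⟩
          rw [s'.word_regular 0 (hne s' (by rw [hs', ascendingWord_succ]; simp)), hlast, hs',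
            ascendingWord_succ (k + 1), List.append_assoc]
          simp

end Words

/-! ### Existence, uniqueness and admissibility of the singularity type -/

section SingularityType

variable {n : ℕ} {M : Type*} [TopologicalSpace M] [ChartedSpace (EuclideanSpace ℝ (Fin n)) M]
  [IsManifold (𝓡 n) ∞ M] {D : SubspaceField n M} {p : M}

lemma IsTypeLetter.unique {i l l' : ℕ} (h : IsTypeLetter D p i l) (h' : IsTypeLetter D p i l') :
    l = l' := by
  by_cases hj : ∃ j, p ∈ canonicalSet D (i + j) j
  · obtain ⟨j, hj⟩ := hj
    rw [h.1 j hj, h'.1 j hj]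
  · push Not at hj
    rw [h.2 hj, h'.2 hj]

lemma IsGoursat.exists_isTypeLetter (hD : IsGoursat D) (p : M) (i : ℕ) :
    ∃ l, IsTypeLetter D p i l := by
  by_cases hj : ∃ j, p ∈ canonicalSet D (i + j) j
  · obtain ⟨j, hj⟩ := hj
    refine ⟨j + 1, fun k hk => ?_, fun h => absurd hj (h j)⟩
    by_contra hne
    have := hD.canonicalSet_inter_eq_empty i j k (by omega)
    exact (this ▸ ⟨hj, hk⟩ : p ∈ (∅ : Set M))
  · push Not at hj
    exact ⟨0, fun j h => absurd h (hj j), fun _ => rfl⟩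

theorem IsGoursat.existsUnique_isSingularityType (hD : IsGoursat D) (p : M) :
    ∃! w : List ℕ, IsSingularityType D p w := by
  choose l hl using hD.exists_isTypeLetter p
  refine ⟨_, ⟨l, fun i _ => hl i, rfl⟩, ?_⟩
  rintro _ ⟨l', hl', rfl⟩
  refine List.map_congr_left fun i hi => ?_
  have : i < n - 3 := by simpa using hi
  exact (hl' i (by omega)).unique (hl i)

lemma map_reverse_range (l : ℕ → ℕ) (m : ℕ) :
    (List.range m).reverse.map l = (List.range m).map fun i => l (m - 1 - i) := by
  refine List.ext_getElem (by simp) fun i h1 h2 => ?_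
  simp

/-- The leading letter `w_{n-4}` is `a_0` because `S_j^{(i)}` is empty for `i ≥ n - 4`. If `w_a =
a_{j+2}`, then `p ∈ S_{j+1}^{(a+1+j)} ⊂ S_j^{(a+1+j)}`, so the preceding letter `w_{a+1}` is
`a_{j+1}`. -/
theorem IsSingularityType.mem_jacquard {w : List ℕ} (hw : IsSingularityType D p w) :
    w ∈ jacquard (n - 3) := by
  obtain ⟨l, hl, rfl⟩ := hw
  rw [map_reverse_range]
  refine map_range_mem_jacquard _ _ (fun h => (hl _ (by omega)).2 fun j hj => ?_) fun i hi => ?_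
  · have := (le_of_mem_canonicalSet hj).1
    omega
  · obtain ⟨a, ha⟩ : ∃ a, a = n - 3 - 1 - (i + 1) := ⟨_, rfl⟩
    rw [← ha, show n - 3 - 1 - i = a + 1 by omega]
    by_cases hj : ∃ j, p ∈ canonicalSet D (a + j) j
    · obtain ⟨j, hj⟩ := hj
      rw [(hl a (by omega)).1 j hj]
      rcases j with _ | j
      · exact Or.inl le_rfl
      · have h1 := canonicalSet_succ_subset D _ j hj
        rw [show a + (j + 1) = a + 1 + j by omega] at h1
        rw [(hl (a + 1) (by omega)).1 j h1]
        exact Or.inr rfl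
    · push Not at hj
      rw [(hl a (by omega)).2 hj]
      exact Or.inl (Nat.zero_le _)

end SingularityType

end Goursat

end

noncomputable section

namespace Goursat

/-! ### Kumpera–Ruiz fields in coordinates -/

section KumperaRuizFields

variable {n : ℕ} {σ τ : ℕ → Option ℝ} {k m : ℕ} {x : EuclideanSpace ℝ (Fin n)}

/-- The `a`-th coordinate, `0` for `n ≤ a`. -/
def coord (n a : ℕ) : EuclideanSpace ℝ (Fin n) →L[ℝ] ℝ :=
  if h : a < n then EuclideanSpace.proj ⟨a, h⟩ else 0

/-- The `a`-th coordinate vector, `0` for `n ≤ a`. -/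
def coordVec (n a : ℕ) : EuclideanSpace ℝ (Fin n) :=
  if h : a < n then EuclideanSpace.single ⟨a, h⟩ 1 else 0

lemma coord_val (a : Fin n) : coord n a x = x a := by simp [coord]

lemma coord_of_lt {a : ℕ} (h : a < n) : coord n a x = x ⟨a, h⟩ := by simp [coord, h]

lemma coordVec_of_lt {a : ℕ} (h : a < n) : coordVec n a = EuclideanSpace.single ⟨a, h⟩ 1 := by
  simp [coordVec, h]

lemma coordVec_apply (a : ℕ) (b : Fin n) : coordVec n a b = if (b : ℕ) = a then 1 else 0 := by
  by_cases h : a < n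
  · simp [coordVec_of_lt h, Fin.ext_iff]
  · rw [if_neg (by omega)]
    simp [coordVec, h]

lemma coord_coordVec {a b : ℕ} (h : a ≠ b) : coord n a (coordVec n b) = 0 := by
  by_cases ha : a < n
  · rw [coord_of_lt ha, coordVec_apply, if_neg h]
  · simp [coord, ha]

lemma coord_coordVec_self {a : ℕ} (h : a < n) : coord n a (coordVec n a) = 1 := by
  rw [coord_of_lt h, coordVec_apply, if_pos rfl]

/-- The second field of the Kumpera–Ruiz normal form with prolongations `σ`, in dimension `k + 2`,
lifted to dimension `n`. -/
def krField (σ : ℕ → Option ℝ) : ℕ → EuclideanSpace ℝ (Fin n) → EuclideanSpace ℝ (Fin n)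
  | 0 => fun _ => coordVec n 0
  | k + 1 => fun x =>
    match σ k with
    | none => coordVec n (k + 1) + coord n (k + 2) x • krField σ k x
    | some c => (coord n (k + 2) x + c) • coordVec n (k + 1) + krField σ k x

lemma krField_zero : krField (n := n) σ 0 = fun _ => coordVec n 0 := rfl

lemma krField_none (h : σ k = none) : krField (n := n) σ (k + 1) =
    fun x => coordVec n (k + 1) + coord n (k + 2) x • krField σ k x := by
  funext x; rw [krField, h]

lemma krField_some {c : ℝ} (h : σ k = some c) : krField (n := n) σ (k + 1) =
    fun x => (coord n (k + 2) x + c) • coordVec n (k + 1) + krField σ k x := by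
  funext x; rw [krField, h]

lemma krField_congr (h : ∀ i < k, σ i = τ i) : krField (n := n) σ k = krField τ k := by
  induction k with
  | zero => rfl
  | succ k ih =>
    funext x
    rw [krField, krField, h k (by omega), ih fun i hi => h i (by omega)]

lemma contDiff_krField (σ : ℕ → Option ℝ) (k : ℕ) : ContDiff ℝ ∞ (krField (n := n) σ k) := by
  induction k with
  | zero => exact contDiff_const
  | succ k ih =>
    rcases h : σ k with _ | c
    · rw [krField_none h]
      exact contDiff_const.add ((coord n (k + 2)).contDiff.smul ih)
    · rw [krField_some h]
      exact (((coord n (k + 2)).contDiff.add contDiff_const).smul contDiff_const).add ih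

lemma differentiableAt_krField (σ : ℕ → Option ℝ) (k : ℕ) (x : EuclideanSpace ℝ (Fin n)) :
    DifferentiableAt ℝ (krField (n := n) σ k) x :=
  ((contDiff_krField σ k).differentiable (by simp)) x

lemma fderiv_krField_none (h : σ k = none) (x v : EuclideanSpace ℝ (Fin n)) :
    fderiv ℝ (krField (n := n) σ (k + 1)) x v =
      coord n (k + 2) x • fderiv ℝ (krField σ k) x v + coord n (k + 2) v • krField σ k x := by
  have h1 := ((coord n (k + 2)).hasFDerivAt (x := x)).smul
    (differentiableAt_krField σ k x).hasFDerivAt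
  have h2 : HasFDerivAt (krField σ (k + 1)) _ x :=
    (h1.const_add (coordVec n (k + 1))).congr_of_eventuallyEq (.of_eq (krField_none h))
  rw [h2.fderiv]
  simp

lemma fderiv_krField_some {c : ℝ} (h : σ k = some c) (x v : EuclideanSpace ℝ (Fin n)) :
    fderiv ℝ (krField (n := n) σ (k + 1)) x v =
      coord n (k + 2) v • coordVec n (k + 1) + fderiv ℝ (krField σ k) x v := by
  have h1 := (((coord n (k + 2)).hasFDerivAt (x := x)).add_const c).smul_const (coordVec n (k + 1))
  have h2 : HasFDerivAt (krField σ (k + 1)) _ x :=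
    (h1.add (differentiableAt_krField σ k x).hasFDerivAt).congr_of_eventuallyEq
      (.of_eq (krField_some h))
  rw [h2.fderiv]
  simp

/-- The field involves only coordinates of zero-based index at most `k + 1`. -/
lemma fderiv_krField_coordVec {a : ℕ} (ha : k + 1 < a) (x : EuclideanSpace ℝ (Fin n)) :
    fderiv ℝ (krField (n := n) σ k) x (coordVec n a) = 0 := by
  induction k with
  | zero => simp [krField_zero]
  | succ k ih =>
    rcases h : σ k with _ | c
    · rw [fderiv_krField_none h, ih (by omega), coord_coordVec (by omega)]
      simp
    · rw [fderiv_krField_some h, ih (by omega), coord_coordVec (by omega)]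
      simp

lemma krField_add_smul_coordVec {a : ℕ} (ha : k + 1 < a) (x : EuclideanSpace ℝ (Fin n)) (t : ℝ) :
    krField σ k (x + t • coordVec n a) = krField σ k x := by
  induction k with
  | zero => rfl
  | succ k ih =>
    have h1 : coord n (k + 2) (x + t • coordVec n a) = coord n (k + 2) x := by
      rw [map_add, map_smul, coord_coordVec (by omega), smul_zero, add_zero]
    rcases h : σ k with _ | c
    · simp only [krField_none h, ih (by omega), h1]
    · simp only [krField_some h, ih (by omega), h1]

lemma krField_apply_of_lt {b : Fin n} (hb : k < b) : krField σ k x b = 0 := by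
  induction k with
  | zero => rw [krField_zero, coordVec_apply, if_neg (by omega)]
  | succ k ih =>
    rcases h : σ k with _ | c
    · simp [krField_none h, ih (by omega), coordVec_apply, show (b : ℕ) ≠ k + 1 by omega]
    · simp [krField_some h, ih (by omega), coordVec_apply, show (b : ℕ) ≠ k + 1 by omega]

/-- The vectors whose first `r` coordinates vanish. -/
def tail (n r : ℕ) : Submodule ℝ (EuclideanSpace ℝ (Fin n)) where
  carrier := {v | ∀ a : Fin n, (a : ℕ) < r → v a = 0}
  zero_mem' := fun _ _ => rfl
  add_mem' := fun {v w} hv hw a ha => by simp [hv a ha, hw a ha]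
  smul_mem' := fun c v hv a ha => by simp [hv a ha]

lemma tail_anti {r s : ℕ} (h : r ≤ s) : tail n s ≤ tail n r := fun _ hv a ha => hv a (by omega)

lemma coordVec_mem_tail {a r : ℕ} (h : r ≤ a) : coordVec n a ∈ tail n r := fun b hb => by
  rw [coordVec_apply, if_neg (by omega)]

lemma tail_eq_span (n r : ℕ) :
    tail n r = Submodule.span ℝ (Set.range fun a : {a : Fin n // r ≤ a} => coordVec n a.1) := by
  refine le_antisymm (fun v hv => ?_) (Submodule.span_le.2 ?_)
  · have : v = ∑ a : Fin n, v a • coordVec n a := by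
      ext b
      simp [coordVec_apply, Fin.val_inj]
    rw [this]
    refine Submodule.sum_mem _ fun a _ => ?_
    by_cases ha : r ≤ a
    · exact Submodule.smul_mem _ _ (Submodule.subset_span ⟨⟨a, ha⟩, rfl⟩)
    · rw [hv a (by omega), zero_smul]
      exact zero_mem _
  · rintro _ ⟨a, rfl⟩
    exact coordVec_mem_tail a.2

lemma linearIndependent_coordVec (n r : ℕ) :
    LinearIndependent ℝ fun a : {a : Fin n // r ≤ a} => coordVec n a.1 := by
  have h := (EuclideanSpace.basisFun (Fin n) ℝ).toBasis.linearIndependent.comp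
    (fun a : {a : Fin n // r ≤ a} => a.1) Subtype.val_injective
  refine (?_ : (fun a : {a : Fin n // r ≤ a} => coordVec n a.1) = _) ▸ h
  funext a
  simp [coordVec_of_lt a.1.2]

lemma card_tail_index (n r : ℕ) : Fintype.card {a : Fin n // r ≤ a} = n - r := by
  rw [Fintype.card_subtype]
  by_cases h : r < n
  · rw [show (Finset.univ.filter fun a : Fin n => r ≤ a) = Finset.Ici ⟨r, h⟩ by
      ext a; simp [Fin.le_def]]
    simp
  · rw [Finset.filter_false_of_mem fun a _ => by omega]
    simp; omega

lemma finrank_tail (n r : ℕ) : Module.finrank ℝ (tail n r) = n - r := by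
  rw [tail_eq_span, finrank_span_eq_card (linearIndependent_coordVec n r), card_tail_index]

/-- A singular step puts the component `1` on the new axis; a regular one leaves the lower
components unchanged, and these are nonzero by induction. -/
lemma krField_notMem_tail (hk : k < n) : krField σ k x ∉ tail n (k + 1) := by
  induction k with
  | zero =>
    intro h
    have := h ⟨0, hk⟩ (by simp)
    simp [krField_zero, coordVec_apply] at this
  | succ k ih =>
    intro h
    rcases hs : σ k with _ | c
    · have h1 := h ⟨k + 1, hk⟩ (by simp)
      simp [krField_none hs, coordVec_apply, krField_apply_of_lt] at h1
    · refine ih (by omega) fun a ha => ?_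
      have h1 := h a (by omega)
      simpa [krField_some hs, coordVec_apply, ha.ne] using h1

/-- Modulo the tail the field is `krField σ k`, multiplied by the new coordinate if the step is
singular, and `krField σ k` itself never lies in the tail. This is where `S_0^{(i)}` becomes a
coordinate hyperplane. -/
lemma krField_succ_mem_tail_iff (hk : k + 2 < n) :
    krField σ (k + 1) x ∈ tail n (k + 1) ↔ σ k = none ∧ coord n (k + 2) x = 0 := by
  rcases hs : σ k with _ | c
  · rw [krField_none hs]
    simp only [true_and]
    rw [Submodule.add_mem_iff_right _ (coordVec_mem_tail le_rfl)]
    refine ⟨fun h => ?_, fun h => by rw [h, zero_smul]; exact zero_mem _⟩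
    by_contra h0
    exact krField_notMem_tail (by omega) ((Submodule.smul_mem_iff _ h0).1 h)
  · rw [krField_some hs]
    simp only [reduceCtorEq, false_and, iff_false]
    rw [Submodule.add_mem_iff_right _ (Submodule.smul_mem _ _ (coordVec_mem_tail le_rfl))]
    exact krField_notMem_tail (by omega)

/-- Along the locus of a run, only the first step of the run contributes. -/
lemma IsRun.krField_eq {j : ℕ} (h : IsRun σ k j)
    (hx : ∀ t, 1 ≤ t → t ≤ j → coord n (k + 2 + t) x = 0) :
    krField σ (k + 1 + j) x = krField σ (k + 1) x := by
  induction j with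
  | zero => rfl
  | succ j ih =>
    have h1 := h.2.2 (j + 1) (by omega) le_rfl
    rw [show k + 1 + (j + 1) = k + 1 + j + 1 by omega,
      krField_some (show σ (k + 1 + j) = some 0 by rw [← h1]; congr 1; omega)]
    have h2 := hx (j + 1) (by omega) le_rfl
    rw [show k + 2 + (j + 1) = k + 1 + j + 2 by omega] at h2
    simp only [h2, add_zero, zero_smul, zero_add]
    exact ih ⟨h.1, h.2.1, fun t h3 h4 => h.2.2 t h3 (by omega)⟩ fun t h3 h4 => hx t h3 (by omega)

/-- The fields of subspaces of the derived flag of a Kumpera–Ruiz normal form. -/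
def krSpan (σ : ℕ → Option ℝ) (m : ℕ) (x : EuclideanSpace ℝ (Fin n)) :
    Submodule ℝ (EuclideanSpace ℝ (Fin n)) := tail n (m + 1) ⊔ ℝ ∙ krField σ m x

/-- A frame of `krSpan σ m`. -/
def krFrame (σ : ℕ → Option ℝ) (m : ℕ) (o : Option {a : Fin n // m + 1 ≤ a})
    (x : EuclideanSpace ℝ (Fin n)) : EuclideanSpace ℝ (Fin n) :=
  o.casesOn' (krField σ m x) fun a => coordVec n a.1

lemma krField_mem_krSpan : krField σ m x ∈ krSpan σ m x :=
  Submodule.mem_sup_right (Submodule.mem_span_singleton_self _)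

lemma tail_le_krSpan {r : ℕ} (h : m + 1 ≤ r) : tail n r ≤ krSpan σ m x :=
  (tail_anti h).trans le_sup_left

lemma krSpan_eq_span : krSpan σ m x = Submodule.span ℝ (Set.range fun o => krFrame σ m o x) := by
  have : (Set.range fun o => krFrame (n := n) σ m o x) =
      (Set.range fun a : {a : Fin n // m + 1 ≤ a} => coordVec n a.1) ∪ {krField σ m x} := by
    ext v
    constructor
    · rintro ⟨_ | a, rfl⟩
      · exact Or.inr rfl
      · exact Or.inl ⟨a, rfl⟩
    · rintro (⟨a, rfl⟩ | rfl)
      · exact ⟨some a, rfl⟩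
      · exact ⟨none, rfl⟩
  rw [this, Submodule.span_union, ← tail_eq_span]
  rfl

lemma linearIndependent_krFrame (hm : m < n) :
    LinearIndependent ℝ fun o => krFrame (n := n) σ m o x := by
  refine LinearIndependent.option (linearIndependent_coordVec n (m + 1)) ?_
  rw [← tail_eq_span]
  exact krField_notMem_tail hm

lemma finrank_krSpan (hm : m < n) : Module.finrank ℝ (krSpan (n := n) σ m x) = n - m := by
  rw [krSpan_eq_span, finrank_span_eq_card (linearIndependent_krFrame hm), Fintype.card_option,
    card_tail_index]
  omega

lemma krSpan_succ_le : krSpan (n := n) σ (m + 1) x ≤ krSpan σ m x := by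
  refine sup_le (tail_le_krSpan (by omega)) ((Submodule.span_singleton_le_iff_mem _ _).2 ?_)
  have h1 : coordVec n (m + 1) ∈ krSpan σ m x := tail_le_krSpan le_rfl (coordVec_mem_tail le_rfl)
  rcases h : σ m with _ | c
  · rw [krField_none h]
    exact add_mem h1 (Submodule.smul_mem _ _ krField_mem_krSpan)
  · rw [krField_some h]
    exact add_mem (Submodule.smul_mem _ _ h1) krField_mem_krSpan

lemma fderiv_krField_mem_krSpan {a : ℕ} (ha : m + 2 ≤ a) :
    fderiv ℝ (krField (n := n) σ (m + 1)) x (coordVec n a) ∈ krSpan σ m x := by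
  rcases h : σ m with _ | c
  · rw [fderiv_krField_none h, fderiv_krField_coordVec (by omega), smul_zero, zero_add]
    exact Submodule.smul_mem _ _ krField_mem_krSpan
  · rw [fderiv_krField_some h, fderiv_krField_coordVec (by omega), add_zero]
    exact Submodule.smul_mem _ _ (tail_le_krSpan le_rfl (coordVec_mem_tail le_rfl))

/-- `krSpan σ m` is spanned by `krSpan σ (m + 1)` and a bracket. -/
lemma krSpan_le_of_mem (hm : m + 2 < n) {S : Submodule ℝ (EuclideanSpace ℝ (Fin n))}
    (hS : krSpan σ (m + 1) x ≤ S)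
    (h : fderiv ℝ (krField (n := n) σ (m + 1)) x (coordVec n (m + 2)) ∈ S) :
    krSpan σ m x ≤ S := by
  have hY : krField σ (m + 1) x ∈ S := hS krField_mem_krSpan
  -- The bracket is one of the two missing vectors, `krField σ m` for a singular and `coordVec n (m
  -- + 1)` for a regular step; the other is then recovered from `krField σ (m + 1)`.
  have key : krField σ m x ∈ S ∧ coordVec n (m + 1) ∈ S := by
    rcases hs : σ m with _ | c
    · rw [fderiv_krField_none hs, fderiv_krField_coordVec (by omega), smul_zero, zero_add,
        coord_coordVec_self hm, one_smul] at h
      rw [krField_none hs] at hY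
      exact ⟨h, (Submodule.add_mem_iff_left _ (Submodule.smul_mem _ _ h)).1 hY⟩
    · rw [fderiv_krField_some hs, fderiv_krField_coordVec (by omega), add_zero,
        coord_coordVec_self hm, one_smul] at h
      rw [krField_some hs] at hY
      exact ⟨(Submodule.add_mem_iff_right _ (Submodule.smul_mem _ _ h)).1 hY, h⟩
  refine sup_le ?_ ((Submodule.span_singleton_le_iff_mem _ _).2 key.1)
  rw [tail_eq_span, Submodule.span_le]
  rintro _ ⟨a, rfl⟩
  rcases a.2.eq_or_lt with h1 | h1
  · exact (congrArg (coordVec n · ∈ S) h1).mp key.2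
  · exact hS (tail_le_krSpan le_rfl (coordVec_mem_tail h1))

lemma krSpan_add_smul_coordVec {a : ℕ} (ha : m + 2 ≤ a) (t : ℝ) :
    krSpan σ m (x + t • coordVec n a) = krSpan σ m x := by
  rw [krSpan, krField_add_smul_coordVec (by omega), krSpan]

/-- On the line through `x` in this direction the subspace is constant, so the section restricts to
a curve in a fixed subspace. Pairing with the orthogonal complement shows that its derivative stays
there. -/
lemma fderiv_mem_krSpan {a : ℕ} (ha : m + 2 ≤ a)
    {X : EuclideanSpace ℝ (Fin n) → EuclideanSpace ℝ (Fin n)} (hX : DifferentiableAt ℝ X x)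
    (h : ∀ᶠ y in nhds x, X y ∈ krSpan σ m y) : fderiv ℝ X x (coordVec n a) ∈ krSpan σ m x := by
  rw [← Submodule.orthogonal_orthogonal (krSpan σ m x), Submodule.mem_orthogonal]
  intro w hw
  have hline : HasDerivAt (fun t : ℝ => x + t • coordVec n a) (coordVec n a) 0 := by
    simpa using ((hasDerivAt_id (0 : ℝ)).smul_const (coordVec n a)).const_add x
  have hx0 : x + (0 : ℝ) • coordVec n a = x := by simp
  have h1 : HasDerivAt (fun t : ℝ => X (x + t • coordVec n a)) (fderiv ℝ X x (coordVec n a)) 0 := by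
    refine HasFDerivAt.comp_hasDerivAt (l := X) (0 : ℝ) ?_ hline
    rw [hx0]
    exact hX.hasFDerivAt
  have h2 := (innerSL ℝ w).hasFDerivAt.comp_hasDerivAt (0 : ℝ) h1
  have h3 : (fun t : ℝ => innerSL ℝ w (X (x + t • coordVec n a))) =ᶠ[nhds 0] fun _ => 0 := by
    have hc : Filter.Tendsto (fun t : ℝ => x + t • coordVec n a) (nhds 0) (nhds x) := by
      have := hline.continuousAt.tendsto
      rwa [hx0] at this
    filter_upwards [hc.eventually h] with t ht
    rw [krSpan_add_smul_coordVec ha] at ht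
    exact Submodule.inner_left_of_mem_orthogonal ht hw
  exact h2.unique ((hasDerivAt_const (0 : ℝ) (0 : ℝ)).congr_of_eventuallyEq h3)

end KumperaRuizFields

/-! ### Closed form of the normal forms defined by successive prolongation -/

section Prolongations

lemma liftField_add {n : ℕ} (f g : EuclideanSpace ℝ (Fin n) → EuclideanSpace ℝ (Fin n)) :
    liftField (fun x => f x + g x) = fun x => liftField f x + liftField g x := by
  funext x
  ext b
  refine Fin.lastCases ?_ (fun b => ?_) b <;> simp [liftField]

lemma liftField_smul {n : ℕ} {c : EuclideanSpace ℝ (Fin n) → ℝ}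
    {d : EuclideanSpace ℝ (Fin (n + 1)) → ℝ}
    (h : ∀ x : EuclideanSpace ℝ (Fin (n + 1)), c (WithLp.toLp 2 fun b => x b.castSucc) = d x)
    (f : EuclideanSpace ℝ (Fin n) → EuclideanSpace ℝ (Fin n)) :
    liftField (fun x => c x • f x) = fun x => d x • liftField f x := by
  funext x
  ext b
  refine Fin.lastCases ?_ (fun b => ?_) b <;> simp [liftField, h]

lemma liftField_coordVec {n a : ℕ} (ha : a < n) :
    liftField (fun _ => coordVec n a) = fun _ => coordVec (n + 1) a := by
  funext x
  ext b
  refine Fin.lastCases ?_ (fun b => ?_) b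
  · simp [liftField, coordVec_apply, ha.ne']
  · simp [liftField, coordVec_apply]

lemma coord_castSucc {n a : ℕ} (ha : a < n) (x : EuclideanSpace ℝ (Fin (n + 1))) :
    coord n a (WithLp.toLp 2 fun b => x b.castSucc) = coord (n + 1) a x := by
  rw [coord_of_lt ha, coord_of_lt (by omega)]
  rfl

lemma liftField_krField {n : ℕ} (σ : ℕ → Option ℝ) {k : ℕ} (hk : k + 1 < n) :
    liftField (krField (n := n) σ k) = krField σ k := by
  induction k with
  | zero => exact liftField_coordVec (by omega)
  | succ k ih =>
    rcases h : σ k with _ | c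
    · rw [krField_none h, liftField_add, liftField_coordVec (by omega),
        liftField_smul (coord_castSucc (by omega)), ih (by omega), krField_none h]
    · rw [krField_some h, liftField_add, ih (by omega),
        liftField_smul (d := fun x => coord (n + 1) (k + 2) x + c)
          (fun x => by rw [coord_castSucc (by omega)]), liftField_coordVec (by omega),
        krField_some h]

lemma KRSequence.fields_eq {n : ℕ} (s : KRSequence n) :
    s.fields = (fun _ => coordVec n (n - 1), krField s.step (n - 2)) := by
  induction s with
  | base =>
    refine Prod.ext ?_ ?_
    · funext x
      simp [KRSequence.fields, coordVec]
    · funext x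
      simp [KRSequence.fields, coordVec, krField, KRSequence.step, coord]
  | @singular n s ih =>
    have hn := s.three_le
    obtain ⟨m, rfl⟩ : ∃ m, n = m + 2 := ⟨n - 2, by omega⟩
    have hlast : ∀ x : EuclideanSpace ℝ (Fin (m + 2 + 1)), coord (m + 2 + 1) (m + 2) x =
        x (Fin.last _) := fun x => coord_of_lt (by omega)
    have hstep : (KRSequence.singular s).step m = none := Function.update_self _ _ _
    rw [KRSequence.fields, ih]
    refine Prod.ext ?_ ?_
    · funext x
      exact (coordVec_of_lt (by omega)).symm
    · simp only [Nat.add_sub_cancel, show m + 2 - 1 = m + 1 by omega,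
        show m + 2 + 1 - 2 = m + 1 by omega]
      rw [krField_none hstep, liftField_coordVec (by omega), liftField_krField _ (by omega)]
      funext x
      rw [hlast, krField_congr fun i hi => ?_]
      exact (Function.update_of_ne (by omega) _ _).symm
  | @regular n c s ih =>
    have hn := s.three_le
    obtain ⟨m, rfl⟩ : ∃ m, n = m + 2 := ⟨n - 2, by omega⟩
    have hlast : ∀ x : EuclideanSpace ℝ (Fin (m + 2 + 1)), coord (m + 2 + 1) (m + 2) x =
        x (Fin.last _) := fun x => coord_of_lt (by omega)
    have hstep : (KRSequence.regular c s).step m = some c := Function.update_self _ _ _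
    rw [KRSequence.fields, ih]
    refine Prod.ext ?_ ?_
    · funext x
      exact (coordVec_of_lt (by omega)).symm
    · simp only [Nat.add_sub_cancel, show m + 2 - 1 = m + 1 by omega,
        show m + 2 + 1 - 2 = m + 1 by omega]
      rw [krField_some hstep, liftField_coordVec (by omega), liftField_krField _ (by omega)]
      funext x
      rw [hlast, krField_congr fun i hi => ?_]
      exact (Function.update_of_ne (by omega) _ _).symm

end Prolongations

end Goursat

end

noncomputable section

namespace Goursat

open Set Topology VectorField

/-! ### Derived flag and characteristic fields of a normal form -/

section KumperaRuizFlag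

variable {n : ℕ} {σ : ℕ → Option ℝ} {k m : ℕ} {x : EuclideanSpace ℝ (Fin n)}

lemma smoothFieldOn_iff_contDiffOn {X : VField n (EuclideanSpace ℝ (Fin n))}
    {U : Set (EuclideanSpace ℝ (Fin n))} : SmoothFieldOn X U ↔
      ContDiffOn ℝ ∞ (fun y => (X y : EuclideanSpace ℝ (Fin n))) U :=
  contMDiffOn_vectorSpace_iff_contDiffOn

/-- A map from `ℝ^n` to `ℝ^n` as a vector field. -/
def asField (f : EuclideanSpace ℝ (Fin n) → EuclideanSpace ℝ (Fin n)) :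
    VField n (EuclideanSpace ℝ (Fin n)) := f

lemma lieBracket_const (v : EuclideanSpace ℝ (Fin n))
    (f : EuclideanSpace ℝ (Fin n) → EuclideanSpace ℝ (Fin n)) (x : EuclideanSpace ℝ (Fin n)) :
    lieBracket ℝ (fun _ => v) f x = fderiv ℝ f x v := by
  simp [lieBracket_eq]

lemma mlieBracket_coordVec (a : ℕ) (Y : VField n (EuclideanSpace ℝ (Fin n)))
    (x : EuclideanSpace ℝ (Fin n)) : mlieBracket (𝓡 n) (asField fun _ => coordVec n a) Y x =
      fderiv ℝ (fun y => (Y y : EuclideanSpace ℝ (Fin n))) x (coordVec n a) :=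
  (congrFun (mlieBracketWithin_eq_lieBracketWithin (𝕜 := ℝ)
    (V := asField fun _ => coordVec n a) (W := Y) (s := univ)) x).trans
    ((congrFun lieBracketWithin_univ x).trans (lieBracket_const _ _ x))

lemma mlieBracket_coordVec_mem_iff {a : ℕ} {Y : VField n (EuclideanSpace ℝ (Fin n))}
    {S : Submodule ℝ (EuclideanSpace ℝ (Fin n))} :
    (mlieBracket (𝓡 n) (asField fun _ => coordVec n a) Y x : EuclideanSpace ℝ (Fin n)) ∈ S ↔
      fderiv ℝ (fun y => (Y y : EuclideanSpace ℝ (Fin n))) x (coordVec n a) ∈ S :=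
  iff_of_eq (congrArg (fun v : EuclideanSpace ℝ (Fin n) => v ∈ S) (mlieBracket_coordVec a Y x))

/-- The fields of subspaces `krSpan σ m` on the manifold `ℝ^n`. -/
def krSpanField (n : ℕ) (σ : ℕ → Option ℝ) (m : ℕ) : SubspaceField n (EuclideanSpace ℝ (Fin n)) :=
  fun x => krSpan σ m x

lemma smoothFieldOn_coordVec (a : ℕ) (U : Set (EuclideanSpace ℝ (Fin n))) :
    SmoothFieldOn (asField fun _ => coordVec n a) U :=
  smoothFieldOn_iff_contDiffOn.2 contDiffOn_const

lemma smoothFieldOn_krField (σ : ℕ → Option ℝ) (m : ℕ) (U : Set (EuclideanSpace ℝ (Fin n))) :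
    SmoothFieldOn (asField (krField σ m)) U :=
  smoothFieldOn_iff_contDiffOn.2 (contDiff_krField σ m).contDiffOn

lemma isSectionOn_coordVec {a : ℕ} (ha : m + 1 ≤ a) :
    IsSectionOn (krSpanField n σ m) univ (asField fun _ => coordVec n a) :=
  ⟨smoothFieldOn_coordVec a _, fun _ _ => tail_le_krSpan ha (coordVec_mem_tail le_rfl)⟩

lemma isSectionOn_krField : IsSectionOn (krSpanField n σ m) univ (asField (krField σ m)) :=
  ⟨smoothFieldOn_krField σ m _, fun _ _ => krField_mem_krSpan⟩

/-- In the frame only one field is not constant, so the only brackets that matter are its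
derivatives along coordinate vectors, and the one along `coordVec n (m + 2)` already supplies the
missing dimension. -/
lemma bracketSum_krSpanField (hm : m + 2 < n) :
    bracketSum (krSpanField n σ (m + 1)) = krSpanField n σ m := by
  funext x
  have hbr : ∀ a, m + 2 ≤ a → mlieBracket (𝓡 n) (asField fun _ => coordVec n a)
      (asField (krField σ (m + 1))) x ∈ krSpanField n σ m x :=
    fun a ha => mlieBracket_coordVec_mem_iff.2 (fderiv_krField_mem_krSpan ha)
  refine le_antisymm (bracketSum_le_of_frame isOpen_univ (mem_univ x)
    (e := fun o => asField (krFrame σ (m + 1) o)) ?_ (linearIndependent_krFrame (by omega))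
    (fun _ _ => krSpan_eq_span) (fun o => ?_) fun o o' => ?_) ?_
  · rintro (_ | a)
    · exact smoothFieldOn_krField σ _ _
    · exact smoothFieldOn_coordVec _ _
  · have h : krFrame σ (m + 1) o x ∈ krSpan σ (m + 1) x := by
      rw [krSpan_eq_span]
      exact Submodule.subset_span ⟨o, rfl⟩
    exact krSpan_succ_le h
  · rcases o with _ | a
    · rcases o' with _ | b
      · rw [mlieBracket_self]
        exact zero_mem _
      · rw [mlieBracket_swap_apply]
        exact neg_mem (hbr b.1 b.2)
    · rcases o' with _ | b
      · exact hbr a.1 a.2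
      · refine mlieBracket_coordVec_mem_iff.2 ?_
        change fderiv ℝ (fun _ => coordVec n (b.1 : ℕ)) x _ ∈ krSpan σ m x
        simp
  · exact krSpan_le_of_mem hm (le_bracketSum _ x) (mlieBracket_coordVec_mem_iff.1
      (mlieBracket_mem_bracketSum isOpen_univ (mem_univ x) (isSectionOn_coordVec le_rfl)
        isSectionOn_krField))

lemma isCharacteristicOn_coordVec {a : ℕ} (ha : m + 2 ≤ a) :
    IsCharacteristicOn (krSpanField n σ m) univ (asField fun _ => coordVec n a) :=
  ⟨isSectionOn_coordVec (by omega), fun V hV _ Y hY q hq => mlieBracket_coordVec_mem_iff.2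
    (fderiv_mem_krSpan ha (((smoothFieldOn_iff_contDiffOn.1 hY.1).differentiableOn
      (by simp)).differentiableAt (hV.mem_nhds hq)) (Filter.eventually_of_mem (hV.mem_nhds hq) hY.2))⟩

lemma tail_le_characteristicDistribution :
    tail n (m + 2) ≤ characteristicDistribution (krSpanField n σ m) x := by
  rw [tail_eq_span]
  refine Submodule.span_mono ?_
  rintro _ ⟨a, rfl⟩
  exact ⟨univ, isOpen_univ, mem_univ x, _, isCharacteristicOn_coordVec a.2, rfl⟩

lemma differential_coord (a : ℕ) (v : EuclideanSpace ℝ (Fin n)) :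
    differential n (coord n a) x v = coord n a v := by
  have : mfderiv (𝓡 n) 𝓘(ℝ, ℝ) (coord n a) x = coord n a := by
    rw [mfderiv_eq_fderiv, ContinuousLinearMap.fderiv]
  exact congrArg (fun l => l v) this

lemma mem_tangentSpaceOf_coord {r j : ℕ} (hr : r + j < n) {S : Set (EuclideanSpace ℝ (Fin n))}
    (hS : ∀ y, y ∈ S ↔ ∀ t ≤ j, coord n (r + t) y = 0) (hx : x ∈ S)
    (v : EuclideanSpace ℝ (Fin n)) :
    v ∈ tangentSpaceOf n S x ↔ ∀ t ≤ j, coord n (r + t) v = 0 := by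
  have key := mem_tangentSpaceOf_iff (m := j + 1) isOpen_univ (mem_univ x)
    (h := fun b => coord n (r + b)) (S := S) (fun b => (coord n (r + b)).contMDiff.contMDiffOn)
    ?_ (fun q _ => (hS q).trans ⟨fun h b => h b (by omega), fun h t ht => h ⟨t, by omega⟩⟩) hx v
  · refine key.trans ⟨fun h t ht => ?_, fun h b => ?_⟩
    · exact (differential_coord _ v).symm.trans (h ⟨t, by omega⟩)
    · exact (differential_coord _ v).trans (h b (by omega))
  · have hi : LinearIndependent ℝ fun b : Fin (j + 1) => (coord n (r + b)).toLinearMap := by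
      rw [Fintype.linearIndependent_iff]
      intro g hg b
      have h1 := LinearMap.congr_fun hg (coordVec n (r + b))
      rw [LinearMap.sum_apply, Finset.sum_eq_single b] at h1
      · simpa [coord_coordVec_self (show r + b < n by omega)] using h1
      · intro c _ hcb
        have : coord n (r + c) (coordVec n (r + b)) = 0 :=
          coord_coordVec fun h => hcb (Fin.ext (by omega))
        simp [this]
      · simp
    have he : (fun b : Fin (j + 1) => (coord n (r + b)).toLinearMap) =
        fun b : Fin (j + 1) => differential n (coord n (r + b)) x :=
      funext fun b => LinearMap.ext fun v => (differential_coord (r + (b : ℕ)) v).symm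
    rw [he] at hi
    exact hi

end KumperaRuizFlag

end Goursat

end

noncomputable section

namespace Goursat

/-! ### Canonical sets and singularity type of a normal form -/

section KumperaRuizSets

variable {n : ℕ} (s : KRSequence n) {i j k : ℕ} {x : EuclideanSpace ℝ (Fin n)}

lemma KRSequence.distribution_eq : s.distribution = krSpanField n s.step (n - 2) := by
  have hn := s.three_le
  have htail : tail n (n - 2 + 1) = ℝ ∙ coordVec n (n - 1) := by
    refine le_antisymm ?_ ((Submodule.span_singleton_le_iff_mem _ _).2
      (coordVec_mem_tail (by omega)))
    rw [tail_eq_span, Submodule.span_le]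
    rintro _ ⟨a, rfl⟩
    have h1 := a.2
    have h2 := a.1.2
    have h3 : (a.1 : ℕ) = n - 1 := by omega
    exact (congrArg (fun b => coordVec n b ∈ ℝ ∙ coordVec n (n - 1)) h3).mpr
      (Submodule.mem_span_singleton_self _)
  funext x
  have h : Submodule.span ℝ {s.fields.1 x, s.fields.2 x} = krSpan s.step (n - 2) x := by
    rw [s.fields_eq, krSpan, htail, Submodule.span_insert]
  exact h

lemma KRSequence.derivedFlag_eq (hi : i + 2 ≤ n) :
    derivedFlag s.distribution i = krSpanField n s.step (n - 2 - i) := by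
  induction i with
  | zero => exact s.distribution_eq
  | succ i ih =>
    rw [derivedFlag, ih (by omega), show n - 2 - i = n - 2 - (i + 1) + 1 by omega]
    exact bracketSum_krSpanField (by omega)

theorem KRSequence.isGoursat : IsGoursat s.distribution := by
  have hn := s.three_le
  have hrank : ∀ i : ℕ, i + 2 ≤ n → ∀ p, Module.finrank ℝ (derivedFlag s.distribution i p) = i + 2 := by
    intro i hi p
    rw [s.derivedFlag_eq hi]
    exact (finrank_krSpan (by omega)).trans (by omega)
  refine ⟨fun p => ⟨Set.univ, isOpen_univ, Set.mem_univ p,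
    ![asField s.fields.1, asField s.fields.2], ?_, fun q _ => ?_⟩, hrank⟩
  · rw [s.fields_eq, Fin.forall_fin_two]
    exact ⟨smoothFieldOn_coordVec _ _, smoothFieldOn_krField _ _ _⟩
  · have hspan : s.distribution q = Submodule.span ℝ (Set.range fun a : Fin 2 =>
        (![asField s.fields.1, asField s.fields.2] : Fin 2 → VField n _) a q) := by
      refine congrArg (Submodule.span ℝ) (Set.ext fun v => ?_)
      simp only [Set.mem_range, Fin.exists_fin_two]
      exact or_congr eq_comm eq_comm
    refine ⟨linearIndependent_iff_card_eq_finrank_span.2 ?_, hspan⟩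
    rw [Set.finrank, ← hspan]
    exact (hrank 0 (by omega) q).symm

/-- Coordinate fields are characteristic, which gives one inclusion; equality follows from the rank
`i + 1` supplied by Cartan's lemma. -/
lemma KRSequence.cartanDistribution_eq (hi : i + 4 ≤ n) (x : EuclideanSpace ℝ (Fin n)) :
    cartanDistribution s.distribution i x = tail n (n - 1 - i) := by
  obtain ⟨C, hC⟩ : ∃ C : Submodule ℝ (EuclideanSpace ℝ (Fin n)),
    C = cartanDistribution s.distribution i x := ⟨_, rfl⟩
  have h1 : tail n (n - 1 - i) ≤ C := by
    rw [hC, cartanDistribution, s.derivedFlag_eq (by omega),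
      show n - 1 - i = n - 2 - (i + 1) + 2 by omega]
    exact tail_le_characteristicDistribution
  refine hC.symm.trans (Submodule.eq_of_le_of_finrank_eq h1 ?_).symm
  rw [finrank_tail, hC]
  exact (show n - (n - 1 - i) = i + 1 by omega).trans
    (s.isGoursat.finrank_cartanDistribution hi x).symm

lemma KRSequence.mem_canonicalSet_zero_iff (hi : i + 5 ≤ n) :
    x ∈ canonicalSet s.distribution i 0 ↔
      s.step (n - 3 - i) = none ∧ coord n (n - 3 - i + 2) x = 0 := by
  have h1 : x ∈ canonicalSet s.distribution i 0 ↔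
      krSpan s.step (n - 3 - i + 1) x = tail n (n - 3 - i + 1) := by
    have h2 := s.cartanDistribution_eq (i := i + 1) (by omega) x
    rw [show n - 1 - (i + 1) = n - 3 - i + 1 by omega] at h2
    have h3 : derivedFlag s.distribution i x = krSpan s.step (n - 3 - i + 1) x := by
      rw [s.derivedFlag_eq (by omega), show n - 2 - i = n - 3 - i + 1 by omega]
      rfl
    exact ⟨fun h => h3.symm.trans (h.2.trans h2), fun h => ⟨hi, h3.trans (h.trans h2.symm)⟩⟩
  rw [h1, ← krField_succ_mem_tail_iff (by omega)]
  refine ⟨fun h => h ▸ krField_mem_krSpan, fun h => ?_⟩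
  refine Submodule.eq_of_le_of_finrank_eq
    (sup_le (tail_anti (by omega)) ((Submodule.span_singleton_le_iff_mem _ _).2 h)) ?_
  rw [finrank_krSpan (by omega), finrank_tail]

/-- The tail is a hyperplane of `krSpan` contained in `T`, so the intersection is either the tail or
all of `krSpan`. -/
lemma krSpan_inf_ne_iff {σ : ℕ → Option ℝ} {m : ℕ} {T : Submodule ℝ (EuclideanSpace ℝ (Fin n))}
    (hm : m < n) (hT : tail n (m + 1) ≤ T) :
    krSpan σ m x ⊓ T ≠ tail n (m + 1) ↔ krField σ m x ∈ T := by
  constructor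
  · intro h
    by_contra hY
    refine h (le_antisymm ?_ (le_inf le_sup_left hT))
    rintro v ⟨hv, hvT⟩
    obtain ⟨t, ht, z, hz, rfl⟩ := Submodule.mem_sup.1 hv
    obtain ⟨c, rfl⟩ := Submodule.mem_span_singleton.1 hz
    by_cases hc : c = 0
    · simpa [hc] using ht
    · exact absurd ((Submodule.smul_mem_iff _ hc).1
        ((Submodule.add_mem_iff_right _ (hT ht)).1 hvT)) hY
  · intro hY h
    refine krField_notMem_tail (σ := σ) (x := x) hm ?_
    rw [← h]
    exact ⟨krField_mem_krSpan, hY⟩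

/-- The next canonical set along a run. -/
lemma KRSequence.mem_canonicalSet_succ_iff (hi : i + 5 ≤ n) (hj : j + 1 ≤ i)
    (hrun : IsRun s.step (n - 3 - i) j)
    (hS : ∀ y, y ∈ canonicalSet s.distribution i j ↔
      ∀ t ≤ j, coord n (n - 3 - i + 2 + t) y = 0) :
    x ∈ canonicalSet s.distribution i (j + 1) ↔ (∀ t ≤ j, coord n (n - 3 - i + 2 + t) x = 0) ∧
      ∃ c, s.step (n - 3 - i + (j + 1)) = some c ∧
        coord n (n - 3 - i + 2 + (j + 1)) x + c = 0 := by
  obtain ⟨k, hk⟩ : ∃ k, k = n - 3 - i := ⟨_, rfl⟩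
  rw [← hk] at hrun hS ⊢
  have hmem : x ∈ canonicalSet s.distribution i (j + 1) ↔ x ∈ canonicalSet s.distribution i j ∧
      derivedFlag s.distribution (i - (j + 1)) x ⊓
        tangentSpaceOf n (canonicalSet s.distribution i j) x ≠
          cartanDistribution s.distribution (i - (j + 1)) x :=
    ⟨fun h => h.2, fun h => ⟨hj, h⟩⟩
  rw [hmem]
  refine Iff.trans (and_congr_right fun hx => ?_) (and_congr_left fun _ => hS x)
  have hx0 := (hS x).1 hx
  obtain ⟨T, hTdef⟩ : ∃ T : Submodule ℝ (EuclideanSpace ℝ (Fin n)),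
    T = tangentSpaceOf n (canonicalSet s.distribution i j) x := ⟨_, rfl⟩
  have hT : ∀ v, v ∈ T ↔ ∀ t ≤ j, coord n (k + 2 + t) v = 0 := by
    rw [hTdef]
    exact mem_tangentSpaceOf_coord (by omega) hS hx
  have hTle : tail n (k + j + 2 + 1) ≤ T := fun v hv => (hT v).2 fun t ht => by
    rw [coord_of_lt (by omega)]
    exact hv _ (show k + 2 + t < k + j + 2 + 1 by omega)
  have h1 : derivedFlag s.distribution (i - (j + 1)) x ⊓
        tangentSpaceOf n (canonicalSet s.distribution i j) x ≠
          cartanDistribution s.distribution (i - (j + 1)) x ↔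
      krSpan s.step (k + j + 2) x ⊓ T ≠ tail n (k + j + 2 + 1) := by
    rw [s.derivedFlag_eq (by omega), s.cartanDistribution_eq (by omega), hTdef,
      show n - 2 - (i - (j + 1)) = k + j + 2 by omega,
      show n - 1 - (i - (j + 1)) = k + j + 2 + 1 by omega]
    rfl
  rw [h1, krSpan_inf_ne_iff (by omega) hTle, hT]
  -- On the locus the steps `R_0` add nothing, so the field is still the one at the start of the run
  -- and has no component beyond index `k + 1`.
  have hbase : ∀ b, k + 1 < b → coord n b (krField s.step (k + 1 + j) x) = 0 := by
    intro b hb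
    rw [hrun.krField_eq fun t _ ht => hx0 t ht]
    by_cases hbn : b < n
    · rw [coord_of_lt hbn]
      exact krField_apply_of_lt hb
    · simp [coord, hbn]
  -- Tangency depends on the component of the next field along axis `k + 2 + j`: it is `1` after a
  -- singular step and the next coordinate plus `c` after `R_c`.
  rcases hs : s.step (k + (j + 1)) with _ | c
  · simp only [reduceCtorEq, false_and, exists_false, iff_false]
    intro h
    have h2 := h j le_rfl
    rw [krField_none (k := k + j + 1) hs, map_add, map_smul,
      show k + j + 1 = k + 1 + j by omega, hbase _ (by omega), show k + 1 + j + 1 = k + 2 + j by omega,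
      coord_coordVec_self (by omega)] at h2
    simp at h2
  · rw [krField_some (k := k + j + 1) hs]
    have h2 : ∀ t ≤ j, coord n (k + 2 + t) ((coord n (k + j + 1 + 2) x + c) •
        coordVec n (k + j + 1 + 1) + krField s.step (k + j + 1) x) =
          (coord n (k + j + 1 + 2) x + c) * coord n (k + 2 + t) (coordVec n (k + 2 + j)) := by
      intro t ht
      rw [map_add, map_smul, show k + j + 1 = k + 1 + j by omega, hbase _ (by omega), add_zero,
        smul_eq_mul, show k + 1 + j + 1 = k + 2 + j by omega]
    constructor
    · intro h
      refine ⟨c, rfl, ?_⟩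
      have h3 := h j le_rfl
      rw [h2 j le_rfl, coord_coordVec_self (by omega), mul_one] at h3
      rwa [show k + 2 + (j + 1) = k + j + 1 + 2 by omega]
    · rintro ⟨c', hc', h3⟩ t ht
      obtain rfl : c = c' := by simpa using hc'
      rw [h2 t ht, show k + j + 1 + 2 = k + 2 + (j + 1) by omega, h3, zero_mul]

/-- Both claims go through one induction: deciding whether the origin is in the next set requires
the tangent space of the current one, hence its full description. A step `R_c` prolongs the run to
the locus where the next coordinate equals `-c`, which meets the origin only for `c = 0`. -/
lemma KRSequence.canonicalSet_spec (hi : i + 5 ≤ n) (hj : j ≤ i) :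
    (0 ∈ canonicalSet s.distribution i j ↔ IsRun s.step (n - 3 - i) j) ∧
      (IsRun s.step (n - 3 - i) j → ∀ y, y ∈ canonicalSet s.distribution i j ↔
        ∀ t ≤ j, coord n (n - 3 - i + 2 + t) y = 0) := by
  induction j with
  | zero =>
    constructor
    · rw [s.mem_canonicalSet_zero_iff hi, map_zero]
      exact ⟨fun h => ⟨by omega, h.1, fun t _ _ => by omega⟩, fun h => ⟨h.2.1, rfl⟩⟩
    · intro h y
      rw [s.mem_canonicalSet_zero_iff hi]
      refine ⟨fun hy t ht => ?_, fun hy => ⟨h.2.1, hy 0 le_rfl⟩⟩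
      obtain rfl : t = 0 := by omega
      exact hy.2
  | succ j ih =>
    obtain ⟨ih1, ih2⟩ := ih (by omega)
    have hrun : IsRun s.step (n - 3 - i) (j + 1) → IsRun s.step (n - 3 - i) j :=
      fun h => ⟨h.1, h.2.1, fun t h3 h4 => h.2.2 t h3 (by omega)⟩
    constructor
    · constructor
      · intro h
        have h1 := ih1.1 (canonicalSet_succ_subset _ _ _ h)
        obtain ⟨-, c, hc, hc0⟩ := (s.mem_canonicalSet_succ_iff hi hj h1 (ih2 h1)).1 h
        rw [map_zero, zero_add] at hc0
        refine ⟨h1.1, h1.2.1, fun t h3 h4 => ?_⟩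
        rcases h4.eq_or_lt with rfl | h4
        · rw [hc, hc0]
        · exact h1.2.2 t h3 (by omega)
      · intro h
        refine (s.mem_canonicalSet_succ_iff hi hj (hrun h) (ih2 (hrun h))).2
          ⟨fun t _ => map_zero _, 0, h.2.2 (j + 1) (by omega) le_rfl, ?_⟩
        rw [map_zero, add_zero]
    · intro h y
      rw [s.mem_canonicalSet_succ_iff hi hj (hrun h) (ih2 (hrun h)),
        h.2.2 (j + 1) (by omega) le_rfl]
      constructor
      · rintro ⟨h1, c, hc, hc0⟩ t ht
        obtain rfl : 0 = c := by simpa using hc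
        rcases ht.eq_or_lt with rfl | ht
        · rwa [add_zero] at hc0
        · exact h1 t (by omega)
      · intro hy
        exact ⟨fun t ht => hy t (by omega), 0, rfl, by rw [add_zero]; exact hy _ le_rfl⟩

theorem KRSequence.zero_mem_canonicalSet_iff :
    0 ∈ canonicalSet s.distribution i j ↔ i + 5 ≤ n ∧ j ≤ i ∧ IsRun s.step (n - 3 - i) j := by
  constructor
  · intro h
    obtain ⟨hi, hj⟩ := le_of_mem_canonicalSet h
    exact ⟨hi, hj, (s.canonicalSet_spec hi hj).1.1 h⟩
  · rintro ⟨hi, hj, h⟩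
    exact (s.canonicalSet_spec hi hj).1.2 h

theorem KRSequence.canonicalSet_eq (h : 0 ∈ canonicalSet s.distribution i j) :
    canonicalSet s.distribution i j =
      {x | ∀ a : Fin n, n - i ≤ (a : ℕ) + 1 → (a : ℕ) + 1 ≤ n - i + j → x a = 0} := by
  obtain ⟨hi, hj, hrun⟩ := s.zero_mem_canonicalSet_iff.1 h
  ext y
  -- The zero-based index `n - 3 - i + 2` is that of the coordinate `x_{n-i}`.
  rw [(s.canonicalSet_spec hi hj).2 hrun y]
  constructor
  · intro hy a ha1 ha2
    have := hy (a - (n - 3 - i + 2)) (by omega)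
    rwa [show n - 3 - i + 2 + ((a : ℕ) - (n - 3 - i + 2)) = a by omega, coord_val] at this
  · intro hy t ht
    rw [coord_of_lt (by omega)]
    exact hy _ (by simp only; omega) (by simp only; omega)

theorem KRSequence.isSingularityType : IsSingularityType s.distribution 0 s.word := by
  have hn := s.three_le
  -- The letter `w_i` comes from step `n - 3 - i`, where a run begun at step `n - 3 - (i + j)` has
  -- continued for `j` steps.
  refine ⟨fun i => stepLetter s.step (n - 3 - i), fun i hi => ⟨fun j h => ?_, fun h => ?_⟩, ?_⟩
  · obtain ⟨h1, -, h2⟩ := s.zero_mem_canonicalSet_iff.1 h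
    have := h2.stepLetter le_rfl
    rwa [show n - 3 - (i + j) + j = n - 3 - i by omega] at this
  · rcases hl : stepLetter s.step (n - 3 - i) with _ | j
    · exact hl
    · obtain ⟨hj, hrun⟩ := stepLetter_eq_succ_iff.1 hl
      have h2 := hrun.1
      refine absurd (s.zero_mem_canonicalSet_iff.2 ⟨by omega, by omega, ?_⟩) (h j)
      rwa [show n - 3 - (i + j) = n - 3 - i - j by omega]
  · rw [s.word_eq, map_reverse_range]
    refine List.map_congr_left fun i hi => ?_
    have := List.mem_range.1 hi
    rw [show n - 3 - (n - 3 - 1 - i) = i + 1 by omega]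

end KumperaRuizSets

end Goursat

end

/-- Smoothness and disjointness of the canonical sets, their description in Kumpera–Ruiz
coordinates, and the description of singularity types by the Jacquard language. -/
theorem mainTheorem11 (n : ℕ) (hn : 3 ≤ n) :
    -- arbitrary Goursat structures on smooth manifolds of dimension `n`
    (∀ (M : Type u) [TopologicalSpace M] [T2Space M] [SecondCountableTopology M]
        [ChartedSpace (EuclideanSpace ℝ (Fin n)) M] [IsManifold (𝓡 n) ∞ M]
        (D : Goursat.SubspaceField n M), Goursat.IsGoursat D →
      (∀ i j : ℕ, Goursat.canonicalSet D i j = ∅ ∨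
        Goursat.IsSubmanifoldOfCodim n (Goursat.canonicalSet D i j) (j + 1)) ∧
      (∀ i j k : ℕ, k ≠ j →
        Goursat.canonicalSet D (i + j) j ∩ Goursat.canonicalSet D (i + k) k = ∅) ∧
      (∀ p : M, ∃! w : List ℕ, Goursat.IsSingularityType D p w) ∧
      (∀ (p : M) (w : List ℕ), Goursat.IsSingularityType D p w → w ∈ Goursat.jacquard (n - 3))) ∧
    -- Kumpera–Ruiz normal forms
    (∀ s : Goursat.KRSequence n,
      Goursat.IsGoursat s.distribution ∧
      s.word ∈ Goursat.jacquard (n - 3) ∧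
      Goursat.IsSingularityType s.distribution 0 s.word ∧
      (∀ i j : ℕ, j ≤ i →
        ((0 : EuclideanSpace ℝ (Fin n)) ∈ Goursat.canonicalSet s.distribution i j ↔
          ∃ w₁ w₂ : List ℕ, w₂.length = i - j ∧
            s.word = w₁ ++ Goursat.ascendingWord (j + 1) ++ w₂)) ∧
      (∀ i j : ℕ, (0 : EuclideanSpace ℝ (Fin n)) ∈ Goursat.canonicalSet s.distribution i j →
        Goursat.canonicalSet s.distribution i j =
          {x | ∀ a : Fin n, n - i ≤ (a : ℕ) + 1 → (a : ℕ) + 1 ≤ n - i + j → x a = 0})) ∧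
    -- every word of the Jacquard language occurs
    (∀ w ∈ Goursat.jacquard (n - 3),
      ∃ (D : Goursat.SubspaceField n (EuclideanSpace ℝ (Fin n))) (p : EuclideanSpace ℝ (Fin n)),
        Goursat.IsGoursat D ∧ Goursat.IsSingularityType D p w) := by
  -- The submanifold condition is vacuous for the empty set, so the second alternative always holds.
  refine ⟨fun M _ _ _ _ _ D hD => ⟨fun i j => Or.inr (hD.isSubmanifoldOfCodim i j),
      hD.canonicalSet_inter_eq_empty, hD.existsUnique_isSingularityType,
      fun p w hw => hw.mem_jacquard⟩,
    fun s => ⟨s.isGoursat, s.word_mem_jacquard, s.isSingularityType, fun i j hj => ?_,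
      fun i j h => s.canonicalSet_eq h⟩, fun w hw => ?_⟩
  · rw [s.zero_mem_canonicalSet_iff, s.exists_word_eq_iff hj]
    exact and_congr_right fun _ => and_iff_right hj
  · obtain ⟨n', s, rfl⟩ := Goursat.exists_word_eq hw
    -- The length of the word fixes the dimension, since both dimensions are at least three.
    obtain rfl : n' = n := by
      have h1 := Goursat.length_of_mem_jacquard hw
      rw [s.length_word] at h1
      have h2 := s.three_le
      omega
    exact ⟨s.distribution, 0, s.isGoursat, s.isSingularityType⟩
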